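/- **Setting.** Let $\mathcal X\subset\mathbb R^{d_x}$ (states) and $\mathcal A\subset\mathbb R^{d_a}$ (actions) be finite and non-empty, $d=d_x+d_a$, $K=|\mathcal A|$. Write $\zeta=(x,a)\in\mathbb R^d$ for the concatenated vector. Let $p(z|x,a)$ be transition probabilities, $r(x,a)$ a reward, $\gamma\in(0,1]$, $0<\alpha<\infty$, $T>0$. Let $(x_k,a_k)_{k\ge0}$ be the controlled Markov chain under pure exploration, with arbitrary initial law: given the past and $x_k$, $a_k$ is uniform on $\mathcal A$; given the past and $(x_k,a_k)$, $x_{k+1}\sim p(\cdot|x_k,a_k)$. Assume there is a probability mass function $\pi>0$ on $\mathcal X$ such that, for every initial state, $\frac1n\sum_{k=1}^n\mathbf 1_{\{x_k=s\}}\to\pi(s)$ almost surely for every $s$; put $\pi(x,a)=\pi(x)/K$. Let $\sigma\in C^2_b(\mathbb R)$ ($C^2$, with $\sigma,\sigma',\sigma''$ bounded). Let $(C^i_0,W^i_0)_{i\ge1}$ be i.i.d. in $\mathbb R\times\mathbb R^d$ with law $\mu_0$, where $\mu_0$ is absolutely continuous with respect to Lebesgue measure, $C^i_0$ is bounded, $\int\|w\|\,d\mu_0<\infty$,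 $C^i_0$ and $W^i_0$ have mean zero, and $C_0^i$ is independent of $W_0^i$. For $N\ge1$ let $Q^N(\zeta;\theta)=\frac1{\sqrt N}\sum_{i=1}^N C^i\sigma(W^i\cdot\zeta)$, and train the parameters $\theta_k=(C^i_k,W^i_k)_{i\le N}$ by Q-learning with learning rate $\alpha/N$: $$C^i_{k+1}=C^i_k+\tfrac{\alpha}{N^{3/2}}\,\delta_k\,\sigma(W^i_k\cdot\zeta_k),\qquad W^i_{k+1}=W^i_k+\tfrac{\alpha}{N^{3/2}}\,\delta_k\,C^i_k\,\sigma'(W^i_k\cdot\zeta_k)\,\zeta_k,$$ $$\zeta_k=(x_k,a_k),\qquad \delta_k=r(\zeta_k)+\gamma\max_{a'\in\mathcal A}Q^N((x_{k+1},a');\theta_k)-Q^N(\zeta_k;\theta_k).$$ Set $\mu^N_t=\frac1N\sum_{i=1}^N\delta_{(C^i_{\lfloor Nt\rfloor},W^i_{\lfloor Nt\rfloor})}$, $h^N_t(\zeta)=Q^N(\zeta;\theta_{\lfloor Nt\rfloor})$ and $E=\mathcal M(\mathbb R^{1+d})\times\mathbb R^{\mathcal X\times\mathcal A}$, where $\mathcal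 M(\mathbb R^{1+d})$ is the space of probability measures with the weak topology. **Theorem.** (i) As $N\to\infty$, $(\mu^N_t,h^N_t)_{0\le t\le T}$ converges in distribution in the Skorokhod space $D_E([0,T])$ to a random element $(\mu_t,h_t)$ such that almost surely, for all $t\in[0,T]$, $\zeta\in\mathcal X\times\mathcal A$ and $f\in C^2_b(\mathbb R^{1+d})$, $$h_t(\zeta)=h_0(\zeta)+\int_0^t\sum_{\zeta'\in\mathcal X\times\mathcal A}\pi(\zeta')A_{\zeta,\zeta'}\Big(r(\zeta')+\gamma\sum_{z\in\mathcal X}\max_{a''\in\mathcal A}h_s(z,a'')\,p(z|\zeta')-h_s(\zeta')\Big)ds,$$ $$h_0(\zeta)=\mathcal G(\zeta),\qquad \langle f,\mu_t\rangle=\langle f,\mu_0\rangle,\quad\text{hence }\mu_t=\mu_0.$$ Here $\mathcal G$ is a mean-zero Gaussian vector with covariance $\mathbb E[\mathcal G(\zeta)\mathcal G(\zeta')]=\langle c^2\sigma(w\cdot\zeta)\sigma(w\cdot\zeta'),\mu_0\rangle$ and $$A_{\zeta,\zeta'}=\alpha\langle\sigma(w\cdot\zeta')\sigma(w\cdot\zeta),\mu_0\rangle+\alpha\langle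 c^2\sigma'(w\cdot\zeta')\sigma'(w\cdot\zeta)\,\zeta'\cdot\zeta,\mu_0\rangle.$$ (ii) Suppose moreover that $\gamma<1$; that $\sigma$ is not a polynomial and is slowly increasing ($\sigma(t)/t^b\to0$ as $t\to\infty$ for every $b>0$); that for some $B$ one has $C^i_0\in[-B,B]$ almost surely and $\mu_0(\Gamma)>0$ for every measurable $\Gamma\subset[-B,B]\times\mathbb R^d$ of positive Lebesgue measure; and that the vectors $\zeta\in\mathcal X\times\mathcal A$ are in distinct directions (all non-zero, no two parallel). Then the Bellman equation $$0=r(\zeta)+\gamma\sum_{z\in\mathcal X}\max_{a'\in\mathcal A}V(z,a')\,p(z|\zeta)-V(\zeta)\qquad(\zeta\in\mathcal X\times\mathcal A)$$ has a unique solution $V$, and $V$ is the unique stationary point of the ODE for $h$, i.e. the unique $h\in\mathbb R^{\mathcal X\times\mathcal A}$ with $\sum_{\zeta'}\pi(\zeta')A_{\zeta,\zeta'}\big(r(\zeta')+\gamma\sum_z\max_{a''}h(z,a'')p(z|\zeta')-h(\zeta')\big)=0$ for all $\zeta$. -/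

import Mathlib

open MeasureTheory ProbabilityTheory Filter Topology

open scoped ENNReal

noncomputable section

namespace QLearning

/-! ### Skorokhod space of right-continuous paths with left limits on `[0, T]` -/

/-- Right-continuous paths with left limits `[0, T] → E`. -/
structure SkorokhodSpace (T : ℝ) (E : Type*) [TopologicalSpace E] where
  toFun : Set.Icc (0 : ℝ) T → E
  right_continuous : ∀ t, ContinuousWithinAt toFun (Set.Ici t) t
  left_limits : ∀ t, ∃ l, Tendsto toFun (𝓝[<] t) (𝓝 l)

namespace SkorokhodSpace

variable {T : ℝ} {E : Type*}

instance [TopologicalSpace E] : CoeFun (SkorokhodSpace T E) (fun _ => Set.Icc (0 : ℝ) T → E) :=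
  ⟨toFun⟩

/-- The cost of a time change (an increasing homeomorphism `τ` of `[0, T]` onto itself):
the larger of `sup_t |τ t - t|` and `sup_t d (u t, v (τ t))`. -/
def cost [PseudoEMetricSpace E] (u v : SkorokhodSpace T E)
    (τ : Set.Icc (0 : ℝ) T ≃o Set.Icc (0 : ℝ) T) : ℝ≥0∞ :=
  max (⨆ t, edist (τ t) t) (⨆ t, edist (u t) (v (τ t)))

/-- The Skorokhod (J1) distance: the infimum of the cost over all time changes. -/
instance [PseudoEMetricSpace E] : PseudoEMetricSpace (SkorokhodSpace T E) where
  edist u v := ⨅ τ, cost u v τ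
  edist_self u := by
    refine le_antisymm ((iInf_le _ (OrderIso.refl _)).trans ?_) bot_le
    simp [cost]
  edist_comm u v := by
    have key : ∀ u v : SkorokhodSpace T E, (⨅ τ, cost u v τ) ≤ ⨅ τ, cost v u τ := by
      intro u v
      refine le_iInf fun τ => (iInf_le _ τ.symm).trans ?_
      refine max_le_max (iSup_le fun t => ?_) (iSup_le fun t => ?_)
      · refine le_trans ?_ (le_iSup _ (τ.symm t))
        rw [τ.apply_symm_apply, edist_comm]
      · refine le_trans ?_ (le_iSup _ (τ.symm t))
        rw [τ.apply_symm_apply, edist_comm]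
    exact le_antisymm (key u v) (key v u)
  edist_triangle u v w := by
    refine ENNReal.le_iInf_add_iInf fun τ τ' => (iInf_le _ (τ.trans τ')).trans ?_
    refine max_le (iSup_le fun t => ?_) (iSup_le fun t => ?_)
    · calc edist ((τ.trans τ') t) t ≤ edist (τ' (τ t)) (τ t) + edist (τ t) t :=
            edist_triangle _ _ _
        _ ≤ cost v w τ' + cost u v τ :=
            add_le_add ((le_iSup (fun s => edist (τ' s) s) (τ t)).trans (le_max_left _ _))
              ((le_iSup (fun s => edist (τ s) s) t).trans (le_max_left _ _))
        _ = _ := add_comm _ _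
    · calc edist (u t) (w ((τ.trans τ') t))
            ≤ edist (u t) (v (τ t)) + edist (v (τ t)) (w (τ' (τ t))) := edist_triangle _ _ _
        _ ≤ cost u v τ + cost v w τ' :=
            add_le_add ((le_iSup (fun s => edist (u s) (v (τ s))) t).trans (le_max_right _ _))
              ((le_iSup (fun s => edist (v s) (w (τ' s))) (τ t)).trans (le_max_right _ _))

/-- The Borel σ-algebra of the Skorokhod topology. -/
instance [PseudoEMetricSpace E] : MeasurableSpace (SkorokhodSpace T E) :=
  borel _

instance [PseudoEMetricSpace E] : BorelSpace (SkorokhodSpace T E) :=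
  ⟨rfl⟩

/-- The path `t ↦ u ⌊N t⌋` attached to a sequence `u`. -/
def ofSeq [TopologicalSpace E] (T : ℝ) (N : ℕ) (u : ℕ → E) : SkorokhodSpace T E where
  toFun t := u ⌊(N : ℝ) * t⌋₊
  right_continuous t := by
    have h0 : (0 : ℝ) ≤ (N : ℝ) * t := mul_nonneg (Nat.cast_nonneg _) t.2.1
    have hlt : (N : ℝ) * t < ⌊(N : ℝ) * t⌋₊ + 1 := Nat.lt_floor_add_one _
    have hc : Continuous fun s : Set.Icc (0 : ℝ) T => (N : ℝ) * s := by fun_prop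
    have hev : ∀ᶠ s : Set.Icc (0 : ℝ) T in 𝓝[Set.Ici t] t, u ⌊(N : ℝ) * t⌋₊ = u ⌊(N : ℝ) * s⌋₊ := by
      filter_upwards [self_mem_nhdsWithin,
        nhdsWithin_le_nhds (hc.continuousAt.preimage_mem_nhds (Iio_mem_nhds hlt))] with s hs hs'
      have hs'' : (N : ℝ) * t ≤ N * s :=
        mul_le_mul_of_nonneg_left (show (t : ℝ) ≤ s from hs) (Nat.cast_nonneg _)
      have hfl : ⌊(N : ℝ) * s⌋₊ = ⌊(N : ℝ) * t⌋₊ :=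
        (Nat.floor_eq_iff (h0.trans hs'')).2 ⟨(Nat.floor_le h0).trans hs'', hs'⟩
      rw [hfl]
    exact tendsto_const_nhds.congr' hev
  left_limits t := by
    have hc : Continuous fun s : Set.Icc (0 : ℝ) T => (N : ℝ) * s := by fun_prop
    refine ⟨u (⌈(N : ℝ) * t⌉₊ - 1), ?_⟩
    have hev : ∀ᶠ s : Set.Icc (0 : ℝ) T in 𝓝[<] t, u (⌈(N : ℝ) * t⌉₊ - 1) = u ⌊(N : ℝ) * s⌋₊ := by
      rcases Nat.eq_zero_or_pos N with hN | hN
      · subst hN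
        simp
      · have hN' : (0 : ℝ) < N := Nat.cast_pos.2 hN
        rcases Nat.eq_zero_or_pos ⌈(N : ℝ) * t⌉₊ with hz | hz
        · filter_upwards [self_mem_nhdsWithin] with s hs
          have h1 : (N : ℝ) * t ≤ 0 := Nat.ceil_eq_zero.1 hz
          have h2 : (N : ℝ) * s < N * t :=
            mul_lt_mul_of_pos_left (show (s : ℝ) < t from hs) hN'
          have h3 : (0 : ℝ) ≤ (N : ℝ) * s := mul_nonneg hN'.le s.2.1
          linarith
        · have hlt : ((⌈(N : ℝ) * t⌉₊ - 1 : ℕ) : ℝ) < (N : ℝ) * t :=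
            Nat.lt_ceil.1 (Nat.sub_lt hz one_pos)
          filter_upwards [self_mem_nhdsWithin,
            nhdsWithin_le_nhds (hc.continuousAt.preimage_mem_nhds (Ioi_mem_nhds hlt))] with s hs hs'
          have h2 : (N : ℝ) * s < N * t :=
            mul_lt_mul_of_pos_left (show (s : ℝ) < t from hs) hN'
          have h3 : (0 : ℝ) ≤ (N : ℝ) * s := mul_nonneg hN'.le s.2.1
          have h4 : ((⌈(N : ℝ) * t⌉₊ - 1 : ℕ) : ℝ) + 1 = ⌈(N : ℝ) * t⌉₊ := by
            rw [Nat.cast_sub hz]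
            simp
          have hfl : ⌊(N : ℝ) * s⌋₊ = ⌈(N : ℝ) * t⌉₊ - 1 := by
            refine (Nat.floor_eq_iff h3).2 ⟨le_of_lt hs', ?_⟩
            rw [h4]
            exact h2.trans_le (Nat.le_ceil _)
          rw [hfl]
    exact tendsto_const_nhds.congr' hev

end SkorokhodSpace

/-! ### Activation function and parameter law -/

/-- The class `C²_b`: twice continuously differentiable, bounded together with the
derivatives of orders one and two. -/
def IsC2b {F : Type*} [NormedAddCommGroup F] [NormedSpace ℝ F] (f : F → ℝ) : Prop :=
  ContDiff ℝ 2 f ∧ ∃ K : ℝ, ∀ j : ℕ, j ≤ 2 → ∀ y, ‖iteratedFDeriv ℝ j f y‖ ≤ K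

def NonPolynomial (σ : ℝ → ℝ) : Prop :=
  ¬ ∃ q : Polynomial ℝ, ∀ t, σ t = q.eval t

def SlowlyIncreasing (σ : ℝ → ℝ) : Prop :=
  ∀ b : ℝ, 0 < b → Tendsto (fun t => σ t / t ^ b) atTop (𝓝 0)

/-- The parameters `(c, w) ∈ ℝ × ℝ^d` of one hidden unit. -/
abbrev Param (d : ℕ) : Type :=
  ℝ × EuclideanSpace ℝ (Fin d)

/-- The standing assumptions on the law of the initial parameters `(c, w)` of one unit. -/
structure IsInitialLaw {d : ℕ} (μ₀ : Measure (Param d)) : Prop where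
  isProbabilityMeasure : IsProbabilityMeasure μ₀
  absolutelyContinuous : μ₀ ≪ volume
  indep : IndepFun Prod.fst Prod.snd μ₀
  bounded_c : ∃ B : ℝ, ∀ᵐ θ ∂μ₀, |θ.1| ≤ B
  integrable_w : Integrable (fun θ => ‖θ.2‖) μ₀
  mean_c : ∫ θ, θ.1 ∂μ₀ = 0
  mean_w : ∫ θ, θ.2 ∂μ₀ = 0

/-- For some `B`, the first coordinate lies in `[-B, B]` and every subset of
`[-B, B] × ℝ^d` of positive Lebesgue measure is charged. -/
def HasFullSupport {d : ℕ} (μ₀ : Measure (Param d)) : Prop :=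
  ∃ B : ℝ, (∀ᵐ θ ∂μ₀, θ.1 ∈ Set.Icc (-B) B) ∧
    ∀ Γ : Set (Param d), MeasurableSet Γ → Γ ⊆ Set.Icc (-B) B ×ˢ Set.univ →
      0 < volume Γ → 0 < μ₀ Γ

/-- The empirical measure `N⁻¹ ∑ i, δ_{θ i}`. -/
def empiricalMeasure {d N : ℕ} [NeZero N] (θ : Fin N → Param d) :
    ProbabilityMeasure (Param d) :=
  ⟨(N : ℝ≥0∞)⁻¹ • ∑ i, Measure.dirac (θ i), ⟨by
    simp [ENNReal.inv_mul_cancel (Nat.cast_ne_zero.2 (NeZero.ne N)) (ENNReal.natCast_ne_top N)]⟩⟩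

/-! ### Markov decision problems with finite state and action spaces -/

/-- A Markov decision problem with finite state space in `ℝ^{dx}` and finite action space in
`ℝ^{da}`: `p z x a` is the probability to move from `x` to `z` under the action `a`, and
`r x a` is the reward. -/
structure MDP (dx da : ℕ) where
  states : Finset (EuclideanSpace ℝ (Fin dx))
  actions : Finset (EuclideanSpace ℝ (Fin da))
  states_nonempty : states.Nonempty
  actions_nonempty : actions.Nonempty
  p : states → states → actions → ℝ
  p_nonneg : ∀ z x a, 0 ≤ p z x a
  p_sum : ∀ x a, ∑ z, p z x a = 1
  r : states → actions → ℝ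

namespace MDP

variable {dx da : ℕ} (M : MDP dx da)

/-- State-action pairs. -/
abbrev Pair : Type :=
  M.states × M.actions

/-- The vector `(x, a) ∈ ℝ^{dx + da}`. -/
def vec (ζ : M.Pair) : EuclideanSpace ℝ (Fin (dx + da)) :=
  WithLp.toLp 2 (Fin.append (ζ.1 : EuclideanSpace ℝ (Fin dx)).ofLp
    (ζ.2 : EuclideanSpace ℝ (Fin da)).ofLp)

/-- The vectors `(x, a)` are non-zero and no two of them are parallel. -/
def DistinctDirections : Prop :=
  (∀ ζ, M.vec ζ ≠ 0) ∧
    ∀ ζ ζ', ζ ≠ ζ' → LinearIndependent ℝ ![M.vec ζ, M.vec ζ']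

/-- `max_{a} h (z, a)`; the supremum is over a finite non-empty set. -/
def maxAction (h : M.Pair → ℝ) (z : M.states) : ℝ :=
  M.actions.attach.sup' (Finset.attach_nonempty_iff.2 M.actions_nonempty) fun a => h (z, a)

/-- The Bellman residual `r (x, a) + γ ∑_z max_{a'} h (z, a') p (z | x, a) - h (x, a)`. -/
def bellmanResidual (γ : ℝ) (h : M.Pair → ℝ) (ζ : M.Pair) : ℝ :=
  M.r ζ.1 ζ.2 + γ * ∑ z, M.maxAction h z * M.p z ζ.1 ζ.2 - h ζ

def SolvesBellman (γ : ℝ) (V : M.Pair → ℝ) : Prop :=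
  ∀ ζ, M.bellmanResidual γ V ζ = 0

/-- `(x_k, a_k)` is the controlled Markov chain under pure exploration: given the past and the
current state, the action is uniform on the action space; given the past and the current
state-action pair, the next state has law `p (· | x_k, a_k)`. -/
structure IsExplorationChain {Ω : Type*} [MeasurableSpace Ω] (P : Measure Ω)
    (x : ℕ → Ω → M.states) (a : ℕ → Ω → M.actions) : Prop where
  measurable_state : ∀ k, Measurable (x k)
  measurable_action : ∀ k, Measurable (a k)
  action_uniform : ∀ (n : ℕ) (u : ℕ → M.states) (b : ℕ → M.actions),
    P.real {ω | (∀ k ≤ n, x k ω = u k) ∧ (∀ k ≤ n, a k ω = b k)} =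
      P.real {ω | (∀ k ≤ n, x k ω = u k) ∧ (∀ k < n, a k ω = b k)} * (M.actions.card : ℝ)⁻¹
  transition : ∀ (n : ℕ) (u : ℕ → M.states) (b : ℕ → M.actions),
    P.real {ω | (∀ k ≤ n + 1, x k ω = u k) ∧ (∀ k ≤ n, a k ω = b k)} =
      P.real {ω | (∀ k ≤ n, x k ω = u k) ∧ (∀ k ≤ n, a k ω = b k)} * M.p (u (n + 1)) (u n) (b n)

/-- `ϖ` is a strictly positive probability mass function and, for the chain started from any
state `z`, almost surely the fraction of time spent in each state `s` tends to `ϖ s`. -/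
structure IsLimitingDistribution (ϖ : M.states → ℝ) : Prop where
  pos : ∀ s, 0 < ϖ s
  sum_eq_one : ∑ s, ϖ s = 1
  tendsto_occupation : ∀ (z : M.states) (Ω : Type) [MeasurableSpace Ω] (P : Measure Ω)
    [IsProbabilityMeasure P] (x : ℕ → Ω → M.states) (a : ℕ → Ω → M.actions),
    M.IsExplorationChain P x a → (∀ᵐ ω ∂P, x 0 ω = z) →
      ∀ s, ∀ᵐ ω ∂P, Tendsto
        (fun n : ℕ => (n : ℝ)⁻¹ * ∑ k ∈ Finset.Icc 1 n, if x k ω = s then (1 : ℝ) else 0)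
        atTop (𝓝 (ϖ s))

/-! ### The Q-network and its training -/

/-- The Q-network `N^{-1/2} ∑ i, C^i σ (W^i · (x, a))`. -/
def qNet (σ : ℝ → ℝ) {N : ℕ} (θ : Fin N → Param (dx + da)) (ζ : M.Pair) : ℝ :=
  (√(N : ℝ))⁻¹ * ∑ i, (θ i).1 * σ (inner ℝ (θ i).2 (M.vec ζ))

/-- `r (x, a) + γ max_{a'} Q (x', a'; θ) - Q (x, a; θ)` for a transition from `ζ = (x, a)`
to the state `x'`. -/
def tdError (σ : ℝ → ℝ) (γ : ℝ) {N : ℕ} (θ : Fin N → Param (dx + da)) (ζ : M.Pair)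
    (x' : M.states) : ℝ :=
  M.r ζ.1 ζ.2 + γ * M.maxAction (M.qNet σ θ) x' - M.qNet σ θ ζ

/-- One Q-learning update with learning rate `η`. -/
def qStep (σ : ℝ → ℝ) (γ η : ℝ) {N : ℕ} (θ : Fin N → Param (dx + da)) (ζ : M.Pair)
    (x' : M.states) : Fin N → Param (dx + da) := fun i =>
  ((θ i).1 + η / √(N : ℝ) * M.tdError σ γ θ ζ x' * σ (inner ℝ (θ i).2 (M.vec ζ)),
   (θ i).2 + (η / √(N : ℝ) * M.tdError σ γ θ ζ x' * (θ i).1 *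
      deriv σ (inner ℝ (θ i).2 (M.vec ζ))) • M.vec ζ)

/-- The parameters after `k` updates along the trajectory `(x_0, a_0), (x_1, a_1), …`. -/
def trainedParams (σ : ℝ → ℝ) (γ η : ℝ) {N : ℕ} (θ₀ : Fin N → Param (dx + da))
    (x : ℕ → M.states) (a : ℕ → M.actions) : ℕ → Fin N → Param (dx + da)
  | 0 => θ₀
  | k + 1 => M.qStep σ γ η (trainedParams σ γ η θ₀ x a k) (x k, a k) (x (k + 1))

/-- The space `E`: probability measures on `ℝ^{1+d}` (the Lévy-Prokhorov metric induces the
topology of weak convergence) times functions of the state-action pair. -/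
abbrev E : Type :=
  LevyProkhorov (ProbabilityMeasure (Param (dx + da))) × (M.Pair → ℝ)

/-- The rescaled process `t ↦ (μ_t^N, h_t^N)` with learning rate `α / N`. -/
def scaledPath (σ : ℝ → ℝ) (γ α T : ℝ) (N : ℕ) [NeZero N] (θ₀ : Fin N → Param (dx + da))
    (x : ℕ → M.states) (a : ℕ → M.actions) : SkorokhodSpace T M.E :=
  SkorokhodSpace.ofSeq T N fun k =>
    (LevyProkhorov.ofMeasure (empiricalMeasure (M.trainedParams σ γ (α / N) θ₀ x a k)),
      M.qNet σ (M.trainedParams σ γ (α / N) θ₀ x a k))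

/-! ### The limit equation -/

/-- The kernel matrix `A`. -/
def kernelA (σ : ℝ → ℝ) (α : ℝ) (μ₀ : Measure (Param (dx + da))) (ζ ζ' : M.Pair) : ℝ :=
  α * ∫ θ, σ (inner ℝ θ.2 (M.vec ζ')) * σ (inner ℝ θ.2 (M.vec ζ)) ∂μ₀ +
  α * ∫ θ, θ.1 ^ 2 * deriv σ (inner ℝ θ.2 (M.vec ζ')) * deriv σ (inner ℝ θ.2 (M.vec ζ)) *
    inner ℝ (M.vec ζ') (M.vec ζ) ∂μ₀

/-- The right-hand side of the limit ODE; the limiting distribution of the state-action pair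
`(x, a)` is `ϖ x / |actions|`. -/
def drift (σ : ℝ → ℝ) (γ α : ℝ) (μ₀ : Measure (Param (dx + da))) (ϖ : M.states → ℝ)
    (h : M.Pair → ℝ) (ζ : M.Pair) : ℝ :=
  ∑ ζ' : M.Pair, (ϖ ζ'.1 / M.actions.card) * M.kernelA σ α μ₀ ζ ζ' * M.bellmanResidual γ h ζ'

/-- The path `u = (μ_t, h_t)` solves the limit equation on `[0, T]` with initial output `g`. -/
structure SolvesLimitEquation (σ : ℝ → ℝ) (γ α : ℝ) (μ₀ : Measure (Param (dx + da)))
    (ϖ : M.states → ℝ) {T : ℝ} (hT : 0 ≤ T) (g : M.Pair → ℝ) (u : SkorokhodSpace T M.E) :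
    Prop where
  initial : (u ⟨0, Set.left_mem_Icc.2 hT⟩).2 = g
  output : ∀ (t : Set.Icc (0 : ℝ) T) (ζ : M.Pair),
    (u t).2 ζ = (u ⟨0, Set.left_mem_Icc.2 hT⟩).2 ζ +
      ∫ s in (0 : ℝ)..t, M.drift σ γ α μ₀ ϖ (u (Set.projIcc 0 T hT s)).2 ζ
  measure : ∀ (t : Set.Icc (0 : ℝ) T) (f : Param (dx + da) → ℝ), IsC2b f →
    ∫ θ, f θ ∂((u t).1.toMeasure : Measure (Param (dx + da))) = ∫ θ, f θ ∂μ₀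
  measure_eq : ∀ t : Set.Icc (0 : ℝ) T,
    ((u t).1.toMeasure : Measure (Param (dx + da))) = μ₀

/-- A stationary point of the limit ODE. -/
def IsStationaryPoint (σ : ℝ → ℝ) (γ α : ℝ) (μ₀ : Measure (Param (dx + da)))
    (ϖ : M.states → ℝ) (h : M.Pair → ℝ) : Prop :=
  ∀ ζ, M.drift σ γ α μ₀ ϖ h ζ = 0

/-- `G` is a centred Gaussian vector with covariance
`E[G ζ G ζ'] = ∫ c² σ (w · ζ) σ (w · ζ') μ₀(dc, dw)`. -/
structure IsInitialGaussian (σ : ℝ → ℝ) (μ₀ : Measure (Param (dx + da))) {Ω : Type*}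
    [MeasurableSpace Ω] (P : Measure Ω) (G : Ω → M.Pair → ℝ) : Prop where
  gaussian : HasGaussianLaw G P
  mean : ∀ ζ, ∫ ω, G ω ζ ∂P = 0
  covariance : ∀ ζ ζ', ∫ ω, G ω ζ * G ω ζ' ∂P =
    ∫ θ, θ.1 ^ 2 * σ (inner ℝ θ.2 (M.vec ζ)) * σ (inner ℝ θ.2 (M.vec ζ')) ∂μ₀

end MDP

end QLearning

end

/-! Part (i) rests on a pathwise comparison, with randomness of the initial output added only at the
end. One update moves each parameter by `O(N^(-3/2))`, so over `N T` updates the parameters move by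
`O(N^(-1/2))`, provided the output stays bounded (`exists_trajectory_bound`). Hence the empirical
measure and the tangent kernel of the network stay near their initial values, which converge almost
surely to `μ₀` and to `A` by the law of large numbers. The output itself moves by `N⁻¹ A(·, ζ_k)
δ_k` per step, up to a small relative error (`norm_qNet_qStep_sub_sub_le`): an Euler scheme driven
by the transitions `ξ_k = ((x_k, a_k), x_{k+1})`.

The transition frequencies converge almost surely (`ae_tendsto_transition`): occupation frequencies
converge by assumption, and the remaining fluctuation is a sum of martingale differences, handled by
second moments along the squares. Summation by parts and a discrete Gronwall inequality then replace
the driven scheme by the averaged ODE (`norm_sub_le_of_averaging`). So on almost every realization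
the rescaled path is close to the ODE solution issued from the same initial output, uniformly over
initial outputs in a ball (`eventually_edist_scaledPath_le`).

The initial output `g_N = Q^N(·; θ_0)` converges only in law, to a Gaussian vector, by the central
limit theorem. The map sending `g` to the path `(μ₀, ODE solution from g)` is Lipschitz into the
Skorokhod space, so its value at `g_N` converges in law by continuous mapping. A Slutsky argument
transfers this to the rescaled path; tightness of `g_N` removes the restriction to balls. No
compactness argument in the Skorokhod space is needed, and the limit is explicit.

Part (ii): the drift is `A` applied to the Bellman residual with positive weights, so it suffices
that `A` is injective (`kernelA_injective`). The quadratic form of `A` dominates `α ∫ (∑ y_ζ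
σ(w·ζ))² dμ₀`. If it vanishes, then `∑ y_ζ σ(w·ζ) = 0` for every `w`, and bounded ridge functions in
pairwise non-parallel directions can cancel only if each is constant
(`constant_of_sum_ridge_eq_zero`). As `σ` is not constant, `y = 0`. The Bellman operator is a
`γ`-contraction in the sup norm, which gives existence and uniqueness of `V`. -/

namespace QLearning

/-! ### Bounds on the activation function -/

/-- `K` bounds `σ`, `σ'`, and is a Lipschitz constant of both. -/
structure ActivationBound (σ : ℝ → ℝ) (K : ℝ) : Prop where
  nonneg : 0 ≤ K
  continuous : Continuous σ
  continuous_deriv : Continuous (deriv σ)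
  differentiable : Differentiable ℝ σ
  abs_le : ∀ t, |σ t| ≤ K
  abs_deriv_le : ∀ t, |deriv σ t| ≤ K
  lipschitz : ∀ s t, |σ s - σ t| ≤ K * |s - t|
  lipschitz_deriv : ∀ s t, |deriv σ s - deriv σ t| ≤ K * |s - t|

theorem IsC2b.exists_activationBound {σ : ℝ → ℝ} (hσ : IsC2b σ) :
    ∃ K, ActivationBound σ K := by
  obtain ⟨hc, K, hK⟩ := hσ
  have hd : Differentiable ℝ σ := hc.differentiable (by norm_num)
  have hc1 : ContDiff ℝ 1 (deriv σ) := by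
    have : ContDiff ℝ (1 + 1) σ := by convert hc using 1; norm_num
    exact (contDiff_succ_iff_deriv.1 this).2.2
  have h1 : ∀ t, ‖deriv σ t‖ ≤ K := fun t => by
    have := hK 1 (by norm_num) t
    rwa [norm_iteratedFDeriv_eq_norm_iteratedDeriv, iteratedDeriv_one] at this
  have h2 : ∀ t, ‖deriv (deriv σ) t‖ ≤ K := fun t => by
    have := hK 2 le_rfl t
    rwa [norm_iteratedFDeriv_eq_norm_iteratedDeriv, iteratedDeriv_succ, iteratedDeriv_one] at this
  refine ⟨K, (norm_nonneg _).trans (h1 0), hc.continuous, hc1.continuous, hd, fun t => ?_, h1,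
    fun s t => ?_, fun s t => ?_⟩
  · simpa using hK 0 (by norm_num) t
  · exact convex_univ.norm_image_sub_le_of_norm_deriv_le (fun x _ => hd x) (fun x _ => h1 x)
      (Set.mem_univ t) (Set.mem_univ s)
  · exact convex_univ.norm_image_sub_le_of_norm_deriv_le
      (fun x _ => hc1.differentiable (by norm_num) x) (fun x _ => h2 x)
      (Set.mem_univ t) (Set.mem_univ s)

/-! ### Sums of ridge functions -/

/-- Induction on the number of directions. Shifting `w` by a vector orthogonal to one direction and
subtracting eliminates that direction, leaving a shorter relation between bounded functions. By
induction the increments of each remaining function do not depend on the base point, and a bounded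
function with such increments has none. The functions are generalized because the induction
hypothesis is applied to differences. -/
theorem constant_of_sum_ridge_eq_zero {ι V : Type*} [DecidableEq ι] [NormedAddCommGroup V]
    [InnerProductSpace ℝ V] (v : ι → V) (S : Finset ι) (hv : ∀ i ∈ S, v i ≠ 0)
    (hne : ∀ i ∈ S, ∀ j ∈ S, i ≠ j → ∀ c : ℝ, v i ≠ c • v j) (f : ι → ℝ → ℝ)
    (hf : ∀ i ∈ S, ∃ K, ∀ t, |f i t| ≤ K) (h : ∀ w, ∑ i ∈ S, f i (inner ℝ w (v i)) = 0) :
    ∀ i ∈ S, ∀ t, f i t = f i 0 := by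
  induction S using Finset.induction_on generalizing f with
  | empty => simp
  | insert j S hj ih =>
    have hvj : v j ≠ 0 := hv j (Finset.mem_insert_self _ _)
    have hjj : inner ℝ (v j) (v j) ≠ 0 := inner_self_ne_zero.2 hvj
    have hS : ∀ i ∈ S, ∀ t, f i t = f i 0 := by
      intro i hi
      -- The component of `v i` orthogonal to `v j`; it pairs non-trivially with `v i` because `v i`
      -- is not a multiple of `v j`.
      set u : V := v i - (inner ℝ (v j) (v i) / inner ℝ (v j) (v j)) • v j with hu
      have huj : inner ℝ u (v j) = 0 := by
        rw [hu, inner_sub_left, inner_smul_left, RCLike.conj_to_real, div_mul_cancel₀ _ hjj,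
          real_inner_comm, sub_self]
      have hui : inner ℝ u (v i) ≠ 0 := by
        intro h0
        have : inner ℝ u u = 0 := by
          conv_lhs => rw [hu, inner_sub_right, inner_smul_right, ← hu]
          rw [h0, huj]; simp
        have hu0 : u = 0 := inner_self_eq_zero.1 this
        exact hne i (Finset.mem_insert_of_mem hi) j (Finset.mem_insert_self _ _)
          (fun e => hj (e ▸ hi)) _ (sub_eq_zero.1 hu0)
      have step : ∀ τ s, f i (s + τ * inner ℝ u (v i)) - f i s
          = f i (0 + τ * inner ℝ u (v i)) - f i 0 := by
        intro τ s
        refine ih (fun k hk => hv k (Finset.mem_insert_of_mem hk))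
          (fun k hk l hl => hne k (Finset.mem_insert_of_mem hk) l (Finset.mem_insert_of_mem hl))
          (fun k s => f k (s + τ * inner ℝ u (v k)) - f k s) (fun k hk => ?_) (fun w => ?_) i hi s
        · obtain ⟨K, hK⟩ := hf k (Finset.mem_insert_of_mem hk)
          exact ⟨K + K, fun t => (abs_sub _ _).trans (add_le_add (hK _) (hK _))⟩
        · have h1 := h (w + τ • u)
          have h2 := h w
          rw [Finset.sum_insert hj] at h1 h2
          simp only [inner_add_left, inner_smul_left, huj, RCLike.conj_to_real, mul_zero,
            add_zero] at h1
          rw [Finset.sum_sub_distrib]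
          linarith
      have zero : ∀ τ, f i (0 + τ * inner ℝ u (v i)) - f i 0 = 0 := by
        intro τ
        set c := f i (0 + τ * inner ℝ u (v i)) - f i 0 with hc
        -- Equal increments accumulate linearly along an arithmetic progression, which contradicts
        -- boundedness unless `c = 0`.
        have hn : ∀ n : ℕ, f i (n * (τ * inner ℝ u (v i))) = f i 0 + n * c := by
          intro n
          induction n with
          | zero => simp
          | succ n ihn =>
            have := step τ (n * (τ * inner ℝ u (v i)))
            rw [← hc] at this
            push_cast
            rw [add_mul, one_mul]
            linarith
        obtain ⟨K, hK⟩ := hf i (Finset.mem_insert_of_mem hi)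
        by_contra hc0
        obtain ⟨n, hn'⟩ := exists_nat_gt ((K + K) / |c|)
        rw [div_lt_iff₀ (abs_pos.2 hc0)] at hn'
        have h1 : |(n : ℝ) * c| ≤ K + K := by
          rw [show (n : ℝ) * c = f i (n * (τ * inner ℝ u (v i))) - f i 0 by rw [hn]; ring]
          exact (abs_sub _ _).trans (add_le_add (hK _) (hK _))
        rw [abs_mul, Nat.abs_cast] at h1
        linarith
      intro t
      have := zero (t / inner ℝ u (v i))
      rw [zero_add, div_mul_cancel₀ _ hui] at this
      linarith
    intro i hi
    rcases Finset.mem_insert.1 hi with rfl | hi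
    · have key : ∀ t, f i t = - ∑ k ∈ S, f k 0 := by
        intro t
        have h1 := h ((t / inner ℝ (v i) (v i)) • v i)
        rw [Finset.sum_insert hj, inner_smul_left, RCLike.conj_to_real, div_mul_cancel₀ _ hjj,
          Finset.sum_congr rfl fun k hk => hS k hk _] at h1
        linarith
      intro t
      rw [key, key]
    · exact hS i hi

namespace MDP

variable {dx da : ℕ} (M : MDP dx da)

theorem integrable_activation_mul {σ : ℝ → ℝ} {K : ℝ} (hσ : ActivationBound σ K)
    {μ₀ : Measure (Param (dx + da))} (hμ₀ : IsInitialLaw μ₀) (ζ ζ' : M.Pair) :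
    Integrable (fun θ : Param (dx + da) =>
      σ (inner ℝ θ.2 (M.vec ζ)) * σ (inner ℝ θ.2 (M.vec ζ'))) μ₀ := by
  have := hμ₀.isProbabilityMeasure
  have hc := hσ.continuous
  refine Integrable.of_bound (C := K * K) (Continuous.aestronglyMeasurable (by fun_prop)) ?_
  filter_upwards with θ
  rw [norm_mul]
  exact mul_le_mul (hσ.abs_le _) (hσ.abs_le _) (norm_nonneg _) hσ.nonneg

theorem integrable_sq_mul_mul {f g : ℝ → ℝ} {K : ℝ} (hf : Continuous f) (hg : Continuous g)
    (hf' : ∀ t, |f t| ≤ K) (hg' : ∀ t, |g t| ≤ K)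
    {μ₀ : Measure (Param (dx + da))} (hμ₀ : IsInitialLaw μ₀) (ζ ζ' : M.Pair) :
    Integrable (fun θ : Param (dx + da) =>
      θ.1 ^ 2 * f (inner ℝ θ.2 (M.vec ζ)) * g (inner ℝ θ.2 (M.vec ζ'))) μ₀ := by
  have := hμ₀.isProbabilityMeasure
  obtain ⟨B, hB⟩ := hμ₀.bounded_c
  refine Integrable.of_bound (C := B ^ 2 * K * K) (Continuous.aestronglyMeasurable (by fun_prop)) ?_
  filter_upwards [hB] with θ hθ
  have hK : 0 ≤ K := (abs_nonneg _).trans (hf' 0)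
  rw [norm_mul, norm_mul, norm_pow]
  exact mul_le_mul (mul_le_mul (pow_le_pow_left₀ (norm_nonneg _) hθ 2) (hf' _) (norm_nonneg _)
    (by positivity)) (hg' _) (norm_nonneg _) (by positivity)

theorem integrable_sq_mul_deriv {σ : ℝ → ℝ} {K : ℝ} (hσ : ActivationBound σ K)
    {μ₀ : Measure (Param (dx + da))} (hμ₀ : IsInitialLaw μ₀) (ζ ζ' : M.Pair) :
    Integrable (fun θ : Param (dx + da) => θ.1 ^ 2 * deriv σ (inner ℝ θ.2 (M.vec ζ)) *
      deriv σ (inner ℝ θ.2 (M.vec ζ')) * inner ℝ (M.vec ζ) (M.vec ζ')) μ₀ :=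
  (M.integrable_sq_mul_mul hσ.continuous_deriv hσ.continuous_deriv hσ.abs_deriv_le
    hσ.abs_deriv_le hμ₀ ζ ζ').mul_const _

/-- `A` is `α` times the sum of two Gram matrices in `L²(μ₀)`: that of the scalar features `σ(w·ζ)`
and that of the vector features `c σ'(w·ζ) ζ`. These are the gradients of a unit with respect to `c`
and `w`. -/
theorem quadratic_kernelA {σ : ℝ → ℝ} {K : ℝ} (hσ : ActivationBound σ K) (α : ℝ)
    {μ₀ : Measure (Param (dx + da))} (hμ₀ : IsInitialLaw μ₀) (y : M.Pair → ℝ) :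
    ∑ ζ, y ζ * ∑ ζ', M.kernelA σ α μ₀ ζ ζ' * y ζ' =
      α * ∫ θ : Param (dx + da), (∑ ζ, y ζ * σ (inner ℝ θ.2 (M.vec ζ))) ^ 2 ∂μ₀ +
      α * ∫ θ : Param (dx + da), θ.1 ^ 2 *
        ‖∑ ζ, (y ζ * deriv σ (inner ℝ θ.2 (M.vec ζ))) • M.vec ζ‖ ^ 2 ∂μ₀ := by
  have h1 : ∀ θ : Param (dx + da), (∑ ζ, y ζ * σ (inner ℝ θ.2 (M.vec ζ))) ^ 2 =
      ∑ ζ, ∑ ζ', y ζ * y ζ' *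
        (σ (inner ℝ θ.2 (M.vec ζ')) * σ (inner ℝ θ.2 (M.vec ζ))) := by
    intro θ
    rw [sq, Finset.sum_mul_sum]
    exact Finset.sum_congr rfl fun _ _ => Finset.sum_congr rfl fun _ _ => by ring
  have h2 : ∀ θ : Param (dx + da), θ.1 ^ 2 *
        ‖∑ ζ, (y ζ * deriv σ (inner ℝ θ.2 (M.vec ζ))) • M.vec ζ‖ ^ 2 =
      ∑ ζ, ∑ ζ', y ζ * y ζ' * (θ.1 ^ 2 * deriv σ (inner ℝ θ.2 (M.vec ζ')) *
        deriv σ (inner ℝ θ.2 (M.vec ζ)) * inner ℝ (M.vec ζ') (M.vec ζ)) := by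
    intro θ
    rw [← real_inner_self_eq_norm_sq, sum_inner, Finset.mul_sum]
    refine Finset.sum_congr rfl fun _ _ => ?_
    rw [inner_sum, Finset.mul_sum]
    refine Finset.sum_congr rfl fun _ _ => ?_
    rw [inner_smul_left, inner_smul_right, real_inner_comm (M.vec _) (M.vec _)]
    simp only [RCLike.conj_to_real]
    ring
  simp only [h1, h2]
  rw [integral_finsetSum _ fun ζ _ => integrable_finsetSum _ fun ζ' _ =>
      (M.integrable_activation_mul hσ hμ₀ ζ' ζ).const_mul _,
    integral_finsetSum _ fun ζ _ => integrable_finsetSum _ fun ζ' _ =>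
      (M.integrable_sq_mul_deriv hσ hμ₀ ζ' ζ).const_mul _, Finset.mul_sum, Finset.mul_sum,
    ← Finset.sum_add_distrib]
  refine Finset.sum_congr rfl fun ζ _ => ?_
  rw [integral_finsetSum _ fun ζ' _ => (M.integrable_activation_mul hσ hμ₀ ζ' ζ).const_mul _,
    integral_finsetSum _ fun ζ' _ => (M.integrable_sq_mul_deriv hσ hμ₀ ζ' ζ).const_mul _,
    Finset.mul_sum, Finset.mul_sum, Finset.mul_sum, ← Finset.sum_add_distrib]
  refine Finset.sum_congr rfl fun ζ' _ => ?_
  rw [integral_const_mul, integral_const_mul, kernelA]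
  ring

/-- A continuous function of `w` that vanishes almost everywhere for a law of full support
vanishes identically. -/
theorem eq_zero_of_ae_eq_zero {d : ℕ} {μ₀ : Measure (Param d)} (hμ₀ : IsInitialLaw μ₀)
    (hfull : HasFullSupport μ₀) {F : EuclideanSpace ℝ (Fin d) → ℝ} (hF : Continuous F)
    (h : ∀ᵐ θ ∂μ₀, F θ.2 = 0) (w : EuclideanSpace ℝ (Fin d)) : F w = 0 := by
  have := hμ₀.isProbabilityMeasure
  obtain ⟨B, hB, hpos⟩ := hfull
  -- `HasFullSupport` does not say that `B > 0`. If the interval were null, absolute continuity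
  -- would leave no mass on the strip that carries `μ₀`.
  have hvol : 0 < volume (Set.Icc (-B) B) := by
    by_contra h0
    have h0 : volume (Set.Icc (-B) B) = 0 := by simpa using h0
    have h1 : μ₀ (Set.Icc (-B) B ×ˢ Set.univ) = 0 := by
      apply hμ₀.absolutelyContinuous
      rw [Measure.volume_eq_prod, Measure.prod_prod, h0, zero_mul]
    have h2 : ∀ᵐ θ ∂μ₀, θ ∉ Set.Icc (-B) B ×ˢ (Set.univ : Set (EuclideanSpace ℝ (Fin d))) :=
      measure_eq_zero_iff_ae_notMem.1 h1
    obtain ⟨θ, h3, h4⟩ := (hB.and h2).exists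
    exact h4 ⟨h3, Set.mem_univ _⟩
  by_contra hw
  have hopen : IsOpen {w | F w ≠ 0} := isOpen_ne_fun hF continuous_const
  have hΓ := hpos (Set.Icc (-B) B ×ˢ {w | F w ≠ 0}) (measurableSet_Icc.prod hopen.measurableSet)
    (Set.prod_mono le_rfl (Set.subset_univ _)) (by
      rw [Measure.volume_eq_prod, Measure.prod_prod]
      exact ENNReal.mul_pos hvol.ne' (hopen.measure_pos _ ⟨w, hw⟩).ne')
  refine hΓ.ne' (measure_mono_null (fun θ hθ => ?_) h)
  exact hθ.2

/-- Both Gram terms are non-negative, so the first one vanishes; continuity and full support turn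
the almost sure relation into an identity in `w`, to which the ridge lemma applies. The second term
matters only through its sign, and non-polynomiality only through excluding constants. -/
theorem kernelA_injective {σ : ℝ → ℝ} {K : ℝ} (hσ : ActivationBound σ K) {α : ℝ} (hα : 0 < α)
    {μ₀ : Measure (Param (dx + da))} (hμ₀ : IsInitialLaw μ₀) (hpoly : NonPolynomial σ)
    (hfull : HasFullSupport μ₀) (hdir : M.DistinctDirections) (y : M.Pair → ℝ)
    (hy : ∀ ζ, ∑ ζ', M.kernelA σ α μ₀ ζ ζ' * y ζ' = 0) : y = 0 := by
  classical
  have := hμ₀.isProbabilityMeasure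
  have hcont := hσ.continuous
  have hq := M.quadratic_kernelA hσ α hμ₀ y
  simp only [hy, mul_zero, Finset.sum_const_zero] at hq
  have h2 : 0 ≤ α * ∫ θ : Param (dx + da), θ.1 ^ 2 *
      ‖∑ ζ, (y ζ * deriv σ (inner ℝ θ.2 (M.vec ζ))) • M.vec ζ‖ ^ 2 ∂μ₀ :=
    mul_nonneg hα.le (integral_nonneg fun θ => by positivity)
  have h1 : ∫ θ : Param (dx + da), (∑ ζ, y ζ * σ (inner ℝ θ.2 (M.vec ζ))) ^ 2 ∂μ₀ = 0 := by
    have h3 : 0 ≤ ∫ θ : Param (dx + da), (∑ ζ, y ζ * σ (inner ℝ θ.2 (M.vec ζ))) ^ 2 ∂μ₀ :=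
      integral_nonneg fun θ => by positivity
    nlinarith
  have hint : Integrable (fun θ : Param (dx + da) =>
      (∑ ζ, y ζ * σ (inner ℝ θ.2 (M.vec ζ))) ^ 2) μ₀ := by
    refine Integrable.of_bound (C := (∑ ζ, |y ζ| * K) ^ 2)
      (Continuous.aestronglyMeasurable (by fun_prop)) ?_
    filter_upwards with θ
    rw [norm_pow]
    refine pow_le_pow_left₀ (norm_nonneg _) ((norm_sum_le _ _).trans
      (Finset.sum_le_sum fun ζ _ => ?_)) 2
    rw [norm_mul]
    exact mul_le_mul_of_nonneg_left (hσ.abs_le _) (abs_nonneg _)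
  rw [integral_eq_zero_iff_of_nonneg (fun θ => by positivity) hint] at h1
  have hzero : ∀ w, ∑ ζ, y ζ * σ (inner ℝ w (M.vec ζ)) = 0 :=
    eq_zero_of_ae_eq_zero hμ₀ hfull (F := fun w => ∑ ζ, y ζ * σ (inner ℝ w (M.vec ζ)))
      (by fun_prop) (by filter_upwards [h1] with θ hθ; simpa using hθ)
  have hconst := constant_of_sum_ridge_eq_zero M.vec Finset.univ (fun ζ _ => hdir.1 ζ)
    (fun ζ _ ζ' _ hne c hc => by
      have := (LinearIndependent.pair_iff.1 (hdir.2 ζ ζ' hne)) 1 (-c) (by rw [hc]; simp)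
      simp at this)
    (fun ζ t => y ζ * σ t) (fun ζ _ => ⟨|y ζ| * K, fun t => by
      rw [abs_mul]; exact mul_le_mul_of_nonneg_left (hσ.abs_le _) (abs_nonneg _)⟩) hzero
  ext ζ
  by_contra hne
  refine hpoly ⟨Polynomial.C (σ 0), fun t => ?_⟩
  rw [Polynomial.eval_C]
  exact mul_left_cancel₀ hne (hconst ζ (Finset.mem_univ _) t)

/-! ### The Bellman equation -/

theorem abs_maxAction_sub_le (h h' : M.Pair → ℝ) (z : M.states) :
    |M.maxAction h z - M.maxAction h' z| ≤ ‖h - h'‖ := by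
  have key : ∀ h h' : M.Pair → ℝ, M.maxAction h z ≤ M.maxAction h' z + ‖h - h'‖ := by
    intro h h'
    refine Finset.sup'_le _ _ fun a ha => ?_
    have h1 := Finset.le_sup' (fun a => h' (z, a)) ha
    have h2 := norm_le_pi_norm (h - h') (z, a)
    rw [Pi.sub_apply, Real.norm_eq_abs] at h2
    have h3 := le_abs_self (h (z, a) - h' (z, a))
    unfold maxAction
    linarith
  rw [abs_le]
  have h1 := key h h'
  have h2 := key h' h
  rw [norm_sub_rev] at h2
  constructor <;> linarith

theorem abs_maxAction_le (h : M.Pair → ℝ) (z : M.states) : |M.maxAction h z| ≤ ‖h‖ := by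
  have h0 : M.maxAction 0 z = 0 := Finset.sup'_const _ 0
  simpa [h0] using M.abs_maxAction_sub_le h 0 z

/-- The Bellman optimality operator. -/
noncomputable def bellmanOperator (γ : ℝ) (h : M.Pair → ℝ) (ζ : M.Pair) : ℝ :=
  M.r ζ.1 ζ.2 + γ * ∑ z, M.maxAction h z * M.p z ζ.1 ζ.2

/-- The maximum over actions is 1-Lipschitz in the sup norm and `p` averages over next states, so
only the factor `γ` remains. -/
theorem norm_bellmanOperator_sub_le {γ : ℝ} (hγ : 0 ≤ γ) (h h' : M.Pair → ℝ) :
    ‖M.bellmanOperator γ h - M.bellmanOperator γ h'‖ ≤ γ * ‖h - h'‖ := by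
  refine (pi_norm_le_iff_of_nonneg (by positivity)).2 fun ζ => ?_
  have h1 : (M.bellmanOperator γ h - M.bellmanOperator γ h') ζ =
      γ * ∑ z, (M.maxAction h z - M.maxAction h' z) * M.p z ζ.1 ζ.2 := by
    simp only [bellmanOperator, Pi.sub_apply, sub_mul, Finset.sum_sub_distrib]
    ring
  rw [h1, norm_mul, Real.norm_of_nonneg hγ]
  refine mul_le_mul_of_nonneg_left ?_ hγ
  calc ‖∑ z, (M.maxAction h z - M.maxAction h' z) * M.p z ζ.1 ζ.2‖
      ≤ ∑ z, ‖h - h'‖ * M.p z ζ.1 ζ.2 := (norm_sum_le _ _).trans (Finset.sum_le_sum fun z _ => by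
        rw [norm_mul, Real.norm_of_nonneg (M.p_nonneg _ _ _)]
        exact mul_le_mul_of_nonneg_right (M.abs_maxAction_sub_le h h' z) (M.p_nonneg _ _ _))
    _ = ‖h - h'‖ := by rw [← Finset.mul_sum, M.p_sum, mul_one]

theorem solvesBellman_iff {γ : ℝ} {V : M.Pair → ℝ} :
    M.SolvesBellman γ V ↔ Function.IsFixedPt (M.bellmanOperator γ) V := by
  rw [Function.IsFixedPt, funext_iff]
  exact forall_congr' fun ζ => sub_eq_zero

theorem existsUnique_solvesBellman {γ : ℝ} (hγ0 : 0 < γ) (hγ1 : γ < 1) :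
    ∃ V, M.SolvesBellman γ V ∧ ∀ V', M.SolvesBellman γ V' → V' = V := by
  have hc : ContractingWith ⟨γ, hγ0.le⟩ (M.bellmanOperator γ) :=
    ⟨NNReal.coe_lt_coe.1 hγ1, LipschitzWith.of_dist_le_mul fun h h' => by
      rw [dist_eq_norm, dist_eq_norm]
      exact M.norm_bellmanOperator_sub_le hγ0.le h h'⟩
  refine ⟨hc.fixedPoint _, M.solvesBellman_iff.2 hc.fixedPoint_isFixedPt, fun V' hV' => ?_⟩
  exact hc.fixedPoint_unique (M.solvesBellman_iff.1 hV')

/-- Injectivity of `A` is applied to the weighted residual; the weights `ϖ / |actions|` are positive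
and can be cancelled. -/
theorem isStationaryPoint_iff {σ : ℝ → ℝ} {K : ℝ} (hσ : ActivationBound σ K) {α : ℝ} (hα : 0 < α)
    {μ₀ : Measure (Param (dx + da))} (hμ₀ : IsInitialLaw μ₀) (hpoly : NonPolynomial σ)
    (hfull : HasFullSupport μ₀) (hdir : M.DistinctDirections) {ϖ : M.states → ℝ}
    (hϖ : ∀ s, 0 < ϖ s) {γ : ℝ} {h : M.Pair → ℝ} :
    M.IsStationaryPoint σ γ α μ₀ ϖ h ↔ M.SolvesBellman γ h := by
  constructor
  · intro hs
    have := M.kernelA_injective hσ hα hμ₀ hpoly hfull hdir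
      (fun ζ' => ϖ ζ'.1 / M.actions.card * M.bellmanResidual γ h ζ') (fun ζ => by
        rw [← hs ζ, drift]
        exact Finset.sum_congr rfl fun _ _ => by ring)
    intro ζ
    have hz := congrFun this ζ
    have hK : (0 : ℝ) < M.actions.card := Nat.cast_pos.2 M.actions_nonempty.card_pos
    exact (mul_eq_zero.1 hz).resolve_left (div_pos (hϖ _) hK).ne'
  · intro hs ζ
    exact Finset.sum_eq_zero fun ζ' _ => by rw [hs ζ', mul_zero]

end MDP

/-! ### Convergence in distribution -/

/-- If `X n` converges in distribution and the distance between `X n` and `Y n` tends to zero in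
probability, then `Y n` converges in distribution to the same limit. -/
theorem tendstoInDistribution_of_tendsto_measure_edist {ι S Ω Ω' : Type*} {mΩ : MeasurableSpace Ω}
    {P : Measure Ω} [IsProbabilityMeasure P] {mΩ' : MeasurableSpace Ω'} {P' : Measure Ω'}
    [IsProbabilityMeasure P'] [PseudoEMetricSpace S] [MeasurableSpace S] [BorelSpace S]
    {l : Filter ι} [l.IsCountablyGenerated] {X Y : ι → Ω → S} {Z : Ω' → S}
    (hX : TendstoInDistribution X l Z (fun _ => P) P') (hY : ∀ n, AEMeasurable (Y n) P)
    (h : ∀ ε : ℝ, 0 < ε →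
      Tendsto (fun n => P {ω | ENNReal.ofReal ε ≤ edist (Y n ω) (X n ω)}) l (𝓝 0)) :
    TendstoInDistribution Y l Z (fun _ => P) P' where
  forall_aemeasurable := hY
  aemeasurable_limit := hX.aemeasurable_limit
  tendsto := by
    -- Portmanteau: unless the two variables are at least `δ` apart, `Y n ∈ F` puts `X n` in the
    -- closed `δ`-thickening of `F`. The index goes to its limit first, then `δ` to zero.
    refine tendsto_of_forall_isClosed_limsup_le' fun F hF => ?_
    rcases l.eq_or_neBot with rfl | hl
    · simp
    simp only [ProbabilityMeasure.coe_mk]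
    have hZ := hX.aemeasurable_limit
    have hlim : Tendsto (fun δ : ℝ => P'.map Z (Metric.cthickening δ F)) (𝓝[>] 0)
        (𝓝 (P'.map Z F)) := by
      have : IsProbabilityMeasure (P'.map Z) := Measure.isProbabilityMeasure_map hZ
      exact (tendsto_measure_cthickening_of_isClosed ⟨1, one_pos, measure_ne_top _ _⟩ hF).mono_left
        nhdsWithin_le_nhds
    refine ge_of_tendsto hlim ?_
    filter_upwards [self_mem_nhdsWithin] with δ hδ
    have hδ : 0 < δ := hδ
    have hle : ∀ n, P.map (Y n) F ≤ P.map (X n) (Metric.cthickening δ F) +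
        P {ω | ENNReal.ofReal δ ≤ edist (Y n ω) (X n ω)} := by
      intro n
      rw [Measure.map_apply_of_aemeasurable (hY n) hF.measurableSet,
        Measure.map_apply_of_aemeasurable (hX.forall_aemeasurable n)
          Metric.isClosed_cthickening.measurableSet]
      refine (measure_mono fun ω hω => ?_).trans (measure_union_le _ _)
      by_cases hd : ENNReal.ofReal δ ≤ edist (Y n ω) (X n ω)
      · exact Or.inr hd
      · refine Or.inl ?_
        change X n ω ∈ Metric.cthickening δ F
        rw [Metric.mem_cthickening_iff]
        rw [edist_comm] at hd
        exact (Metric.infEDist_le_edist_of_mem (show Y n ω ∈ F from hω)).trans (not_le.1 hd).le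
    have h1 := ProbabilityMeasure.limsup_measure_closed_le_of_tendsto hX.tendsto
      (Metric.isClosed_cthickening (δ := δ) (E := F))
    simp only [ProbabilityMeasure.coe_mk] at h1
    refine le_trans ?_ h1
    refine le_of_forall_gt fun c hc => ?_
    obtain ⟨c', hc1, hc2⟩ := exists_between hc
    obtain ⟨e, he, hce⟩ : ∃ e : ℝ≥0∞, 0 < e ∧ c' + e < c := by
      obtain ⟨e, he, h2⟩ := ENNReal.lt_iff_exists_add_pos_lt.1 hc2
      exact ⟨e, by exact_mod_cast he, h2⟩
    refine lt_of_le_of_lt (Filter.limsup_le_of_le (h := ?_)) hce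
    filter_upwards [eventually_lt_of_limsup_lt hc1, (h δ hδ).eventually_lt_const he] with n h3 h4
    exact (hle n).trans (add_le_add h3.le h4.le)

/-- The law of large numbers for a function of independent samples. -/
theorem strong_law_comp {X Ω : Type*} [MeasurableSpace X] [MeasurableSpace Ω] {P : Measure Ω}
    {μ₀ : Measure X} {θ : ℕ → Ω → X} (hθ_meas : ∀ i, Measurable (θ i))
    (hθ_law : ∀ i, P.map (θ i) = μ₀) (hθ_indep : iIndepFun θ P) {f : X → ℝ} (hf : Measurable f)
    (hint : Integrable f μ₀) :
    ∀ᵐ ω ∂P, Tendsto (fun n : ℕ => (n : ℝ)⁻¹ * ∑ i ∈ Finset.range n, f (θ i ω)) atTop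
      (𝓝 (∫ x, f x ∂μ₀)) := by
  have h := strong_law_ae_real (μ := P) (fun i ω => f (θ i ω)) ?_ ?_ ?_
  · filter_upwards [h] with ω hω
    rw [← hθ_law 0, integral_map (hθ_meas 0).aemeasurable hf.aestronglyMeasurable]
    exact hω.congr fun n => by rw [div_eq_inv_mul]
  · rw [← hθ_law 0] at hint
    exact hint.comp_measurable (hθ_meas 0)
  · intro i j hij
    exact (hθ_indep.indepFun hij).comp hf hf
  · intro i
    exact IdentDistrib.comp ⟨(hθ_meas i).aemeasurable, (hθ_meas 0).aemeasurable,
      (hθ_law i).trans (hθ_law 0).symm⟩ hf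

/-- Finite intersections of a countable basis. Convergence on such a π-system implies weak
convergence, and countability lets a single null set serve for all its members. -/
theorem exists_countable_isPiSystem_open (X : Type*) [TopologicalSpace X]
    [SecondCountableTopology X] :
    ∃ S : Set (Set X), S.Countable ∧ IsPiSystem S ∧ (∀ s ∈ S, IsOpen s) ∧
      ∀ u : Set X, IsOpen u → ∀ x ∈ u, ∃ s ∈ S, s ∈ 𝓝 x ∧ s ⊆ u := by
  classical
  have hb := TopologicalSpace.isBasis_countableBasis X
  have hc : Countable (TopologicalSpace.countableBasis X) :=
    (TopologicalSpace.countable_countableBasis X).to_subtype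
  let g : Finset (TopologicalSpace.countableBasis X) → Set X := fun t => ⋂ i ∈ t, (i : Set X)
  refine ⟨Set.range g, Set.countable_range g, ?_, ?_, ?_⟩
  · rintro _ ⟨t, rfl⟩ _ ⟨t', rfl⟩ -
    refine ⟨t ∪ t', ?_⟩
    ext x
    simp only [g, Set.mem_iInter, Finset.mem_union, Set.mem_inter_iff, or_imp, forall_and]
  · rintro _ ⟨t, rfl⟩
    exact isOpen_biInter_finset fun i _ => hb.isOpen i.2
  · intro u hu x hx
    obtain ⟨s, hs, hxs, hsu⟩ := hb.exists_subset_of_mem_open hx hu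
    refine ⟨s, ⟨{⟨s, hs⟩}, ?_⟩, hb.mem_nhds hs hxs, hsu⟩
    ext x
    simp only [g, Set.mem_iInter, Finset.mem_singleton, forall_eq]

/-! ### Empirical measures -/

theorem empiricalMeasure_apply {d N : ℕ} [NeZero N] (θ : Fin N → Param d) {s : Set (Param d)}
    (hs : MeasurableSet s) :
    (empiricalMeasure θ : Measure (Param d)) s =
      (N : ℝ≥0∞)⁻¹ * ∑ i, s.indicator 1 (θ i) := by
  simp [empiricalMeasure, hs]

/-- Pair the `i`-th atoms: when one lies in `B`, its partner lies in every thickening of `B` of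
radius larger than `ε`. The additive slack in the Lévy-Prokhorov distance is not needed. -/
theorem levyProkhorovEDist_empiricalMeasure_le {d N : ℕ} [NeZero N] (θ θ' : Fin N → Param d)
    {ε : ℝ≥0∞} (h : ∀ i, edist (θ i) (θ' i) ≤ ε) :
    edist (LevyProkhorov.ofMeasure (empiricalMeasure θ))
      (LevyProkhorov.ofMeasure (empiricalMeasure θ')) ≤ ε := by
  rw [LevyProkhorov.edist_probabilityMeasure_def]
  refine levyProkhorovEDist_le_of_forall_le _ _ _ fun r B hr hr' hB => ?_
  refine le_trans ?_ le_self_add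
  rw [empiricalMeasure_apply _ hB, empiricalMeasure_apply _ Metric.isOpen_thickening.measurableSet]
  gcongr with i
  by_cases hi : θ i ∈ B
  · have : θ' i ∈ Metric.thickening r.toReal B := by
      rw [Metric.mem_thickening_iff_infEDist_lt, ENNReal.ofReal_toReal hr'.ne]
      refine (Metric.infEDist_le_edist_of_mem hi).trans_lt ?_
      rw [edist_comm]
      exact (h i).trans_lt hr
    simp [hi, this]
  · simp [hi]

/-- The empirical measures of independent samples converge weakly almost surely. -/
theorem ae_tendsto_empiricalMeasure {d : ℕ} {Ω : Type*} [MeasurableSpace Ω] {P : Measure Ω}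
    {μ₀ : Measure (Param d)} [IsProbabilityMeasure μ₀] {θ : ℕ → Ω → Param d}
    (hθ_meas : ∀ i, Measurable (θ i)) (hθ_law : ∀ i, P.map (θ i) = μ₀) (hθ_indep : iIndepFun θ P) :
    ∀ᵐ ω ∂P, Tendsto (fun N : ℕ+ => empiricalMeasure fun i : Fin N => θ i ω) atTop
      (𝓝 ⟨μ₀, inferInstance⟩) := by
  obtain ⟨S, hSc, hSpi, hSo, hSb⟩ := exists_countable_isPiSystem_open (Param d)
  have hall : ∀ᵐ ω ∂P, ∀ s ∈ S, Tendsto (fun n : ℕ => (n : ℝ)⁻¹ *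
      ∑ i ∈ Finset.range n, s.indicator (fun _ => (1 : ℝ)) (θ i ω)) atTop
      (𝓝 (∫ x, s.indicator (fun _ => (1 : ℝ)) x ∂μ₀)) := by
    rw [ae_ball_iff hSc]
    intro s hs
    exact strong_law_comp hθ_meas hθ_law hθ_indep
      (measurable_const.indicator (hSo s hs).measurableSet)
      ((integrable_const _).indicator (hSo s hs).measurableSet)
  filter_upwards [hall] with ω hω
  refine hSpi.tendsto_probabilityMeasure_of_tendsto_of_mem (fun s hs => (hSo s hs).measurableSet)
    hSb fun s hs => ?_
  have hm := (hSo s hs).measurableSet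
  rw [← NNReal.tendsto_coe]
  have h1 := (hω s hs).comp tendsto_PNat_val_atTop_atTop
  rw [integral_indicator hm, setIntegral_const, smul_eq_mul, mul_one] at h1
  refine h1.congr fun N => ?_
  have h2 : (((empiricalMeasure fun i : Fin N => θ i ω) s : NNReal) : ℝ) =
      ((empiricalMeasure fun i : Fin N => θ i ω : Measure (Param d)) s).toReal := rfl
  rw [h2, empiricalMeasure_apply _ hm, ENNReal.toReal_mul, ENNReal.toReal_inv,
    ENNReal.toReal_natCast, ENNReal.toReal_sum, Function.comp_apply]
  · rw [← Fin.sum_univ_eq_sum_range (fun i => s.indicator (fun _ => (1 : ℝ)) (θ i ω))]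
    congr 1
    refine Finset.sum_congr rfl fun i _ => ?_
    by_cases hi : θ i ω ∈ s <;> simp [hi]
  · intro i _
    by_cases hi : θ i ω ∈ s <;> simp [hi]

theorem continuous_empiricalMeasure {d N : ℕ} [NeZero N] :
    Continuous fun θ : Fin N → Param d => LevyProkhorov.ofMeasure (empiricalMeasure θ) := by
  refine LipschitzWith.continuous (K := 1) fun θ θ' => ?_
  rw [ENNReal.coe_one, one_mul]
  exact levyProkhorovEDist_empiricalMeasure_le θ θ' fun i => edist_le_pi_edist θ θ' i

/-! ### The central limit theorem for vectors -/

/-- Cramér-Wold with Lévy's continuity theorem: the characteristic function of the vector at `t` is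
that of its projection on `t` at `1`, and the scalar central limit theorem applies to the
projection, whose variance is `t · S t`. -/
theorem tendstoInDistribution_multivariateGaussian {ι Ω : Type*} [Fintype ι] [DecidableEq ι]
    [MeasurableSpace Ω] {P : Measure Ω} [IsProbabilityMeasure P]
    {Y : ℕ → Ω → EuclideanSpace ℝ ι} (hY : ∀ i, Measurable (Y i)) (hindep : iIndepFun Y P)
    (hident : ∀ i, IdentDistrib (Y i) (Y 0) P P) {C : ℝ} (hC : ∀ᵐ ω ∂P, ∀ i, |Y 0 ω i| ≤ C)
    (hmean : ∀ i, ∫ ω, Y 0 ω i ∂P = 0) {S : Matrix ι ι ℝ} (hS : S.PosSemidef)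
    (hcov : ∀ i j, ∫ ω, Y 0 ω i * Y 0 ω j ∂P = S i j) :
    TendstoInDistribution (fun (n : ℕ) ω => (√(n : ℝ))⁻¹ • ∑ k ∈ Finset.range n, Y k ω) atTop
      id (fun _ => P) (multivariateGaussian 0 S) where
  forall_aemeasurable n := by fun_prop
  aemeasurable_limit := aemeasurable_id
  tendsto := by
    refine ProbabilityMeasure.tendsto_iff_tendsto_charFun.2 fun t => ?_
    have hm : ∀ i, Measurable fun y : EuclideanSpace ℝ ι => y i := fun i => by fun_prop
    have hb : ∀ i, ∀ᵐ ω ∂P, |Y 0 ω i| ≤ C := fun i => by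
      filter_upwards [hC] with ω hω using hω i
    have hint : ∀ i, Integrable (fun ω => Y 0 ω i) P := fun i =>
      Integrable.of_bound ((hm i).comp (hY 0)).aestronglyMeasurable C (hb i)
    have hint2 : ∀ i j, Integrable (fun ω => Y 0 ω i * Y 0 ω j) P := fun i j =>
      (hint j).bdd_mul ((hm i).comp (hY 0)).aestronglyMeasurable (hb i)
    set X : ℕ → Ω → ℝ := fun k ω => inner ℝ (Y k ω) t with hX
    have hmt : Measurable fun y : EuclideanSpace ℝ ι => inner ℝ y t := by fun_prop
    have hXm : ∀ k, Measurable (X k) := fun k => hmt.comp (hY k)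
    have hXsum : ∀ ω, X 0 ω = ∑ i, t i * Y 0 ω i := fun ω => by
      simp [hX, PiLp.inner_apply]
    have hX0 : P[X 0] = 0 := by
      simp only [hXsum]
      rw [integral_finsetSum _ fun i _ => (hint i).const_mul _]
      exact Finset.sum_eq_zero fun i _ => by rw [integral_const_mul, hmean, mul_zero]
    have hX2 : Var[X 0; P] = t.ofLp ⬝ᵥ S.mulVec t.ofLp := by
      rw [variance_of_integral_eq_zero (hXm 0).aemeasurable hX0]
      have : ∀ ω, X 0 ω ^ 2 = ∑ i, ∑ j, t i * t j * (Y 0 ω i * Y 0 ω j) := fun ω => by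
        rw [hXsum, sq, Finset.sum_mul_sum]
        exact Finset.sum_congr rfl fun _ _ => Finset.sum_congr rfl fun _ _ => by ring
      simp only [this]
      rw [integral_finsetSum _ fun i _ => integrable_finsetSum _ fun j _ =>
        (hint2 i j).const_mul _]
      simp only [dotProduct, Matrix.mulVec, Finset.mul_sum]
      refine Finset.sum_congr rfl fun i _ => ?_
      rw [integral_finsetSum _ fun j _ => (hint2 i j).const_mul _]
      refine Finset.sum_congr rfl fun j _ => ?_
      rw [integral_const_mul, hcov]
      ring
    have hL2 : MemLp (X 0) 2 P := by
      have hbX : ∀ᵐ ω ∂P, ‖X 0 ω‖ ≤ ∑ i, |t i| * C := by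
        filter_upwards [hC] with ω hω
        rw [hXsum]
        refine (norm_sum_le _ _).trans (Finset.sum_le_sum fun i _ => ?_)
        rw [norm_mul]
        exact mul_le_mul_of_nonneg_left (hω i) (abs_nonneg _)
      exact MemLp.of_bound (hXm 0).aestronglyMeasurable _ hbX
    have hclt := tendstoInDistribution_inv_sqrt_mul_sum_sub (P := P) (X := X)
      (Y := id) (P' := gaussianReal 0 Var[X 0; P].toNNReal) HasLaw.id hL2
      (hindep.comp (fun _ y => inner ℝ y t) fun _ => hmt) (fun i => (hident i).comp hmt)
    have h1 := ProbabilityMeasure.tendsto_iff_tendsto_charFun.1 hclt.tendsto 1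
    simp only [ProbabilityMeasure.coe_mk, Measure.map_id, hX0, mul_zero, sub_zero] at h1 ⊢
    rw [charFun_gaussianReal, Real.coe_toNNReal _ (variance_nonneg _ _), hX2] at h1
    rw [charFun_multivariateGaussian hS]
    have h2 : ∀ n : ℕ, charFun (P.map fun ω => (√(n : ℝ))⁻¹ * ∑ k ∈ Finset.range n, X k ω) 1 =
        charFun (P.map fun ω => (√(n : ℝ))⁻¹ • ∑ k ∈ Finset.range n, Y k ω) t := by
      intro n
      rw [charFun_apply, charFun_apply, integral_map, integral_map]
      · refine integral_congr_ae (Eventually.of_forall fun ω => ?_)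
        simp [hX, inner_smul_left, sum_inner]
      · fun_prop
      · exact Continuous.aestronglyMeasurable (by fun_prop)
      · exact ((Finset.measurable_sum _ fun i _ => hXm i).const_mul _).aemeasurable
      · exact Continuous.aestronglyMeasurable (by fun_prop)
    simp only [h2] at h1
    convert h1 using 2
    congr 1
    simp

/-! ### Ordinary differential equations with a Lipschitz vector field -/

/-- `φ` solves `φ' = f φ` on `[0, T]` with `φ 0 = g`. -/
structure IsODESolution {F : Type*} [NormedAddCommGroup F] [NormedSpace ℝ F] (f : F → F) (T : ℝ)
    (g : F) (φ : ℝ → F) : Prop where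
  initial : φ 0 = g
  hasDeriv : ∀ t ∈ Set.Icc 0 T, HasDerivWithinAt φ (f (φ t)) (Set.Icc 0 T) t

namespace IsODESolution

variable {F : Type*} [NormedAddCommGroup F] [NormedSpace ℝ F] {f : F → F} {T : ℝ} {g g' : F}
  {φ φ' : ℝ → F}

theorem continuousOn (h : IsODESolution f T g φ) : ContinuousOn φ (Set.Icc 0 T) :=
  fun t ht => (h.hasDeriv t ht).continuousWithinAt

theorem hasDeriv_Ici (h : IsODESolution f T g φ) {t : ℝ} (ht : t ∈ Set.Ico 0 T) :
    HasDerivWithinAt φ (f (φ t)) (Set.Ici t) t :=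
  (h.hasDeriv t ⟨ht.1, ht.2.le⟩).mono_of_mem_nhdsWithin (Icc_mem_nhdsGE_of_mem ht)

theorem norm_le (h : IsODESolution f T g φ) {K C : ℝ} (hK : ∀ u, ‖f u‖ ≤ K * ‖u‖ + C)
    {t : ℝ} (ht : t ∈ Set.Icc 0 T) : ‖φ t‖ ≤ gronwallBound ‖g‖ K C t := by
  have := norm_le_gronwallBound_of_norm_deriv_right_le h.continuousOn
    (fun t ht => h.hasDeriv_Ici ht) (by rw [h.initial]) (fun t _ => hK (φ t)) t ht
  simpa using this

theorem dist_le (h : IsODESolution f T g φ) (h' : IsODESolution f T g' φ') {K : NNReal}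
    (hf : LipschitzWith K f) {t : ℝ} (ht : t ∈ Set.Icc 0 T) :
    dist (φ t) (φ' t) ≤ dist g g' * Real.exp (K * t) := by
  have := dist_le_of_trajectories_ODE (v := fun _ => f) (fun _ => hf) h.continuousOn
    (fun t ht => h.hasDeriv_Ici ht) h'.continuousOn (fun t ht => h'.hasDeriv_Ici ht)
    (by rw [h.initial, h'.initial]) t ht
  simpa using this

theorem norm_sub_le (h : IsODESolution f T g φ) {D : ℝ} (hD : ∀ t ∈ Set.Icc 0 T, ‖f (φ t)‖ ≤ D)
    {s t : ℝ} (hs : s ∈ Set.Icc 0 T) (ht : t ∈ Set.Icc 0 T) : ‖φ t - φ s‖ ≤ D * |t - s| :=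
  (convex_Icc 0 T).norm_image_sub_le_of_norm_hasDerivWithin_le h.hasDeriv hD hs ht

/-- Local error of one Euler step: the mean value inequality for `r ↦ φ r - r • f (φ s)`, whose
derivative `f (φ r) - f (φ s)` is at most `L D (t - s)`. -/
theorem norm_step_le (h : IsODESolution f T g φ) {D L : ℝ} (hL : 0 ≤ L)
    (hf : ∀ u v, ‖f u - f v‖ ≤ L * ‖u - v‖) (hD : ∀ t ∈ Set.Icc 0 T, ‖f (φ t)‖ ≤ D)
    {s t : ℝ} (hs : 0 ≤ s) (hst : s ≤ t) (ht : t ≤ T) :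
    ‖φ t - φ s - (t - s) • f (φ s)‖ ≤ L * D * (t - s) ^ 2 := by
  have hsub : Set.Icc s t ⊆ Set.Icc 0 T := Set.Icc_subset_Icc hs ht
  have hsT : s ∈ Set.Icc 0 T := ⟨hs, hst.trans ht⟩
  have hD0 : 0 ≤ D := (norm_nonneg _).trans (hD s hsT)
  have key := (convex_Icc s t).norm_image_sub_le_of_norm_hasDerivWithin_le
    (f := fun r => φ r - r • f (φ s)) (f' := fun r => f (φ r) - (1 : ℝ) • f (φ s))
    (C := L * D * (t - s)) (fun r hr => ((h.hasDeriv r (hsub hr)).mono hsub).sub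
      ((hasDerivWithinAt_id r _).smul_const _)) (fun r hr => ?_)
    (Set.left_mem_Icc.2 hst) (Set.right_mem_Icc.2 hst)
  · rw [Real.norm_of_nonneg (sub_nonneg.2 hst)] at key
    calc ‖φ t - φ s - (t - s) • f (φ s)‖
        = ‖φ t - t • f (φ s) - (φ s - s • f (φ s))‖ := by rw [sub_smul]; congr 1; abel
      _ ≤ _ := key
      _ = _ := by ring
  · rw [one_smul, mul_assoc]
    refine (hf _ _).trans (mul_le_mul_of_nonneg_left ?_ hL)
    refine (h.norm_sub_le hD hsT (hsub hr)).trans (mul_le_mul_of_nonneg_left ?_ hD0)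
    rw [abs_of_nonneg (sub_nonneg.2 hr.1)]
    linarith [hr.2]

end IsODESolution

/-- A Lipschitz vector field on `ℝ^ι` has global solutions. -/
theorem exists_isODESolution {ι : Type*} [Fintype ι] {f : (ι → ℝ) → ι → ℝ} {K : NNReal}
    (hf : LipschitzWith K f) {T : ℝ} (hT : 0 ≤ T) (g : ι → ℝ) : ∃ φ, IsODESolution f T g φ := by
  -- The Gronwall bound on any solution up to time `T`, known before existence.
  set R : ℝ := gronwallBound ‖g‖ K ‖f 0‖ T with hR
  have hgR : ‖g‖ ≤ R := by
    rw [← gronwallBound_x0 ‖g‖ K ‖f 0‖]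
    exact gronwallBound_mono (norm_nonneg _) (norm_nonneg _) K.2 hT
  have hR0 : 0 ≤ R := (norm_nonneg _).trans hgR
  -- Coordinatewise truncation, the identity on the sup-norm ball of radius `R`. The field `f ∘ c`
  -- is bounded, so Picard-Lindelöf works on the whole interval at once; it obeys the same growth
  -- bound, so its solution stays in that ball and solves the original equation.
  let c : (ι → ℝ) → ι → ℝ := fun u i => max (-R) (min (u i) R)
  have hc : LipschitzWith 1 c := by
    refine LipschitzWith.of_dist_le_mul fun u v => ?_
    rw [NNReal.coe_one, one_mul]
    refine (dist_pi_le_iff dist_nonneg).2 fun i => ?_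
    refine le_trans ?_ (dist_le_pi_dist u v i)
    refine (abs_max_sub_max_le_max _ _ _ _).trans ?_
    rw [sub_self, abs_zero, max_eq_right (abs_nonneg _)]
    refine (abs_min_sub_min_le_max _ _ _ _).trans ?_
    rw [sub_self, abs_zero, max_eq_left (abs_nonneg _)]
    rfl
  have hcR : ∀ u, ‖c u‖ ≤ R := fun u => (pi_norm_le_iff_of_nonneg hR0).2 fun i =>
    abs_le.2 ⟨le_max_left _ _, max_le (by linarith) (min_le_right _ _)⟩
  have hcid : ∀ u, ‖u‖ ≤ R → c u = u := by
    intro u hu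
    ext i
    have := abs_le.1 ((norm_le_pi_norm u i).trans hu)
    simp only [c]
    rw [min_eq_left this.2, max_eq_right this.1]
  have hc0 : c 0 = 0 := hcid 0 (by simpa using hR0)
  have hfc : LipschitzWith K (f ∘ c) := by simpa using hf.comp hc
  have hgrow : ∀ u, ‖f u‖ ≤ K * ‖u‖ + ‖f 0‖ := fun u => by
    have := hf.norm_sub_le u 0
    rw [sub_zero] at this
    have h2 := norm_le_norm_add_norm_sub' (f u) (f 0)
    linarith
  have hgrowc : ∀ u, ‖(f ∘ c) u‖ ≤ K * ‖u‖ + ‖f 0‖ := fun u => by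
    refine (hgrow _).trans ?_
    have : ‖c u‖ ≤ ‖u‖ := by simpa [hc0] using hc.norm_sub_le u 0
    gcongr
  have hbound : ∀ u, ‖(f ∘ c) u‖ ≤ K * R + ‖f 0‖ := fun u => by
    refine (hgrow _).trans ?_
    gcongr
    exact hcR u
  have hL0 : 0 ≤ K * R + ‖f 0‖ := by positivity
  have hpl : IsPicardLindelof (fun _ => f ∘ c) (⟨0, le_rfl, hT⟩ : Set.Icc 0 T) g
      (⟨(K * R + ‖f 0‖) * T, by positivity⟩) 0 ⟨K * R + ‖f 0‖, hL0⟩ K :=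
    { lipschitzOnWith := fun t _ => hfc.lipschitzOnWith
      continuousOn := fun u _ => continuousOn_const
      norm_le := fun t _ u _ => hbound u
      mul_max_le := by
        simp only [sub_zero, NNReal.coe_zero]
        rw [max_eq_left hT]
        exact le_rfl }
  obtain ⟨φ, h0, hφ⟩ := hpl.exists_eq_forall_mem_Icc_hasDerivWithinAt₀
  have hsol : IsODESolution (f ∘ c) T g φ := ⟨h0, hφ⟩
  refine ⟨φ, h0, fun t ht => ?_⟩
  have hle : ‖φ t‖ ≤ R := (hsol.norm_le hgrowc ht).trans
    (gronwallBound_mono (norm_nonneg _) (norm_nonneg _) K.2 ht.2)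
  have := hφ t ht
  rwa [Function.comp_apply, hcid _ hle] at this

/-! ### Averaging -/

theorem sum_smul_eq_abel {F : Type*} [AddCommGroup F] [Module ℝ F] (a : ℕ → ℝ) (v : ℕ → F)
    (k : ℕ) : ∑ j ∈ Finset.range k, a j • v j = (∑ j ∈ Finset.range k, a j) • v k -
      ∑ j ∈ Finset.range k, (∑ i ∈ Finset.range (j + 1), a i) • (v (j + 1) - v j) := by
  induction k with
  | zero => simp
  | succ k ih =>
    rw [Finset.sum_range_succ, ih, Finset.sum_range_succ (fun j => (∑ i ∈ Finset.range (j + 1), a i)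
      • (v (j + 1) - v j)), Finset.sum_range_succ a k, smul_sub, add_smul, add_smul]
    abel

/-- After summation by parts only the partial sums of `a` enter, so oscillating weights cancel
against vectors that vary slowly. -/
theorem norm_sum_smul_le_of_slowly_varying {F : Type*} [NormedAddCommGroup F] [NormedSpace ℝ F]
    (a : ℕ → ℝ) (v : ℕ → F) {k : ℕ} {A D δ : ℝ}
    (hA : ∀ j ≤ k, |∑ i ∈ Finset.range j, a i| ≤ A) (hD : ‖v k‖ ≤ D)
    (hδ : ∀ j < k, ‖v (j + 1) - v j‖ ≤ δ) :
    ‖∑ j ∈ Finset.range k, a j • v j‖ ≤ A * D + k * (A * δ) := by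
  have hA0 : 0 ≤ A := (abs_nonneg _).trans (hA 0 (Nat.zero_le _))
  rw [sum_smul_eq_abel]
  refine (_root_.norm_sub_le _ _).trans (add_le_add ?_ ?_)
  · rw [norm_smul]
    exact mul_le_mul (hA k le_rfl) hD (norm_nonneg _) hA0
  · refine (norm_sum_le_of_le _ (f := fun j => (∑ i ∈ Finset.range (j + 1), a i) •
      (v (j + 1) - v j)) (n := fun _ => A * δ) fun j hj => ?_).trans (by simp)
    have hj := Finset.mem_range.1 hj
    rw [norm_smul]
    exact mul_le_mul (hA _ hj) (hδ j hj) (norm_nonneg _) hA0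

/-- A perturbed Euler scheme driven by a sequence `ξ` with asymptotic frequencies `q` stays close
to the solution of the averaged equation. -/
theorem norm_sub_le_of_averaging {F Ξ : Type*} [NormedAddCommGroup F] [NormedSpace ℝ F]
    [Fintype Ξ] [DecidableEq Ξ] {b : Ξ → F → F} {q : Ξ → ℝ} {f : F → F}
    (hf : ∀ u, f u = ∑ z, q z • b z u) {L D M κ ρ T : ℝ} (hL : 0 ≤ L) (hT : 0 ≤ T)
    (hb : ∀ z u v, ‖b z u - b z v‖ ≤ L * ‖u - v‖) (hfL : ∀ u v, ‖f u - f v‖ ≤ L * ‖u - v‖)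
    (hbD : ∀ z u, ‖u‖ ≤ M → ‖b z u‖ ≤ D) {N : ℝ} (hN : 0 < N) {n : ℕ} (hn : n ≤ N * T)
    {ξ : ℕ → Ξ} {h : ℕ → F} (hM : ∀ k ≤ n, ‖h k‖ ≤ M)
    (hstep : ∀ k < n, ‖h (k + 1) - h k - N⁻¹ • b (ξ k) (h k)‖ ≤ ρ * N⁻¹) (hρ : 0 ≤ ρ)
    (hκ : ∀ k ≤ n, ∀ z, |∑ j ∈ Finset.range k, ((if ξ j = z then (1 : ℝ) else 0) - q z)| ≤ κ * N)
    {φ : ℝ → F} (hφ : IsODESolution f T (h 0) φ) (hD : ∀ t ∈ Set.Icc 0 T, ‖f (φ t)‖ ≤ D)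
    {k : ℕ} (hk : k ≤ n) :
    ‖h k - φ (k * N⁻¹)‖ ≤
      (T * ρ + Fintype.card Ξ * (κ * (D + T * (L * (D + ρ)))) + T * (L * D * N⁻¹)) *
        Real.exp (L * T) := by
  have hNi : 0 < N⁻¹ := inv_pos.2 hN
  have hmem : ∀ j ≤ n, (j : ℝ) * N⁻¹ ∈ Set.Icc 0 T := fun j hj =>
    ⟨by positivity, by
      rw [← div_eq_mul_inv, div_le_iff₀ hN, mul_comm T]
      exact (Nat.cast_le.2 hj).trans hn⟩
  have hD0 : 0 ≤ D := (norm_nonneg _).trans (hD _ (hmem 0 (Nat.zero_le _)))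
  have hkN : ∀ j ≤ n, (j : ℝ) * N⁻¹ ≤ T := fun j hj => (hmem j hj).2
  have hκ0 : 0 ≤ κ := by
    rcases isEmpty_or_nonempty Ξ with hΞ | ⟨⟨z⟩⟩
    · exact (hΞ.false (ξ 0)).elim
    · have := (abs_nonneg _).trans (hκ 0 (Nat.zero_le _) z)
      exact nonneg_of_mul_nonneg_left this hN
  have hinc : ∀ j < n, ‖h (j + 1) - h j‖ ≤ (D + ρ) * N⁻¹ := fun j hj => by
    have h1 := hstep j hj
    have h2 : ‖N⁻¹ • b (ξ j) (h j)‖ ≤ N⁻¹ * D := by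
      rw [norm_smul, Real.norm_of_nonneg hNi.le]
      exact mul_le_mul_of_nonneg_left (hbD _ _ (hM j hj.le)) hNi.le
    have h3 := norm_le_norm_sub_add (h (j + 1) - h j) (N⁻¹ • b (ξ j) (h j))
    linarith
  set ε := T * ρ + Fintype.card Ξ * (κ * (D + T * (L * (D + ρ)))) + T * (L * D * N⁻¹) with hε
  have hε0 : 0 ≤ ε := by positivity
  -- Group the steps by the value `z` of the driver. The centred indicators of each group have
  -- partial sums at most `κ N`, while `b z (h j)` changes by at most `L (D + ρ) / N` per step.
  have hfluct : ∀ k ≤ n, ‖∑ j ∈ Finset.range k, (b (ξ j) (h j) - f (h j))‖ ≤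
      N * (Fintype.card Ξ * (κ * (D + T * (L * (D + ρ))))) := by
    intro k hk
    have h1 : ∑ j ∈ Finset.range k, (b (ξ j) (h j) - f (h j)) =
        ∑ z, ∑ j ∈ Finset.range k, ((if ξ j = z then (1 : ℝ) else 0) - q z) • b z (h j) := by
      rw [Finset.sum_comm]
      refine Finset.sum_congr rfl fun j _ => ?_
      simp only [sub_smul, Finset.sum_sub_distrib, hf, ite_smul, one_smul, zero_smul]
      simp
    rw [h1]
    refine (norm_sum_le_of_le _ (n := fun _ => N * (κ * (D + T * (L * (D + ρ)))))
      fun z _ => ?_).trans (by simp; linarith)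
    refine (norm_sum_smul_le_of_slowly_varying _ _ (fun j hj => hκ j (hj.trans hk) z)
      (hbD z _ (hM k hk)) (δ := L * ((D + ρ) * N⁻¹)) (fun j hj => (hb _ _ _).trans
        (mul_le_mul_of_nonneg_left (hinc j (hj.trans_le hk)) hL))).trans ?_
    have h2 : (k : ℝ) * (κ * N * (L * ((D + ρ) * N⁻¹))) =
        (k * N⁻¹) * (N * (κ * (L * (D + ρ)))) := by ring
    rw [h2]
    have h3 := mul_le_mul_of_nonneg_right (hkN k hk)
      (show 0 ≤ N * (κ * (L * (D + ρ))) by positivity)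
    linarith
  set d : ℕ → ℝ := fun j => ‖h j - φ (j * N⁻¹)‖ with hd
  have hode : ∀ j < n, ‖φ ((j + 1 : ℕ) * N⁻¹) - φ (j * N⁻¹) - N⁻¹ • f (φ (j * N⁻¹))‖ ≤
      L * D * (N⁻¹) ^ 2 := by
    intro j hj
    have := hφ.norm_step_le hL hfL hD (s := j * N⁻¹) (t := (j + 1 : ℕ) * N⁻¹) (by positivity)
      (by push_cast; nlinarith) (hkN _ hj)
    have h4 : ((j + 1 : ℕ) : ℝ) * N⁻¹ - j * N⁻¹ = N⁻¹ := by push_cast; ring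
    rwa [h4] at this
  have hdk : ∀ k ≤ n, d k ≤ ε + ∑ j ∈ Finset.range k, L * N⁻¹ * d j := by
    intro k hk
    -- Telescoping splits the error into the defect of the scheme, the local Euler error of `φ`, a
    -- Lipschitz feedback term and the averaging fluctuation.
    have h1 : h k - φ (k * N⁻¹) = ∑ j ∈ Finset.range k, ((h (j + 1) - h j - N⁻¹ • b (ξ j) (h j)) -
        (φ ((j + 1 : ℕ) * N⁻¹) - φ (j * N⁻¹) - N⁻¹ • f (φ (j * N⁻¹)))
        + N⁻¹ • (f (h j) - f (φ (j * N⁻¹)))) +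
        N⁻¹ • ∑ j ∈ Finset.range k, (b (ξ j) (h j) - f (h j)) := by
      rw [Finset.smul_sum, ← Finset.sum_add_distrib]
      have h2 : h k - φ (k * N⁻¹) = ∑ j ∈ Finset.range k,
          ((h (j + 1) - φ ((j + 1 : ℕ) * N⁻¹)) - (h j - φ (j * N⁻¹))) := by
        rw [Finset.sum_range_sub (fun j => h j - φ (j * N⁻¹))]
        simp [hφ.initial]
      rw [h2]
      refine Finset.sum_congr rfl fun j _ => ?_
      simp only [smul_sub]
      abel
    have h2 : ‖∑ j ∈ Finset.range k, ((h (j + 1) - h j - N⁻¹ • b (ξ j) (h j)) -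
        (φ ((j + 1 : ℕ) * N⁻¹) - φ (j * N⁻¹) - N⁻¹ • f (φ (j * N⁻¹)))
        + N⁻¹ • (f (h j) - f (φ (j * N⁻¹))))‖ ≤
        ∑ j ∈ Finset.range k, (ρ * N⁻¹ + L * D * (N⁻¹) ^ 2 + L * N⁻¹ * d j) := by
      refine norm_sum_le_of_le _ fun j hj => ?_
      have hj : j < n := (Finset.mem_range.1 hj).trans_le hk
      refine (norm_add_le _ _).trans (add_le_add ((_root_.norm_sub_le _ _).trans
        (add_le_add (hstep j hj) (hode j hj))) ?_)
      rw [norm_smul, Real.norm_of_nonneg hNi.le]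
      have := mul_le_mul_of_nonneg_left (hfL (h j) (φ (j * N⁻¹))) hNi.le
      calc _ ≤ _ := this
        _ = _ := by simp only [hd]; ring
    have h3 : ‖N⁻¹ • ∑ j ∈ Finset.range k, (b (ξ j) (h j) - f (h j))‖ ≤
        Fintype.card Ξ * (κ * (D + T * (L * (D + ρ)))) := by
      rw [norm_smul, Real.norm_of_nonneg hNi.le]
      have := mul_le_mul_of_nonneg_left (hfluct k hk) hNi.le
      rwa [inv_mul_cancel_left₀ hN.ne'] at this
    have h4 : ∑ j ∈ Finset.range k, (ρ * N⁻¹ + L * D * (N⁻¹) ^ 2 + L * N⁻¹ * d j) =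
        (k * N⁻¹) * (ρ + L * D * N⁻¹) + ∑ j ∈ Finset.range k, L * N⁻¹ * d j := by
      rw [Finset.sum_add_distrib, Finset.sum_const, Finset.card_range, nsmul_eq_mul]
      ring
    have h5 := mul_le_mul_of_nonneg_right (hkN k hk)
      (show 0 ≤ ρ + L * D * N⁻¹ by positivity)
    rw [h4] at h2
    have h6 : d k ≤ _ := (congrArg norm h1).le.trans (norm_add_le _ _)
    linarith
  -- Discrete Gronwall, run on the right-hand side of `hdk` rather than on `d`, since the former
  -- satisfies a one-step recursion.
  have hs : ∀ k ≤ n, ε + ∑ j ∈ Finset.range k, L * N⁻¹ * d j ≤ ε * (1 + L * N⁻¹) ^ k := by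
    intro k
    induction k with
    | zero => simp
    | succ k ih =>
      intro hk
      have ih := ih (Nat.le_of_succ_le hk)
      have h1 := mul_le_mul_of_nonneg_left ((hdk k (Nat.le_of_succ_le hk)).trans ih)
        (show 0 ≤ L * N⁻¹ by positivity)
      rw [Finset.sum_range_succ, pow_succ]
      linarith
  refine ((hdk k hk).trans (hs k hk)).trans (mul_le_mul_of_nonneg_left ?_ hε0)
  calc (1 + L * N⁻¹) ^ k ≤ Real.exp (L * N⁻¹) ^ k := by
        gcongr
        rw [add_comm]
        exact Real.add_one_le_exp _
    _ = Real.exp (L * (k * N⁻¹)) := by rw [← Real.exp_nat_mul]; ring_nf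
    _ ≤ Real.exp (L * T) := by
        gcongr
        exact hkN k hk

/-! ### Deterministic lemmas on averages -/

/-- From `m ^ 2` to the next square the sum changes by at most `2 m`, which is negligible against `m
^ 2`. Squares are sparse enough for second moments of the averages to be summable. -/
theorem tendsto_inv_mul_of_tendsto_sq {S : ℕ → ℝ} (hS : ∀ n, |S (n + 1) - S n| ≤ 1)
    (h : Tendsto (fun m : ℕ => ((m : ℝ) ^ 2)⁻¹ * S (m ^ 2)) atTop (𝓝 0)) :
    Tendsto (fun n : ℕ => (n : ℝ)⁻¹ * S n) atTop (𝓝 0) := by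
  have hlip : ∀ m k : ℕ, |S (m + k) - S m| ≤ k := by
    intro m k
    induction k with
    | zero => simp
    | succ k ih =>
      have h1 := abs_sub_le (S (m + (k + 1))) (S (m + k)) (S m)
      have h2 := hS (m + k)
      rw [add_assoc] at h2
      push_cast
      linarith
  have hsqrt : Tendsto Nat.sqrt atTop atTop :=
    tendsto_atTop_atTop.2 fun b => ⟨b * b, fun a ha => Nat.le_sqrt.2 ha⟩
  have hb : Tendsto (fun n : ℕ => |((n.sqrt : ℝ) ^ 2)⁻¹ * S (n.sqrt ^ 2)| + 2 * (n.sqrt : ℝ)⁻¹)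
      atTop (𝓝 0) := by
    have h1 := (h.comp hsqrt).abs
    have h2 := ((tendsto_inv_atTop_nhds_zero_nat (𝕜 := ℝ)).comp hsqrt).const_mul 2
    simpa using h1.add h2
  refine squeeze_zero_norm' ?_ hb
  filter_upwards [eventually_ge_atTop 1] with n hn
  set m := n.sqrt with hm
  have hm1 : 1 ≤ m := Nat.le_sqrt.2 (by simpa using hn)
  have hmn : m ^ 2 ≤ n := by rw [sq]; exact Nat.sqrt_le n
  have hnm : n ≤ m ^ 2 + 2 * m := by
    have := Nat.sqrt_le_add n
    rw [← hm] at this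
    nlinarith
  obtain ⟨k, hk⟩ := Nat.exists_eq_add_of_le hmn
  have hk2 : (k : ℝ) ≤ 2 * m := by
    have : k ≤ 2 * m := by omega
    exact_mod_cast this
  have h1 := hlip (m ^ 2) k
  rw [← hk] at h1
  have h2 : |S n| ≤ |S (m ^ 2)| + 2 * m := by
    have := abs_sub_abs_le_abs_sub (S n) (S (m ^ 2))
    linarith
  have hm0 : (0 : ℝ) < m := by exact_mod_cast hm1
  have hmn' : (m : ℝ) ^ 2 ≤ n := by exact_mod_cast hmn
  rw [Real.norm_eq_abs, abs_mul, abs_mul, abs_of_nonneg (by positivity : (0 : ℝ) ≤ (n : ℝ)⁻¹),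
    abs_of_nonneg (by positivity : (0 : ℝ) ≤ ((m : ℝ) ^ 2)⁻¹)]
  calc (n : ℝ)⁻¹ * |S n| ≤ ((m : ℝ) ^ 2)⁻¹ * (|S (m ^ 2)| + 2 * m) := by
        gcongr
    _ = ((m : ℝ) ^ 2)⁻¹ * |S (m ^ 2)| + 2 * (m : ℝ)⁻¹ := by
        field_simp

/-- Makes the bound uniform in `k ≤ N T`: late indices are controlled by the limit, and the finitely
many early ones are absorbed by `κ N` once `N` is large. -/
theorem eventually_forall_abs_le_of_tendsto {S : ℕ → ℝ} (hS0 : S 0 = 0)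
    (h : Tendsto (fun n : ℕ => (n : ℝ)⁻¹ * S n) atTop (𝓝 0)) {T : ℝ} (hT : 0 ≤ T) {κ : ℝ}
    (hκ : 0 < κ) : ∀ᶠ N : ℕ in atTop, ∀ k : ℕ, (k : ℝ) ≤ N * T → |S k| ≤ κ * N := by
  -- Dividing by `T + 1` instead of `T` keeps the case `T = 0`.
  have hκ' : 0 < κ / (T + 1) := by positivity
  obtain ⟨n₀, hn₀⟩ := eventually_atTop.1 ((Metric.tendsto_nhds.1 h) _ hκ')
  obtain ⟨N₀, hN₀⟩ := exists_nat_gt ((∑ j ∈ Finset.range n₀, |S j|) / κ)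
  have hN₀' : (∑ j ∈ Finset.range n₀, |S j|) < κ * N₀ := by
    rw [div_lt_iff₀ hκ] at hN₀
    linarith
  filter_upwards [eventually_ge_atTop N₀] with N hN k hk
  have hNN : (N₀ : ℝ) ≤ N := by exact_mod_cast hN
  rcases lt_or_ge k n₀ with hlt | hge
  · have h1 := Finset.single_le_sum (f := fun j => |S j|) (fun j _ => abs_nonneg _)
      (Finset.mem_range.2 hlt)
    have h2 := mul_le_mul_of_nonneg_left hNN hκ.le
    linarith
  · have h1 := hn₀ k hge
    rcases Nat.eq_zero_or_pos k with rfl | hk0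
    · rw [hS0, abs_zero]
      positivity
    · have hk0' : (0 : ℝ) < k := by exact_mod_cast hk0
      rw [Real.dist_eq, sub_zero, abs_mul, abs_of_nonneg (by positivity : (0 : ℝ) ≤ (k : ℝ)⁻¹),
        inv_mul_lt_iff₀ hk0'] at h1
      refine h1.le.trans ?_
      calc k * (κ / (T + 1)) ≤ (N * T) * (κ / (T + 1)) := by gcongr
        _ = κ * N * (T / (T + 1)) := by ring
        _ ≤ κ * N * 1 := by
          gcongr
          rw [div_le_one (by positivity)]
          linarith
        _ = κ * N := mul_one _

/-! ### Ergodic averages along the exploration chain -/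

namespace MDP

variable {dx da : ℕ} {M : MDP dx da}

namespace IsExplorationChain

variable {Ω : Type*} [MeasurableSpace Ω] {P : Measure Ω} {x : ℕ → Ω → M.states}
  {a : ℕ → Ω → M.actions}

theorem measurableSet_cylinder (h : M.IsExplorationChain P x a) (n m : ℕ) (u : ℕ → M.states)
    (b : ℕ → M.actions) : MeasurableSet {ω | (∀ k ≤ n, x k ω = u k) ∧ ∀ k < m, a k ω = b k} := by
  have h1 : {ω | (∀ k ≤ n, x k ω = u k) ∧ ∀ k < m, a k ω = b k} =
      (⋂ k, ⋂ (_ : k ≤ n), x k ⁻¹' {u k}) ∩ ⋂ k, ⋂ (_ : k < m), a k ⁻¹' {b k} := by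
    ext ω; simp
  rw [h1]
  exact (MeasurableSet.iInter fun k => MeasurableSet.iInter fun _ =>
    h.measurable_state k (measurableSet_singleton _)).inter
    (MeasurableSet.iInter fun k => MeasurableSet.iInter fun _ =>
      h.measurable_action k (measurableSet_singleton _))

theorem measurableSet_cylinder' (h : M.IsExplorationChain P x a) (n m : ℕ) (u : ℕ → M.states)
    (b : ℕ → M.actions) : MeasurableSet {ω | (∀ k ≤ n, x k ω = u k) ∧ ∀ k ≤ m, a k ω = b k} := by
  simpa only [Nat.lt_succ_iff] using h.measurableSet_cylinder n (m + 1) u b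

/-- Conditioning on the initial state. -/
theorem cond (h : M.IsExplorationChain P x a) (z : M.states) :
    M.IsExplorationChain (P[|x 0 ⁻¹' {z}]) x a := by
  have hz : MeasurableSet (x 0 ⁻¹' {z}) := h.measurable_state 0 (measurableSet_singleton _)
  -- A cylinder that prescribes `x 0` is either contained in the conditioning event or disjoint from
  -- it.
  have key : ∀ (n : ℕ) (u : ℕ → M.states) (Q : Ω → Prop),
      (P[|x 0 ⁻¹' {z}]).real {ω | (∀ k ≤ n, x k ω = u k) ∧ Q ω} =
        if u 0 = z then (P.real (x 0 ⁻¹' {z}))⁻¹ * P.real {ω | (∀ k ≤ n, x k ω = u k) ∧ Q ω}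
        else 0 := by
    intro n u Q
    rw [measureReal_def, cond_apply hz, ENNReal.toReal_mul, ENNReal.toReal_inv,
      ← measureReal_def, ← measureReal_def]
    split_ifs with hu
    · congr 2
      ext ω
      simp only [Set.mem_inter_iff, Set.mem_preimage, Set.mem_singleton_iff, Set.mem_ofPred_eq,
        and_iff_right_iff_imp]
      exact fun hω => (hω.1 0 (Nat.zero_le _)).trans hu
    · have : x 0 ⁻¹' {z} ∩ {ω | (∀ k ≤ n, x k ω = u k) ∧ Q ω} = ∅ := by
        ext ω
        simp only [Set.mem_inter_iff, Set.mem_preimage, Set.mem_singleton_iff, Set.mem_ofPred_eq,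
          Set.mem_empty_iff_false, iff_false, not_and]
        exact fun h0 h1 => (hu ((h1 0 (Nat.zero_le _)).symm.trans h0)).elim
      rw [this, measureReal_empty, mul_zero]
  refine ⟨h.measurable_state, h.measurable_action, fun n u b => ?_, fun n u b => ?_⟩
  · rw [key n u fun ω => ∀ k ≤ n, a k ω = b k, key n u fun ω => ∀ k < n, a k ω = b k]
    split_ifs
    · rw [h.action_uniform, mul_assoc]
    · rw [zero_mul]
  · rw [key (n + 1) u fun ω => ∀ k ≤ n, a k ω = b k, key n u fun ω => ∀ k ≤ n, a k ω = b k]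
    split_ifs
    · rw [h.transition, mul_assoc]
    · rw [zero_mul]

/-- The law of the trajectory on the path space. -/
theorem map_path (h : M.IsExplorationChain P x a) :
    M.IsExplorationChain (P.map fun ω => ((fun k => x k ω, fun k => a k ω) :
      (ℕ → M.states) × (ℕ → M.actions))) (fun k y => y.1 k) (fun k y => y.2 k) := by
  have hm : Measurable fun ω => ((fun k => x k ω, fun k => a k ω) :
      (ℕ → M.states) × (ℕ → M.actions)) :=
    (measurable_pi_lambda _ h.measurable_state).prodMk
      (measurable_pi_lambda _ h.measurable_action)
  have key : ∀ (n m : ℕ) (u : ℕ → M.states) (b : ℕ → M.actions),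
      (P.map fun ω => ((fun k => x k ω, fun k => a k ω) :
        (ℕ → M.states) × (ℕ → M.actions))).real
        {y | (∀ k ≤ n, y.1 k = u k) ∧ ∀ k < m, y.2 k = b k} =
      P.real {ω | (∀ k ≤ n, x k ω = u k) ∧ ∀ k < m, a k ω = b k} := by
    intro n m u b
    rw [map_measureReal_apply hm]
    · rfl
    · have h1 : {y : (ℕ → M.states) × (ℕ → M.actions) |
          (∀ k ≤ n, y.1 k = u k) ∧ ∀ k < m, y.2 k = b k} =
          (⋂ k, ⋂ (_ : k ≤ n), (fun y => y.1 k) ⁻¹' {u k}) ∩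
          ⋂ k, ⋂ (_ : k < m), (fun y => y.2 k) ⁻¹' {b k} := by
        ext y; simp
      rw [h1]
      exact (MeasurableSet.iInter fun k => MeasurableSet.iInter fun _ =>
        ((measurable_pi_apply k).comp measurable_fst) (measurableSet_singleton _)).inter
        (MeasurableSet.iInter fun k => MeasurableSet.iInter fun _ =>
          ((measurable_pi_apply k).comp measurable_snd) (measurableSet_singleton _))
  have key' : ∀ (n m : ℕ) (u : ℕ → M.states) (b : ℕ → M.actions),
      (P.map fun ω => ((fun k => x k ω, fun k => a k ω) :
        (ℕ → M.states) × (ℕ → M.actions))).real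
        {y | (∀ k ≤ n, y.1 k = u k) ∧ ∀ k ≤ m, y.2 k = b k} =
      P.real {ω | (∀ k ≤ n, x k ω = u k) ∧ ∀ k ≤ m, a k ω = b k} := by
    intro n m u b
    simpa only [Nat.lt_succ_iff] using key n (m + 1) u b
  refine ⟨fun k => (measurable_pi_apply k).comp measurable_fst,
    fun k => (measurable_pi_apply k).comp measurable_snd, fun n u b => ?_, fun n u b => ?_⟩
  · rw [key', key, h.action_uniform]
  · rw [key', key', h.transition]

/-- The assumption concerns chains with a deterministic initial state on sample spaces in `Type`.
Conditioning on each of the finitely many initial states gives the former, and passing to the law on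
path space gives the latter for `Ω` in any universe. -/
theorem ae_tendsto_occupation [IsProbabilityMeasure P] (h : M.IsExplorationChain P x a)
    {ϖ : M.states → ℝ} (hϖ : M.IsLimitingDistribution ϖ) (s : M.states) :
    ∀ᵐ ω ∂P, Tendsto (fun n : ℕ => (n : ℝ)⁻¹ *
      ∑ k ∈ Finset.Icc 1 n, if x k ω = s then (1 : ℝ) else 0) atTop (𝓝 (ϖ s)) := by
  have hz : ∀ z, ∀ᵐ ω ∂P, x 0 ω = z → Tendsto (fun n : ℕ => (n : ℝ)⁻¹ *
      ∑ k ∈ Finset.Icc 1 n, if x k ω = s then (1 : ℝ) else 0) atTop (𝓝 (ϖ s)) := by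
    intro z
    have hmz : MeasurableSet (x 0 ⁻¹' {z}) := h.measurable_state 0 (measurableSet_singleton _)
    by_cases h0 : P (x 0 ⁻¹' {z}) = 0
    · filter_upwards [measure_eq_zero_iff_ae_notMem.1 h0] with ω hω hω'
      exact (hω hω').elim
    have hp : IsProbabilityMeasure (P[|x 0 ⁻¹' {z}]) := cond_isProbabilityMeasure h0
    have hm : Measurable fun ω => ((fun k => x k ω, fun k => a k ω) :
        (ℕ → M.states) × (ℕ → M.actions)) :=
      (measurable_pi_lambda _ h.measurable_state).prodMk
        (measurable_pi_lambda _ h.measurable_action)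
    have hp' := Measure.isProbabilityMeasure_map (μ := P[|x 0 ⁻¹' {z}]) hm.aemeasurable
    have h1 := hϖ.tendsto_occupation z _ _ _ _ (h.cond z).map_path ((ae_map_iff
      hm.aemeasurable (((measurable_pi_apply 0).comp measurable_fst)
        (measurableSet_singleton z))).2 (ae_cond_mem hmz)) s
    have h2 := ae_of_ae_map hm.aemeasurable h1
    rw [ProbabilityTheory.cond, Measure.ae_ennreal_smul_measure_iff
      (ENNReal.inv_ne_zero.2 (measure_ne_top _ _)), ae_restrict_iff' hmz] at h2
    exact h2
  filter_upwards [ae_all_iff.2 hz] with ω hω using hω _ rfl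

end IsExplorationChain

/-- `F` depends only on `x 0, …, x n` and `a 0, …, a (n - 1)`. -/
def IsPrefixFun {Ω : Type*} (x : ℕ → Ω → M.states) (a : ℕ → Ω → M.actions) (n : ℕ)
    (F : Ω → ℝ) : Prop :=
  ∀ ω ω', (∀ k ≤ n, x k ω = x k ω') → (∀ k < n, a k ω = a k ω') → F ω = F ω'

open Classical in
/-- The difference between the indicator of the transition `(s, b) → z` at time `k` and its
conditional probability given the past. -/
noncomputable def innovation {Ω : Type*} (x : ℕ → Ω → M.states) (a : ℕ → Ω → M.actions)
    (s : M.states) (b : M.actions) (z : M.states) (k : ℕ) (ω : Ω) : ℝ :=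
  (if x k ω = s ∧ a k ω = b ∧ x (k + 1) ω = z then 1 else 0) -
    if x k ω = s then M.p z s b * (M.actions.card : ℝ)⁻¹ else 0

theorem p_le_one (z s : M.states) (b : M.actions) : M.p z s b ≤ 1 := by
  rw [← M.p_sum s b]
  exact Finset.single_le_sum (f := fun z => M.p z s b) (fun z _ => M.p_nonneg z s b)
    (Finset.mem_univ z)

theorem p_mul_inv_card_mem (z s : M.states) (b : M.actions) :
    M.p z s b * (M.actions.card : ℝ)⁻¹ ∈ Set.Icc (0 : ℝ) 1 := by
  have h1 : (1 : ℝ) ≤ M.actions.card := by exact_mod_cast M.actions_nonempty.card_pos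
  exact ⟨mul_nonneg (M.p_nonneg _ _ _) (by positivity),
    mul_le_one₀ (p_le_one z s b) (by positivity) (inv_le_one_of_one_le₀ h1)⟩

theorem abs_innovation_le {Ω : Type*} (x : ℕ → Ω → M.states) (a : ℕ → Ω → M.actions)
    (s : M.states) (b : M.actions) (z : M.states) (k : ℕ) (ω : Ω) :
    |innovation x a s b z k ω| ≤ 1 := by
  have := p_mul_inv_card_mem (M := M) z s b
  unfold innovation
  rw [abs_le]
  split_ifs <;> constructor <;> linarith [this.1, this.2]

theorem abs_sum_innovation_le {Ω : Type*} (x : ℕ → Ω → M.states) (a : ℕ → Ω → M.actions)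
    (s : M.states) (b : M.actions) (z : M.states) (n : ℕ) (ω : Ω) :
    |∑ k ∈ Finset.range n, innovation x a s b z k ω| ≤ n :=
  (Finset.abs_sum_le_sum_abs _ _).trans ((Finset.sum_le_sum fun k _ =>
    abs_innovation_le x a s b z k ω).trans (by simp))

/-- The last summand, of index `n - 1`, reads `x n` but only the action at `n - 1`; this is why a
prefix of length `n` contains the state at time `n` and not the action. -/
theorem isPrefixFun_sum_innovation {Ω : Type*} (x : ℕ → Ω → M.states) (a : ℕ → Ω → M.actions)
    (s : M.states) (b : M.actions) (z : M.states) (n : ℕ) :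
    IsPrefixFun x a n fun ω => ∑ k ∈ Finset.range n, innovation x a s b z k ω := by
  intro ω ω' hx ha
  refine Finset.sum_congr rfl fun k hk => ?_
  have hk := Finset.mem_range.1 hk
  simp only [innovation, hx k hk.le, ha k hk, hx (k + 1) hk]

namespace IsExplorationChain

variable {Ω : Type*} [MeasurableSpace Ω] {P : Measure Ω} {x : ℕ → Ω → M.states}
  {a : ℕ → Ω → M.actions}

theorem measurable_innovation (h : M.IsExplorationChain P x a) (s : M.states) (b : M.actions)
    (z : M.states) (k : ℕ) : Measurable (innovation x a s b z k) := by
  have hx := fun k s => h.measurable_state k (measurableSet_singleton s)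
  have ha := h.measurable_action k (measurableSet_singleton b)
  refine (Measurable.ite ?_ measurable_const measurable_const).sub
    (Measurable.ite (hx k s) measurable_const measurable_const)
  exact (hx k s).inter (ha.inter (hx (k + 1) z))

/-- The martingale difference property, tested on the atoms of the past: on an atom with `x n = s`
the pair `(b, z)` occurs next with conditional probability `p z s b / |actions|`, by the action and
transition laws combined; on the other atoms the innovation vanishes. -/
theorem setIntegral_innovation [IsProbabilityMeasure P] (h : M.IsExplorationChain P x a)
    (s : M.states) (b : M.actions) (z : M.states) (n : ℕ) (u : ℕ → M.states)
    (v : ℕ → M.actions) :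
    ∫ ω in {ω | (∀ k ≤ n, x k ω = u k) ∧ ∀ k < n, a k ω = v k}, innovation x a s b z n ω ∂P
      = 0 := by
  classical
  set C := {ω | (∀ k ≤ n, x k ω = u k) ∧ ∀ k < n, a k ω = v k} with hC
  have hCm : MeasurableSet C := h.measurableSet_cylinder n n u v
  by_cases hu : u n = s
  -- The atom `C` refined by `a n = b` and `x (n + 1) = z`, written as a cylinder so that the chain
  -- identities apply to it.
  · set C' := {ω | (∀ k ≤ n + 1, x k ω = Function.update u (n + 1) z k) ∧
      ∀ k ≤ n, a k ω = Function.update v n b k} with hC'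
    have hCm' : MeasurableSet C' := h.measurableSet_cylinder' (n + 1) n _ _
    have hlast : ∀ ω ∈ C, innovation x a s b z n ω =
        C'.indicator (fun _ => (1 : ℝ)) ω - M.p z s b * (M.actions.card : ℝ)⁻¹ := by
      intro ω hω
      have hxs : x n ω = s := (hω.1 n le_rfl).trans hu
      have hiff : ω ∈ C' ↔ x n ω = s ∧ a n ω = b ∧ x (n + 1) ω = z := by
        constructor
        · intro h'
          have h1 := h'.1 (n + 1) le_rfl
          have h2 := h'.2 n le_rfl
          rw [Function.update_self] at h1 h2
          exact ⟨hxs, h2, h1⟩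
        · rintro ⟨-, h2, h1⟩
          constructor
          · intro k hk
            rcases Nat.lt_or_ge k (n + 1) with hlt | hge
            · rw [Function.update_of_ne hlt.ne]
              exact hω.1 k (Nat.lt_succ_iff.1 hlt)
            · obtain rfl : k = n + 1 := le_antisymm hk hge
              rw [Function.update_self, h1]
          · intro k hk
            rcases Nat.lt_or_ge k n with hlt | hge
            · rw [Function.update_of_ne hlt.ne]
              exact hω.2 k hlt
            · obtain rfl : k = n := le_antisymm hk hge
              rw [Function.update_self, h2]
      rw [innovation, if_pos hxs]
      by_cases hm : ω ∈ C'
      · rw [if_pos (hiff.1 hm), Set.indicator_of_mem hm]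
      · rw [if_neg (fun h' => hm (hiff.2 h')), Set.indicator_of_notMem hm]
    have hsub : C' ⊆ C := by
      intro ω hω
      refine ⟨fun k hk => ?_, fun k hk => ?_⟩
      · have := hω.1 k (by omega)
        rwa [Function.update_of_ne (by omega)] at this
      · have := hω.2 k hk.le
        rwa [Function.update_of_ne (by omega)] at this
    have hprob : P.real C' = P.real C * (M.actions.card : ℝ)⁻¹ * M.p z s b := by
      have h1 := h.transition n (Function.update u (n + 1) z) (Function.update v n b)
      rw [Function.update_self, Function.update_of_ne (by omega : n ≠ n + 1),
        Function.update_self, hu, h.action_uniform] at h1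
      rw [hC', h1, hC]
      congr 3
      ext ω
      refine and_congr (forall₂_congr fun k hk => ?_) (forall₂_congr fun k hk => ?_)
      · rw [Function.update_of_ne (by omega)]
      · rw [Function.update_of_ne (by omega)]
    rw [setIntegral_congr_fun hCm hlast, integral_sub, setIntegral_const,
      integral_indicator hCm', Measure.restrict_restrict hCm', Set.inter_eq_left.2 hsub,
      setIntegral_const, smul_eq_mul, smul_eq_mul, hprob]
    · ring
    · exact (integrable_const _).indicator hCm'
    · exact integrable_const _
  · refine setIntegral_eq_zero_of_forall_eq_zero fun ω hω => ?_
    have hxs : x n ω ≠ s := fun h' => hu ((hω.1 n le_rfl).symm.trans h')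
    rw [innovation, if_neg hxs, if_neg (fun h' => hxs h'.1), sub_zero]

/-- The past takes finitely many values and `F` is constant on each of its atoms, so the integral
splits into atoms and no conditional expectation is needed. -/
theorem integral_mul_innovation [IsProbabilityMeasure P] (h : M.IsExplorationChain P x a)
    (s : M.states) (b : M.actions) (z : M.states) {n : ℕ} {F : Ω → ℝ} (hF : IsPrefixFun x a n F)
    (hint : Integrable (fun ω => F ω * innovation x a s b z n ω) P) :
    ∫ ω, F ω * innovation x a s b z n ω ∂P = 0 := by
  let π : Ω → (Fin (n + 1) → M.states) × (Fin n → M.actions) :=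
    fun ω => (fun k => x k ω, fun k => a k ω)
  have hset : ∀ ω₀, π ⁻¹' {π ω₀} =
      {ω | (∀ k ≤ n, x k ω = x k ω₀) ∧ ∀ k < n, a k ω = a k ω₀} := by
    intro ω₀
    ext ω
    simp only [π, Set.mem_preimage, Set.mem_singleton_iff, Prod.mk.injEq, funext_iff,
      Fin.forall_iff, Set.mem_ofPred_eq, Nat.lt_succ_iff]
  have hcases : ∀ i, π ⁻¹' {i} = ∅ ∨ ∃ ω₀, π ω₀ = i := fun i => by
    rcases Set.eq_empty_or_nonempty (π ⁻¹' {i}) with h0 | ⟨ω₀, hω₀⟩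
    · exact Or.inl h0
    · exact Or.inr ⟨ω₀, hω₀⟩
  have hm : ∀ i, MeasurableSet (π ⁻¹' {i}) := fun i => by
    rcases hcases i with h0 | ⟨ω₀, rfl⟩
    · rw [h0]; exact MeasurableSet.empty
    · rw [hset]; exact h.measurableSet_cylinder n n _ _
  have huniv : (⋃ i, π ⁻¹' {i}) = Set.univ := by
    ext ω; simp
  rw [← setIntegral_univ, ← huniv, integral_iUnion_fintype hm
    (fun i j hij => Disjoint.preimage π (Set.disjoint_singleton.2 hij))
    (fun i => hint.integrableOn)]
  refine Finset.sum_eq_zero fun i _ => ?_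
  rcases hcases i with h0 | ⟨ω₀, rfl⟩
  · rw [h0, Measure.restrict_empty, integral_zero_measure]
  · have h1 : ∀ ω ∈ π ⁻¹' {π ω₀}, F ω * innovation x a s b z n ω =
        F ω₀ * innovation x a s b z n ω := by
      intro ω hω
      rw [hset] at hω
      rw [hF ω ω₀ hω.1 hω.2]
    rw [setIntegral_congr_fun (hm _) h1, integral_const_mul, hset, h.setIntegral_innovation,
      mul_zero]

theorem measurable_sum_innovation (h : M.IsExplorationChain P x a) (s : M.states) (b : M.actions)
    (z : M.states) (n : ℕ) :
    Measurable fun ω => ∑ k ∈ Finset.range n, innovation x a s b z k ω :=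
  Finset.measurable_sum _ fun k _ => h.measurable_innovation s b z k

/-- Orthogonality removes the cross terms, and each square is at most `1`. -/
theorem integral_sum_innovation_sq_le [IsProbabilityMeasure P] (h : M.IsExplorationChain P x a)
    (s : M.states) (b : M.actions) (z : M.states) (n : ℕ) :
    ∫ ω, (∑ k ∈ Finset.range n, innovation x a s b z k ω) ^ 2 ∂P ≤ n := by
  induction n with
  | zero => simp
  | succ n ih =>
    have hm := h.measurable_sum_innovation s b z n
    have hW := h.measurable_innovation s b z n
    have hb := fun ω => abs_sum_innovation_le x a s b z n ω
    have hbW := fun ω => abs_innovation_le x a s b z n ω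
    have i1 : Integrable (fun ω => (∑ k ∈ Finset.range n, innovation x a s b z k ω) ^ 2) P :=
      Integrable.of_bound (hm.pow_const 2).aestronglyMeasurable ((n : ℝ) ^ 2)
        (Eventually.of_forall fun ω => by
          rw [norm_pow]; exact pow_le_pow_left₀ (norm_nonneg _) (hb ω) 2)
    have i2 : Integrable (fun ω => (∑ k ∈ Finset.range n, innovation x a s b z k ω) *
        innovation x a s b z n ω) P :=
      Integrable.of_bound (hm.mul hW).aestronglyMeasurable ((n : ℝ) * 1)
        (Eventually.of_forall fun ω => by
          rw [norm_mul]
          exact mul_le_mul (hb ω) (hbW ω) (norm_nonneg _) (Nat.cast_nonneg _))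
    have i3 : Integrable (fun ω => innovation x a s b z n ω ^ 2) P :=
      Integrable.of_bound (hW.pow_const 2).aestronglyMeasurable ((1 : ℝ) ^ 2)
        (Eventually.of_forall fun ω => by
          rw [norm_pow]; exact pow_le_pow_left₀ (norm_nonneg _) (hbW ω) 2)
    have hexp : ∀ ω, (∑ k ∈ Finset.range (n + 1), innovation x a s b z k ω) ^ 2 =
        (∑ k ∈ Finset.range n, innovation x a s b z k ω) ^ 2 +
        2 * ((∑ k ∈ Finset.range n, innovation x a s b z k ω) * innovation x a s b z n ω) +
        innovation x a s b z n ω ^ 2 := fun ω => by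
      rw [Finset.sum_range_succ]; ring
    have i12 : Integrable (fun ω => (∑ k ∈ Finset.range n, innovation x a s b z k ω) ^ 2 +
        2 * ((∑ k ∈ Finset.range n, innovation x a s b z k ω) * innovation x a s b z n ω)) P :=
      i1.add (i2.const_mul 2)
    simp only [hexp]
    rw [integral_add i12 i3, integral_add i1 (i2.const_mul 2),
      integral_const_mul, h.integral_mul_innovation s b z
        (isPrefixFun_sum_innovation x a s b z n) i2]
    have h3 : ∫ ω, innovation x a s b z n ω ^ 2 ∂P ≤ 1 := by
      have := integral_mono i3 (integrable_const (1 : ℝ)) fun ω => by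
        have := pow_le_pow_left₀ (abs_nonneg _) (hbW ω) 2
        rwa [sq_abs, one_pow] at this
      simpa using this
    push_cast
    linarith

/-- The average over the first `m ^ 2` innovations has second moment at most `m ^ (-2)`. These are
summable, so the squared averages are almost surely summable and tend to zero along the squares;
bounded increments fill the gaps. -/
theorem ae_tendsto_sum_innovation [IsProbabilityMeasure P] (h : M.IsExplorationChain P x a)
    (s : M.states) (b : M.actions) (z : M.states) :
    ∀ᵐ ω ∂P, Tendsto (fun n : ℕ => (n : ℝ)⁻¹ *
      ∑ k ∈ Finset.range n, innovation x a s b z k ω) atTop (𝓝 0) := by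
  set S : ℕ → Ω → ℝ := fun n ω => ∑ k ∈ Finset.range n, innovation x a s b z k ω with hS
  have hSm : ∀ n, Measurable (S n) := fun n => h.measurable_sum_innovation s b z n
  have hsum : ∑' m : ℕ, ∫⁻ ω, ENNReal.ofReal ((((m : ℝ) ^ 2)⁻¹ * S (m ^ 2) ω) ^ 2) ∂P ≠ ⊤ := by
    have hle : ∀ m : ℕ, ∫⁻ ω, ENNReal.ofReal ((((m : ℝ) ^ 2)⁻¹ * S (m ^ 2) ω) ^ 2) ∂P ≤
        ENNReal.ofReal (((m : ℝ) ^ 2)⁻¹) := by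
      intro m
      have hint : Integrable (fun ω => (((m : ℝ) ^ 2)⁻¹ * S (m ^ 2) ω) ^ 2) P :=
        Integrable.of_bound (((hSm _).const_mul _).pow_const 2).aestronglyMeasurable
          ((((m : ℝ) ^ 2)⁻¹ * (m ^ 2 : ℕ)) ^ 2) (Eventually.of_forall fun ω => by
            rw [norm_pow, norm_mul, Real.norm_of_nonneg (by positivity : (0 : ℝ) ≤ ((m : ℝ) ^ 2)⁻¹)]
            exact pow_le_pow_left₀ (by positivity) (mul_le_mul_of_nonneg_left
              (abs_sum_innovation_le x a s b z _ ω) (by positivity)) 2)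
      rw [← ofReal_integral_eq_lintegral_ofReal hint
        (Eventually.of_forall fun ω => sq_nonneg _)]
      refine ENNReal.ofReal_le_ofReal ?_
      simp only [mul_pow]
      rw [integral_const_mul]
      have h1 := h.integral_sum_innovation_sq_le s b z (m ^ 2)
      refine (mul_le_mul_of_nonneg_left h1 (by positivity)).trans ?_
      rcases Nat.eq_zero_or_pos m with rfl | hm
      · simp
      · have : (0 : ℝ) < m := by exact_mod_cast hm
        push_cast
        apply le_of_eq
        field_simp
    refine ne_top_of_le_ne_top ?_ (ENNReal.tsum_le_tsum hle)
    rw [← ENNReal.ofReal_tsum_of_nonneg (fun m => by positivity)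
      (Real.summable_nat_pow_inv.2 (by norm_num))]
    exact ENNReal.ofReal_ne_top
  rw [← lintegral_tsum fun m => (((hSm _).const_mul _).pow_const 2).ennreal_ofReal.aemeasurable]
    at hsum
  have hae := ae_lt_top' (AEMeasurable.tsum fun m =>
    (((hSm _).const_mul _).pow_const 2).ennreal_ofReal.aemeasurable) hsum
  filter_upwards [hae] with ω hω
  refine tendsto_inv_mul_of_tendsto_sq (S := fun n => S n ω) (fun n => ?_) ?_
  · simp only [hS, Finset.sum_range_succ, add_sub_cancel_left]
    exact abs_innovation_le x a s b z n ω
  · have h1 := ENNReal.tendsto_atTop_zero_of_tsum_ne_top hω.ne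
    have h2 := (ENNReal.tendsto_toReal ENNReal.zero_ne_top).comp h1
    simp only [ENNReal.toReal_zero] at h2
    have h3 : Tendsto (fun m : ℕ => (((m : ℝ) ^ 2)⁻¹ * S (m ^ 2) ω) ^ 2) atTop (𝓝 0) :=
      h2.congr fun m => ENNReal.toReal_ofReal (sq_nonneg _)
    have h4 := h3.sqrt
    rw [Real.sqrt_zero] at h4
    exact (tendsto_zero_iff_abs_tendsto_zero _).2
      (h4.congr fun m => by rw [Real.sqrt_sq_eq_abs]; rfl)

open Classical in
/-- The frequencies of the transitions `(x, a) → z` converge almost surely. -/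
theorem ae_tendsto_transition [IsProbabilityMeasure P] (h : M.IsExplorationChain P x a)
    {ϖ : M.states → ℝ} (hϖ : M.IsLimitingDistribution ϖ) :
    ∀ᵐ ω ∂P, ∀ ξ : M.Pair × M.states, Tendsto (fun n : ℕ => (n : ℝ)⁻¹ *
      ∑ k ∈ Finset.range n, ((if ((x k ω, a k ω), x (k + 1) ω) = ξ then (1 : ℝ) else 0) -
        ϖ ξ.1.1 / M.actions.card * M.p ξ.2 ξ.1.1 ξ.1.2)) atTop (𝓝 0) := by
  rw [ae_all_iff]
  rintro ⟨⟨s, b⟩, z⟩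
  filter_upwards [h.ae_tendsto_sum_innovation s b z, h.ae_tendsto_occupation hϖ s] with ω h1 h2
  have hc := p_mul_inv_card_mem (M := M) z s b
  set c := M.p z s b * (M.actions.card : ℝ)⁻¹ with hcdef
  -- Occupation is counted over `1, …, n` but the transitions start at `0, …, n - 1`; the two counts
  -- differ by this boundary term.
  have h3 : Tendsto (fun n : ℕ => (n : ℝ)⁻¹ *
      ((if x 0 ω = s then (1 : ℝ) else 0) - if x n ω = s then (1 : ℝ) else 0)) atTop (𝓝 0) := by
    refine squeeze_zero_norm (fun n => ?_) (tendsto_inv_atTop_nhds_zero_nat (𝕜 := ℝ))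
    rw [norm_mul, Real.norm_of_nonneg (by positivity : (0 : ℝ) ≤ (n : ℝ)⁻¹)]
    refine mul_le_of_le_one_right (by positivity) ?_
    split_ifs <;> simp
  have h4 := h1.add (((h2.sub_const (ϖ s)).add h3).mul_const c)
  simp only [sub_self, zero_add, zero_mul] at h4
  refine h4.congr' ?_
  filter_upwards [eventually_ge_atTop 1] with n hn
  have hn0 : (n : ℝ) ≠ 0 := by positivity
  have h5 : ∑ k ∈ Finset.Icc 1 n, (if x k ω = s then (1 : ℝ) else 0) =
      ∑ k ∈ Finset.range n, (if x k ω = s then (1 : ℝ) else 0) -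
        (if x 0 ω = s then (1 : ℝ) else 0) + if x n ω = s then (1 : ℝ) else 0 := by
    have h6 := Finset.sum_range_succ (fun k => if x k ω = s then (1 : ℝ) else 0) n
    have h7 := Finset.sum_range_succ' (fun k => if x k ω = s then (1 : ℝ) else 0) n
    have h8 : ∑ k ∈ Finset.Icc 1 n, (if x k ω = s then (1 : ℝ) else 0) =
        ∑ k ∈ Finset.range n, (if x (k + 1) ω = s then (1 : ℝ) else 0) := by
      rw [Finset.range_eq_Ico, Finset.sum_Ico_add' (fun k => if x k ω = s then (1 : ℝ) else 0) 0 n 1]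
      rfl
    linarith
  have h9 : ∑ k ∈ Finset.range n, innovation x a s b z k ω =
      ∑ k ∈ Finset.range n, (if ((x k ω, a k ω), x (k + 1) ω) = ((s, b), z) then (1 : ℝ) else 0) -
      c * ∑ k ∈ Finset.range n, (if x k ω = s then (1 : ℝ) else 0) := by
    rw [Finset.mul_sum, ← Finset.sum_sub_distrib]
    refine Finset.sum_congr rfl fun k _ => ?_
    simp only [innovation, Prod.mk.injEq, and_assoc, mul_ite, mul_one, mul_zero, hcdef]
  rw [h5, h9, Finset.sum_sub_distrib, Finset.sum_const, Finset.card_range, nsmul_eq_mul]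
  have h10 : ϖ s / M.actions.card * M.p z s b = ϖ s * c := by rw [hcdef]; ring
  simp only [h10]
  field_simp
  ring

end IsExplorationChain

end MDP

/-! ### One step of Q-learning -/

theorem ActivationBound.abs_taylor_le {σ : ℝ → ℝ} {K : ℝ} (hσ : ActivationBound σ K) (s t : ℝ) :
    |σ t - σ s - deriv σ s * (t - s)| ≤ K * (t - s) ^ 2 := by
  have key := (convex_uIcc s t).norm_image_sub_le_of_norm_hasDerivWithin_le
    (f := fun r => σ r - deriv σ s * r) (f' := fun r => deriv σ r - deriv σ s * 1)
    (C := K * |t - s|) (fun r _ => ((hσ.differentiable r).hasDerivAt.sub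
      ((hasDerivAt_id r).const_mul _)).hasDerivWithinAt) (fun r hr => ?_)
    Set.left_mem_uIcc Set.right_mem_uIcc
  · calc |σ t - σ s - deriv σ s * (t - s)|
        = ‖σ t - deriv σ s * t - (σ s - deriv σ s * s)‖ := by
          rw [Real.norm_eq_abs]; congr 1; ring
      _ ≤ K * |t - s| * ‖t - s‖ := key
      _ = K * (t - s) ^ 2 := by rw [Real.norm_eq_abs, mul_assoc, ← sq, sq_abs]
  · rw [mul_one]
    refine (hσ.lipschitz_deriv r s).trans (mul_le_mul_of_nonneg_left ?_ hσ.nonneg)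
    exact Set.abs_sub_left_of_mem_uIcc hr

theorem abs_mul_sub_mul_le {a b a' b' A B α β : ℝ} (ha : |a| ≤ A) (hb' : |b'| ≤ B)
    (h1 : |a - a'| ≤ α) (h2 : |b - b'| ≤ β) : |a * b - a' * b'| ≤ A * β + α * B := by
  have : a * b - a' * b' = a * (b - b') + (a - a') * b' := by ring
  rw [this]
  refine (abs_add_le _ _).trans ?_
  rw [abs_mul, abs_mul]
  exact add_le_add (mul_le_mul ha h2 (abs_nonneg _) ((abs_nonneg _).trans ha))
    (mul_le_mul h1 hb' (abs_nonneg _) ((abs_nonneg _).trans h1))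

/-- The contribution of one unit to the kernel. -/
noncomputable def unitKernel {d : ℕ} (σ : ℝ → ℝ) (θ : Param d) (v v' : EuclideanSpace ℝ (Fin d)) :
    ℝ :=
  σ (inner ℝ θ.2 v') * σ (inner ℝ θ.2 v) +
    θ.1 ^ 2 * deriv σ (inner ℝ θ.2 v') * deriv σ (inner ℝ θ.2 v) * inner ℝ v' v

theorem abs_inner_sub_inner_le {d : ℕ} (w w' v : EuclideanSpace ℝ (Fin d)) {V ε : ℝ} (hv : ‖v‖ ≤ V)
    (hw : ‖w - w'‖ ≤ ε) : |inner ℝ w v - inner ℝ w' v| ≤ ε * V := by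
  rw [← inner_sub_left]
  exact (abs_real_inner_le_norm _ _).trans
    (mul_le_mul hw hv (norm_nonneg _) ((norm_nonneg _).trans hw))

theorem abs_inner_le_sq {d : ℕ} {v v' : EuclideanSpace ℝ (Fin d)} {V : ℝ} (hv : ‖v‖ ≤ V)
    (hv' : ‖v'‖ ≤ V) : |inner ℝ v v'| ≤ V ^ 2 := by
  rw [sq]
  exact (abs_real_inner_le_norm _ _).trans
    (mul_le_mul hv hv' (norm_nonneg _) ((norm_nonneg _).trans hv))

/-- Lipschitz dependence of the kernel on the parameters; it carries the law of large numbers from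
the initial kernel to the trained one. -/
theorem abs_unitKernel_sub_le {d : ℕ} {σ : ℝ → ℝ} {K : ℝ} (hσ : ActivationBound σ K)
    {θ θ' : Param d} {v v' : EuclideanSpace ℝ (Fin d)} {V b ε : ℝ} (hv : ‖v‖ ≤ V) (hv' : ‖v'‖ ≤ V)
    (hb : |θ.1| ≤ b) (hb' : |θ'.1| ≤ b) (h1 : |θ.1 - θ'.1| ≤ ε) (h2 : ‖θ.2 - θ'.2‖ ≤ ε) :
    |unitKernel σ θ v v' - unitKernel σ θ' v v'| ≤
      (2 * K ^ 2 * V + (2 * b * K ^ 2 + 2 * b ^ 2 * K ^ 2 * V) * V ^ 2) * ε := by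
  have hK := hσ.nonneg
  have hb0 : 0 ≤ b := (abs_nonneg _).trans hb
  have hV0 : 0 ≤ V := (norm_nonneg _).trans hv
  have hε0 : 0 ≤ ε := (abs_nonneg _).trans h1
  have hs : ∀ u : EuclideanSpace ℝ (Fin d), ‖u‖ ≤ V →
      |σ (inner ℝ θ.2 u) - σ (inner ℝ θ'.2 u)| ≤ K * (ε * V) := fun u hu =>
    (hσ.lipschitz _ _).trans
      (mul_le_mul_of_nonneg_left (abs_inner_sub_inner_le _ _ _ hu h2) hK)
  have hs' : ∀ u : EuclideanSpace ℝ (Fin d), ‖u‖ ≤ V →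
      |deriv σ (inner ℝ θ.2 u) - deriv σ (inner ℝ θ'.2 u)| ≤ K * (ε * V) := fun u hu =>
    (hσ.lipschitz_deriv _ _).trans
      (mul_le_mul_of_nonneg_left (abs_inner_sub_inner_le _ _ _ hu h2) hK)
  have t1 := abs_mul_sub_mul_le (hσ.abs_le (inner ℝ θ.2 v')) (hσ.abs_le (inner ℝ θ'.2 v))
    (hs v' hv') (hs v hv)
  have hsq : |θ.1 ^ 2| ≤ b ^ 2 := by
    rw [abs_pow]; exact pow_le_pow_left₀ (abs_nonneg _) hb 2
  have t2 : |θ.1 ^ 2 - θ'.1 ^ 2| ≤ b * ε + ε * b := by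
    rw [sq, sq]; exact abs_mul_sub_mul_le hb hb' h1 h1
  have t3 := abs_mul_sub_mul_le hsq (hσ.abs_deriv_le (inner ℝ θ'.2 v')) t2 (hs' v' hv')
  have t4 : |θ.1 ^ 2 * deriv σ (inner ℝ θ.2 v')| ≤ b ^ 2 * K := by
    rw [abs_mul]; exact mul_le_mul hsq (hσ.abs_deriv_le _) (abs_nonneg _) (by positivity)
  have t5 := abs_mul_sub_mul_le t4 (hσ.abs_deriv_le (inner ℝ θ'.2 v)) t3 (hs' v hv)
  have t6 := mul_le_mul t5 (abs_inner_le_sq hv' hv) (abs_nonneg _) (by positivity)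
  rw [← abs_mul, sub_mul] at t6
  have t7 : unitKernel σ θ v v' - unitKernel σ θ' v v' =
      (σ (inner ℝ θ.2 v') * σ (inner ℝ θ.2 v) - σ (inner ℝ θ'.2 v') * σ (inner ℝ θ'.2 v)) +
      (θ.1 ^ 2 * deriv σ (inner ℝ θ.2 v') * deriv σ (inner ℝ θ.2 v) * inner ℝ v' v -
        θ'.1 ^ 2 * deriv σ (inner ℝ θ'.2 v') * deriv σ (inner ℝ θ'.2 v) * inner ℝ v' v) := by
    unfold unitKernel; ring
  rw [t7]
  refine (abs_add_le _ _).trans ((add_le_add t1 t6).trans (le_of_eq ?_))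
  ring

/-- The update of one unit with step `e` in the direction of the input `v`. -/
noncomputable def unitStep {d : ℕ} (σ : ℝ → ℝ) (e : ℝ) (θ : Param d)
    (v : EuclideanSpace ℝ (Fin d)) : Param d :=
  (θ.1 + e * σ (inner ℝ θ.2 v), θ.2 + (e * θ.1 * deriv σ (inner ℝ θ.2 v)) • v)

section unitStep

variable {d : ℕ} {σ : ℝ → ℝ} {K : ℝ} {θ : Param d} {v v' : EuclideanSpace ℝ (Fin d)} {V b e : ℝ}

theorem abs_unitStep_fst_sub_le (hσ : ActivationBound σ K) :
    |(unitStep σ e θ v).1 - θ.1| ≤ |e| * K := by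
  simp only [unitStep, add_sub_cancel_left]
  rw [abs_mul]
  exact mul_le_mul_of_nonneg_left (hσ.abs_le _) (abs_nonneg _)

theorem norm_unitStep_snd_sub_le (hσ : ActivationBound σ K) (hv : ‖v‖ ≤ V) (hb : |θ.1| ≤ b) :
    ‖(unitStep σ e θ v).2 - θ.2‖ ≤ |e| * (b * K * V) := by
  have hK := hσ.nonneg
  have hb0 : 0 ≤ b := (abs_nonneg _).trans hb
  simp only [unitStep, add_sub_cancel_left]
  rw [norm_smul, norm_mul, norm_mul, Real.norm_eq_abs, Real.norm_eq_abs, Real.norm_eq_abs,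
    mul_assoc, mul_assoc]
  refine mul_le_mul_of_nonneg_left ?_ (abs_nonneg _)
  rw [← mul_assoc]
  exact mul_le_mul (mul_le_mul hb (hσ.abs_deriv_le _) (abs_nonneg _) hb0) hv (norm_nonneg _)
    (by positivity)

theorem abs_unit_sub_le (hσ : ActivationBound σ K) (hv : ‖v‖ ≤ V) (hv' : ‖v'‖ ≤ V)
    (hb : |θ.1| ≤ b) :
    |(unitStep σ e θ v').1 * σ (inner ℝ (unitStep σ e θ v').2 v) - θ.1 * σ (inner ℝ θ.2 v)| ≤
      |e| * (K ^ 2 + b ^ 2 * K ^ 2 * V ^ 2) := by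
  have hK := hσ.nonneg
  have h1 : |θ.1 - (unitStep σ e θ v').1| ≤ |e| * K := by
    rw [abs_sub_comm]; exact abs_unitStep_fst_sub_le hσ
  have h2 : |σ (inner ℝ θ.2 v) - σ (inner ℝ (unitStep σ e θ v').2 v)| ≤
      K * (|e| * (b * K * V) * V) := (hσ.lipschitz _ _).trans
    (mul_le_mul_of_nonneg_left (abs_inner_sub_inner_le _ _ _ hv (by
      rw [norm_sub_rev]; exact norm_unitStep_snd_sub_le hσ hv' hb)) hK)
  rw [abs_sub_comm]
  refine (abs_mul_sub_mul_le hb (hσ.abs_le _) h1 h2).trans (le_of_eq ?_)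
  ring

/-- `unitKernel` is the derivative at `e = 0` of the output of one unit along its update. The
remainder consists of the product of the increments of `c` and of `σ(w·v)`, and of the Taylor
remainder of `σ`; both are quadratic in `e`. -/
theorem abs_unit_sub_sub_le (hσ : ActivationBound σ K) (hv : ‖v‖ ≤ V) (hv' : ‖v'‖ ≤ V)
    (hb : |θ.1| ≤ b) :
    |(unitStep σ e θ v').1 * σ (inner ℝ (unitStep σ e θ v').2 v) - θ.1 * σ (inner ℝ θ.2 v) -
      e * unitKernel σ θ v v'| ≤ e ^ 2 * (b * K ^ 3 * V ^ 2 + b ^ 3 * K ^ 3 * V ^ 4) := by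
  have hK := hσ.nonneg
  have hb0 : 0 ≤ b := (abs_nonneg _).trans hb
  have hV0 : 0 ≤ V := (norm_nonneg _).trans hv
  set c' := (unitStep σ e θ v').1 with hc'
  set s := inner ℝ θ.2 v with hs
  set s' := inner ℝ (unitStep σ e θ v').2 v with hs'
  have hss : s' - s = e * θ.1 * deriv σ (inner ℝ θ.2 v') * inner ℝ v' v := by
    rw [hs', hs, ← inner_sub_left]
    simp only [unitStep, add_sub_cancel_left, inner_smul_left, RCLike.conj_to_real]
  have hcc : c' - θ.1 = e * σ (inner ℝ θ.2 v') := by rw [hc']; simp only [unitStep]; ring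
  have h1 : |c' - θ.1| ≤ |e| * K := abs_unitStep_fst_sub_le hσ
  have h2 : |s' - s| ≤ |e| * (b * K * V) * V :=
    abs_inner_sub_inner_le _ _ _ hv (norm_unitStep_snd_sub_le hσ hv' hb)
  have h3 : |σ s' - σ s| ≤ K * (|e| * (b * K * V) * V) := (hσ.lipschitz _ _).trans
    (mul_le_mul_of_nonneg_left h2 hK)
  have h4 : |σ s' - σ s - deriv σ s * (s' - s)| ≤ K * (|e| * (b * K * V) * V) ^ 2 := by
    refine (hσ.abs_taylor_le s s').trans (mul_le_mul_of_nonneg_left ?_ hK)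
    rw [← sq_abs]
    exact pow_le_pow_left₀ (abs_nonneg _) h2 2
  have h5 : c' * σ s' - θ.1 * σ s - e * unitKernel σ θ v v' =
      (c' - θ.1) * (σ s' - σ s) + θ.1 * (σ s' - σ s - deriv σ s * (s' - s)) := by
    have h6 : e * unitKernel σ θ v v' = (c' - θ.1) * σ s + θ.1 * (deriv σ s * (s' - s)) := by
      rw [hcc, hss, unitKernel]; ring
    rw [h6]; ring
  rw [h5]
  refine (abs_add_le _ _).trans ?_
  rw [abs_mul, abs_mul]
  refine (add_le_add (mul_le_mul h1 h3 (abs_nonneg _) (by positivity))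
    (mul_le_mul hb h4 (abs_nonneg _) hb0)).trans (le_of_eq ?_)
  rw [mul_pow, mul_pow, sq_abs]
  have : |e| * K * (K * (|e| * (b * K * V) * V)) = |e| ^ 2 * (b * K ^ 3 * V ^ 2) := by ring
  rw [this, sq_abs]
  ring

end unitStep

namespace MDP

variable {dx da : ℕ} (M : MDP dx da)

/-- The kernel of the network with parameters `θ`. -/
noncomputable def empiricalKernel (σ : ℝ → ℝ) (α : ℝ) {N : ℕ} (θ : Fin N → Param (dx + da))
    (ζ ζ' : M.Pair) : ℝ :=
  α * ((N : ℝ)⁻¹ * ∑ i, unitKernel σ (θ i) (M.vec ζ) (M.vec ζ'))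

theorem qStep_eq_unitStep (σ : ℝ → ℝ) (γ η : ℝ) {N : ℕ} (θ : Fin N → Param (dx + da)) (ζ : M.Pair)
    (x' : M.states) (i : Fin N) :
    M.qStep σ γ η θ ζ x' i = unitStep σ (η / √(N : ℝ) * M.tdError σ γ θ ζ x') (θ i) (M.vec ζ) := by
  rfl

theorem qNet_qStep_sub (σ : ℝ → ℝ) (γ η : ℝ) {N : ℕ} (θ : Fin N → Param (dx + da)) (ζ ζ' : M.Pair)
    (x' : M.states) : M.qNet σ (M.qStep σ γ η θ ζ' x') ζ - M.qNet σ θ ζ =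
      (√(N : ℝ))⁻¹ * ∑ i, ((M.qStep σ γ η θ ζ' x' i).1 *
        σ (inner ℝ (M.qStep σ γ η θ ζ' x' i).2 (M.vec ζ)) -
          (θ i).1 * σ (inner ℝ (θ i).2 (M.vec ζ))) := by
  rw [qNet, qNet, Finset.sum_sub_distrib, mul_sub]

theorem abs_tdError_le {σ : ℝ → ℝ} {γ rM : ℝ} {N : ℕ} {θ : Fin N → Param (dx + da)}
    (hr : ∀ x a, |M.r x a| ≤ rM) (hγ0 : 0 ≤ γ) (hγ1 : γ ≤ 1)
    (ζ : M.Pair) (x' : M.states) : |M.tdError σ γ θ ζ x'| ≤ rM + 2 * ‖M.qNet σ θ‖ := by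
  have h1 := M.abs_maxAction_le (M.qNet σ θ) x'
  have h2 : |γ * M.maxAction (M.qNet σ θ) x'| ≤ ‖M.qNet σ θ‖ := by
    rw [abs_mul, abs_of_nonneg hγ0]
    exact (mul_le_of_le_one_left (abs_nonneg _) hγ1).trans h1
  have h3 : |M.qNet σ θ ζ| ≤ ‖M.qNet σ θ‖ := norm_le_pi_norm (M.qNet σ θ) ζ
  have h4 := hr ζ.1 ζ.2
  have h5 := abs_sub (M.r ζ.1 ζ.2 + γ * M.maxAction (M.qNet σ θ) x') (M.qNet σ θ ζ)
  have h6 := abs_add_le (M.r ζ.1 ζ.2) (γ * M.maxAction (M.qNet σ θ) x')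
  unfold tdError
  linarith

section step

variable {σ : ℝ → ℝ} {K V b γ η : ℝ} {N : ℕ} [NeZero N] {θ : Fin N → Param (dx + da)}

/-- `N` units, each changing by `O(η / √N)`, are summed with prefactor `1 / √N`: the powers of `N`
cancel and the output moves by `O(η)`. -/
theorem abs_qNet_qStep_sub_le (hσ : ActivationBound σ K) (hV : ∀ ζ, ‖M.vec ζ‖ ≤ V) (hη : 0 ≤ η)
    (hb : ∀ i, |(θ i).1| ≤ b) (ζ ζ' : M.Pair) (x' : M.states) :
    |M.qNet σ (M.qStep σ γ η θ ζ' x') ζ - M.qNet σ θ ζ| ≤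
      η * |M.tdError σ γ θ ζ' x'| * (K ^ 2 + b ^ 2 * K ^ 2 * V ^ 2) := by
  have hN : (0 : ℝ) < N := Nat.cast_pos.2 (NeZero.pos N)
  have hs : 0 < √(N : ℝ) := Real.sqrt_pos.2 hN
  rw [qNet_qStep_sub, abs_mul, abs_of_nonneg (inv_nonneg.2 hs.le)]
  have h1 : |∑ i, ((M.qStep σ γ η θ ζ' x' i).1 *
        σ (inner ℝ (M.qStep σ γ η θ ζ' x' i).2 (M.vec ζ)) -
          (θ i).1 * σ (inner ℝ (θ i).2 (M.vec ζ)))| ≤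
      N * (|η / √(N : ℝ) * M.tdError σ γ θ ζ' x'| * (K ^ 2 + b ^ 2 * K ^ 2 * V ^ 2)) := by
    refine (Finset.abs_sum_le_sum_abs _ _).trans ((Finset.sum_le_sum fun i _ =>
      abs_unit_sub_le hσ (hV ζ) (hV ζ') (hb i)).trans ?_)
    rw [Finset.sum_const, Finset.card_univ, Fintype.card_fin, nsmul_eq_mul]
  refine (mul_le_mul_of_nonneg_left h1 (inv_nonneg.2 hs.le)).trans (le_of_eq ?_)
  rw [abs_mul, abs_div, abs_of_nonneg hη, abs_of_nonneg hs.le]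
  have : (N : ℝ) = √(N : ℝ) * √(N : ℝ) := (Real.mul_self_sqrt hN.le).symm
  conv_lhs => enter [2, 1]; rw [this]
  field_simp

/-- The quadratic remainders of the `N` units are each `O(η² / N)`, so only the prefactor `1 / √N`
survives in their total. -/
theorem abs_qNet_qStep_sub_sub_le (hσ : ActivationBound σ K) (hV : ∀ ζ, ‖M.vec ζ‖ ≤ V)
    (hb : ∀ i, |(θ i).1| ≤ b) (ζ ζ' : M.Pair) (x' : M.states) :
    |M.qNet σ (M.qStep σ γ η θ ζ' x') ζ - M.qNet σ θ ζ -
      M.tdError σ γ θ ζ' x' * M.empiricalKernel σ η θ ζ ζ'| ≤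
      (√(N : ℝ))⁻¹ * (η * M.tdError σ γ θ ζ' x') ^ 2 *
        (b * K ^ 3 * V ^ 2 + b ^ 3 * K ^ 3 * V ^ 4) := by
  have hN : (0 : ℝ) < N := Nat.cast_pos.2 (NeZero.pos N)
  have hs : 0 < √(N : ℝ) := Real.sqrt_pos.2 hN
  have hNs : (N : ℝ) = √(N : ℝ) * √(N : ℝ) := (Real.mul_self_sqrt hN.le).symm
  set δ := M.tdError σ γ θ ζ' x' with hδ
  have h0 : δ * M.empiricalKernel σ η θ ζ ζ' = (√(N : ℝ))⁻¹ * ∑ i, η / √(N : ℝ) * δ *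
      unitKernel σ (θ i) (M.vec ζ) (M.vec ζ') := by
    rw [empiricalKernel, ← Finset.mul_sum]
    conv_lhs => enter [2, 2, 1]; rw [hNs]
    field_simp
  rw [qNet_qStep_sub, h0, ← mul_sub, ← Finset.sum_sub_distrib, abs_mul,
    abs_of_nonneg (inv_nonneg.2 hs.le), mul_assoc]
  refine mul_le_mul_of_nonneg_left ?_ (inv_nonneg.2 hs.le)
  have h1 := (Finset.abs_sum_le_sum_abs (fun i => (M.qStep σ γ η θ ζ' x' i).1 *
        σ (inner ℝ (M.qStep σ γ η θ ζ' x' i).2 (M.vec ζ)) -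
          (θ i).1 * σ (inner ℝ (θ i).2 (M.vec ζ)) - η / √(N : ℝ) * δ *
      unitKernel σ (θ i) (M.vec ζ) (M.vec ζ')) Finset.univ).trans ((Finset.sum_le_sum fun i _ =>
      abs_unit_sub_sub_le hσ (hV ζ) (hV ζ') (hb i)))
  refine h1.trans (le_of_eq ?_)
  rw [Finset.sum_const, Finset.card_univ, Fintype.card_fin, nsmul_eq_mul]
  rw [← hδ]
  conv_lhs => enter [1]; rw [hNs]
  field_simp

theorem abs_empiricalKernel_sub_le (hσ : ActivationBound σ K) (hV : ∀ ζ, ‖M.vec ζ‖ ≤ V)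
    {θ' : Fin N → Param (dx + da)} {α ε : ℝ} (hα : 0 ≤ α) (hb : ∀ i, |(θ i).1| ≤ b)
    (hb' : ∀ i, |(θ' i).1| ≤ b) (h1 : ∀ i, |(θ i).1 - (θ' i).1| ≤ ε)
    (h2 : ∀ i, ‖(θ i).2 - (θ' i).2‖ ≤ ε) (ζ ζ' : M.Pair) :
    |M.empiricalKernel σ α θ ζ ζ' - M.empiricalKernel σ α θ' ζ ζ'| ≤
      α * ((2 * K ^ 2 * V + (2 * b * K ^ 2 + 2 * b ^ 2 * K ^ 2 * V) * V ^ 2) * ε) := by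
  have hN : (0 : ℝ) < N := Nat.cast_pos.2 (NeZero.pos N)
  rw [empiricalKernel, empiricalKernel, ← mul_sub, ← mul_sub, ← Finset.sum_sub_distrib, abs_mul,
    abs_mul, abs_of_nonneg hα, abs_of_nonneg (inv_nonneg.2 hN.le)]
  refine mul_le_mul_of_nonneg_left ?_ hα
  rw [inv_mul_le_iff₀ hN]
  refine (Finset.abs_sum_le_sum_abs _ _).trans ((Finset.sum_le_sum fun i _ =>
      abs_unitKernel_sub_le hσ (hV ζ) (hV ζ') (hb i) (hb' i) (h1 i) (h2 i)).trans ?_)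
  rw [Finset.sum_const, Finset.card_univ, Fintype.card_fin, nsmul_eq_mul]

end step

/-! ### A priori bounds along the training -/

/-- The size of the data of the training problem. -/
structure DataBound (σ : ℝ → ℝ) (K V ρ : ℝ) : Prop where
  activation : ActivationBound σ K
  nonneg_V : 0 ≤ V
  norm_vec_le : ∀ ζ, ‖M.vec ζ‖ ≤ V
  nonneg_reward : 0 ≤ ρ
  abs_r_le : ∀ x a, |M.r x a| ≤ ρ

theorem exists_dataBound {σ : ℝ → ℝ} (hσ : IsC2b σ) : ∃ K V ρ, M.DataBound σ K V ρ := by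
  obtain ⟨K, hK⟩ := hσ.exists_activationBound
  refine ⟨K, ∑ ζ, ‖M.vec ζ‖, ∑ x, ∑ a, |M.r x a|, hK,
    Finset.sum_nonneg fun _ _ => norm_nonneg _, fun ζ =>
      Finset.single_le_sum (f := fun ζ => ‖M.vec ζ‖) (fun _ _ => norm_nonneg _)
        (Finset.mem_univ ζ),
    Finset.sum_nonneg fun _ _ => Finset.sum_nonneg fun _ _ => abs_nonneg _, fun x a => ?_⟩
  refine le_trans ?_ (Finset.single_le_sum (f := fun x => ∑ a, |M.r x a|)
    (fun _ _ => Finset.sum_nonneg fun _ _ => abs_nonneg _) (Finset.mem_univ x))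
  exact Finset.single_le_sum (f := fun a => |M.r x a|) (fun _ _ => abs_nonneg _)
    (Finset.mem_univ a)

/-- Over `N T` steps the network output stays bounded and the parameters move by
`O(N ^ (-1/2))`. -/
theorem exists_trajectory_bound {σ : ℝ → ℝ} {K V ρ : ℝ} (hd : M.DataBound σ K V ρ) {γ : ℝ}
    (hγ0 : 0 ≤ γ) (hγ1 : γ ≤ 1) {α : ℝ} (hα : 0 ≤ α) {T : ℝ} (hT : 0 ≤ T) {B : ℝ} (hB : 0 ≤ B)
    {R : ℝ} (hR : 0 ≤ R) :
    ∃ C M₀ : ℝ, 0 ≤ C ∧ 0 ≤ M₀ ∧ ∃ N₀ : ℕ, ∀ N ≥ N₀, ∀ [NeZero N],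
      ∀ (θ₀ : Fin N → Param (dx + da)) (x : ℕ → M.states) (a : ℕ → M.actions),
        (∀ i, |(θ₀ i).1| ≤ B) → ‖M.qNet σ θ₀‖ ≤ R → ∀ k : ℕ, (k : ℝ) ≤ N * T →
          ‖M.qNet σ (M.trainedParams σ γ (α / N) θ₀ x a k)‖ ≤ M₀ ∧
          ∀ i, |(M.trainedParams σ γ (α / N) θ₀ x a k i).1| ≤ B + 1 ∧
            |(M.trainedParams σ γ (α / N) θ₀ x a k i).1 - (θ₀ i).1| ≤ C * (√(N : ℝ))⁻¹ ∧
            ‖(M.trainedParams σ γ (α / N) θ₀ x a k i).2 - (θ₀ i).2‖ ≤ C * (√(N : ℝ))⁻¹ := by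
  have hσ := hd.activation
  have hK := hσ.nonneg
  have hV := hd.nonneg_V
  have hρ := hd.nonneg_reward
  -- The slack `1` allows for the displacement of `c`. `G` is chosen so that `|δ| ≤ G (1 + ‖Q‖)`,
  -- `L` is the growth rate of `1 + ‖Q‖`, and `U`, up to the factor `N^(-3/2)`, bounds the
  -- displacement of both parameters in one step.
  set b := B + 1 with hb
  set G := ρ + 2 with hG
  set L := α * G * (K ^ 2 + b ^ 2 * K ^ 2 * V ^ 2) with hL
  set M₀ := (1 + R) * Real.exp (L * T) with hM₀
  set U := α * (G * M₀) * (K + b * K * V) with hU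
  have hb0 : 0 ≤ b := by positivity
  have hG0 : 0 ≤ G := by positivity
  have hL0 : 0 ≤ L := by positivity
  have hM0 : 0 ≤ M₀ := by positivity
  have hU0 : 0 ≤ U := by positivity
  -- From this `N₀` on, the total displacement `T U / √N` is at most `1`, so `|c| ≤ B + 1` persists.
  refine ⟨T * U, M₀, by positivity, hM0, ⌈(T * U) ^ 2⌉₊, fun N hN hNz θ₀ x a hθB hqR => ?_⟩
  have hN0 : (0 : ℝ) < N := Nat.cast_pos.2 (NeZero.pos N)
  have hs : 0 < √(N : ℝ) := Real.sqrt_pos.2 hN0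
  have hNi : 0 ≤ (N : ℝ)⁻¹ := inv_nonneg.2 hN0.le
  have hsi : 0 ≤ (√(N : ℝ))⁻¹ := inv_nonneg.2 hs.le
  have hsmall : T * U * (√(N : ℝ))⁻¹ ≤ 1 := by
    rw [← div_eq_mul_inv, div_le_one hs]
    exact Real.le_sqrt_of_sq_le (Nat.ceil_le.1 hN)
  have hkT : ∀ k : ℕ, (k : ℝ) ≤ N * T → (k : ℝ) * (N : ℝ)⁻¹ ≤ T := fun k hk => by
    rw [← div_eq_mul_inv, div_le_iff₀ hN0]
    linarith
  have hmove : ∀ k : ℕ, (k : ℝ) ≤ N * T →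
      k * ((N : ℝ)⁻¹ * (√(N : ℝ))⁻¹ * U) ≤ T * U * (√(N : ℝ))⁻¹ := fun k hk => by
    calc k * ((N : ℝ)⁻¹ * (√(N : ℝ))⁻¹ * U) = (k * (N : ℝ)⁻¹) * (U * (√(N : ℝ))⁻¹) := by ring
      _ ≤ T * (U * (√(N : ℝ))⁻¹) := by gcongr; exact hkT k hk
      _ = _ := by ring
  have hpow : ∀ k : ℕ, (k : ℝ) ≤ N * T → (1 + R) * (1 + L * (N : ℝ)⁻¹) ^ k ≤ M₀ := by
    intro k hk
    refine mul_le_mul_of_nonneg_left ?_ (by positivity)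
    calc (1 + L * (N : ℝ)⁻¹) ^ k ≤ Real.exp (L * (N : ℝ)⁻¹) ^ k := by
          gcongr
          rw [add_comm]
          exact Real.add_one_le_exp _
      _ = Real.exp (L * (k * (N : ℝ)⁻¹)) := by rw [← Real.exp_nat_mul]; ring_nf
      _ ≤ Real.exp (L * T) := by gcongr; exact hkT k hk
  -- A joint induction: the output bound needs `|c| ≤ b`, and the displacement bound needs the
  -- output bound. Following `1 + ‖Q‖` makes the recursion purely multiplicative.
  have key : ∀ k : ℕ, (k : ℝ) ≤ N * T →
      1 + ‖M.qNet σ (M.trainedParams σ γ (α / N) θ₀ x a k)‖ ≤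
        (1 + R) * (1 + L * (N : ℝ)⁻¹) ^ k ∧
      ∀ i, |(M.trainedParams σ γ (α / N) θ₀ x a k i).1 - (θ₀ i).1| ≤
          k * ((N : ℝ)⁻¹ * (√(N : ℝ))⁻¹ * U) ∧
        ‖(M.trainedParams σ γ (α / N) θ₀ x a k i).2 - (θ₀ i).2‖ ≤
          k * ((N : ℝ)⁻¹ * (√(N : ℝ))⁻¹ * U) := by
    intro k
    induction k with
    | zero =>
      intro _
      refine ⟨?_, fun i => ?_⟩
      · rw [pow_zero, mul_one]
        exact add_le_add_right hqR 1
      · simp [trainedParams]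
    | succ k ih =>
      intro hk1
      have hk : (k : ℝ) ≤ N * T := le_trans (by push_cast; linarith) hk1
      obtain ⟨ih1, ih2⟩ := ih hk
      set θ := M.trainedParams σ γ (α / N) θ₀ x a k with hθ
      have hstep : M.trainedParams σ γ (α / N) θ₀ x a (k + 1) =
        M.qStep σ γ (α / N) θ (x k, a k) (x (k + 1)) := rfl
      rw [hstep]
      have hcb : ∀ i, |(θ i).1| ≤ b := fun i => by
        have h1 := (ih2 i).1.trans ((hmove k hk).trans hsmall)
        have h2 := abs_sub_abs_le_abs_sub (θ i).1 (θ₀ i).1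
        have h3 := hθB i
        linarith
      set δ := M.tdError σ γ θ (x k, a k) (x (k + 1)) with hδ
      have hδ1 : |δ| ≤ G * (1 + ‖M.qNet σ θ‖) := by
        refine (M.abs_tdError_le hd.abs_r_le hγ0 hγ1 _ _).trans ?_
        have := mul_nonneg hρ (norm_nonneg (M.qNet σ θ))
        rw [hG]
        linarith
      have hδ2 : |δ| ≤ G * M₀ := hδ1.trans
        (mul_le_mul_of_nonneg_left (ih1.trans (hpow k hk)) hG0)
      have hη : 0 ≤ α / N := by positivity
      have he : |α / N / √(N : ℝ) * δ| ≤ (N : ℝ)⁻¹ * (√(N : ℝ))⁻¹ * (α * (G * M₀)) := by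
        rw [abs_mul, abs_of_nonneg (by positivity : 0 ≤ α / N / √(N : ℝ))]
        calc α / N / √(N : ℝ) * |δ| ≤ α / N / √(N : ℝ) * (G * M₀) := by gcongr
          _ = _ := by rw [div_eq_mul_inv, div_eq_mul_inv]; ring
      constructor
      · have h1 : ‖M.qNet σ (M.qStep σ γ (α / N) θ (x k, a k) (x (k + 1))) - M.qNet σ θ‖ ≤
            L * (N : ℝ)⁻¹ * (1 + ‖M.qNet σ θ‖) := by
          refine (pi_norm_le_iff_of_nonneg (by positivity)).2 fun ζ => ?_
          refine (M.abs_qNet_qStep_sub_le hσ hd.norm_vec_le hη hcb ζ _ _).trans ?_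
          calc α / N * |δ| * (K ^ 2 + b ^ 2 * K ^ 2 * V ^ 2)
              ≤ α / N * (G * (1 + ‖M.qNet σ θ‖)) * (K ^ 2 + b ^ 2 * K ^ 2 * V ^ 2) := by gcongr
            _ = _ := by rw [hL, div_eq_mul_inv]; ring
        have h2 := norm_le_norm_add_norm_sub' (M.qNet σ (M.qStep σ γ (α / N) θ (x k, a k)
          (x (k + 1)))) (M.qNet σ θ)
        calc 1 + ‖M.qNet σ (M.qStep σ γ (α / N) θ (x k, a k) (x (k + 1)))‖
            ≤ (1 + ‖M.qNet σ θ‖) * (1 + L * (N : ℝ)⁻¹) := by linarith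
          _ ≤ (1 + R) * (1 + L * (N : ℝ)⁻¹) ^ k * (1 + L * (N : ℝ)⁻¹) := by gcongr
          _ = _ := by rw [pow_succ]; ring
      · intro i
        rw [qStep_eq_unitStep, ← hδ]
        have h1 := abs_unitStep_fst_sub_le (θ := θ i) (v := M.vec (x k, a k))
          (e := α / N / √(N : ℝ) * δ) hσ
        have h2 := norm_unitStep_snd_sub_le (e := α / N / √(N : ℝ) * δ) hσ
          (hd.norm_vec_le (x k, a k)) (hcb i)
        have h3 : |α / N / √(N : ℝ) * δ| * K ≤ (N : ℝ)⁻¹ * (√(N : ℝ))⁻¹ * U := by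
          refine (mul_le_mul_of_nonneg_right he hK).trans ?_
          rw [hU, mul_assoc]
          refine mul_le_mul_of_nonneg_left ?_ (by positivity)
          refine mul_le_mul_of_nonneg_left ?_ (by positivity)
          have : 0 ≤ b * K * V := by positivity
          linarith
        have h4 : |α / N / √(N : ℝ) * δ| * (b * K * V) ≤ (N : ℝ)⁻¹ * (√(N : ℝ))⁻¹ * U := by
          refine (mul_le_mul_of_nonneg_right he (by positivity)).trans ?_
          rw [hU, mul_assoc]
          refine mul_le_mul_of_nonneg_left ?_ (by positivity)
          refine mul_le_mul_of_nonneg_left ?_ (by positivity)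
          linarith
        push_cast
        rw [add_mul, one_mul]
        refine ⟨?_, ?_⟩
        · have := abs_sub_le (unitStep σ (α / N / √(N : ℝ) * δ) (θ i) (M.vec (x k, a k))).1
            (θ i).1 (θ₀ i).1
          linarith [(ih2 i).1]
        · have := norm_sub_le_norm_sub_add_norm_sub
            (unitStep σ (α / N / √(N : ℝ) * δ) (θ i) (M.vec (x k, a k))).2 (θ i).2 (θ₀ i).2
          linarith [(ih2 i).2]
  intro k hk
  obtain ⟨h1, h2⟩ := key k hk
  refine ⟨by linarith [hpow k hk], fun i => ?_⟩
  have h3 := (h2 i).1.trans (hmove k hk)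
  have h4 := (h2 i).2.trans (hmove k hk)
  refine ⟨?_, h3, h4⟩
  have h5 := abs_sub_abs_le_abs_sub (M.trainedParams σ γ (α / N) θ₀ x a k i).1 (θ₀ i).1
  have h6 := hθB i
  linarith

/-! ### The limiting recursion and the comparison with the ODE -/

/-- The increment of the limiting recursion along a transition `ξ = ((x, a), z)`. -/
noncomputable def increment (A : M.Pair → M.Pair → ℝ) (γ : ℝ) (ξ : M.Pair × M.states)
    (h : M.Pair → ℝ) (ζ : M.Pair) : ℝ :=
  A ζ ξ.1 * (M.r ξ.1.1 ξ.1.2 + γ * M.maxAction h ξ.2 - h ξ.1)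

theorem norm_increment_sub_le {A : M.Pair → M.Pair → ℝ} {Ā : ℝ} (hĀ : 0 ≤ Ā)
    (hA : ∀ ζ ζ', |A ζ ζ'| ≤ Ā) {γ : ℝ} (hγ0 : 0 ≤ γ) (hγ1 : γ ≤ 1) (ξ : M.Pair × M.states)
    (h h' : M.Pair → ℝ) : ‖M.increment A γ ξ h - M.increment A γ ξ h'‖ ≤ 2 * Ā * ‖h - h'‖ := by
  refine (pi_norm_le_iff_of_nonneg (by positivity)).2 fun ζ => ?_
  have h1 : (M.increment A γ ξ h - M.increment A γ ξ h') ζ = A ζ ξ.1 *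
      (γ * (M.maxAction h ξ.2 - M.maxAction h' ξ.2) - (h - h') ξ.1) := by
    simp only [increment, Pi.sub_apply]; ring
  rw [h1, norm_mul, mul_comm 2 Ā, mul_assoc]
  refine mul_le_mul (hA _ _) ?_ (norm_nonneg _) hĀ
  have h2 := M.abs_maxAction_sub_le h h' ξ.2
  have h3 := norm_le_pi_norm (h - h') ξ.1
  have h4 : ‖γ * (M.maxAction h ξ.2 - M.maxAction h' ξ.2)‖ ≤ ‖h - h'‖ := by
    rw [norm_mul, Real.norm_of_nonneg hγ0]
    exact (mul_le_of_le_one_left (norm_nonneg _) hγ1).trans h2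
  refine (_root_.norm_sub_le _ _).trans ?_
  linarith

theorem norm_increment_le {A : M.Pair → M.Pair → ℝ} {Ā : ℝ} (hĀ : 0 ≤ Ā)
    (hA : ∀ ζ ζ', |A ζ ζ'| ≤ Ā) {γ : ℝ} (hγ0 : 0 ≤ γ) (hγ1 : γ ≤ 1) {ρ : ℝ} (hρ : 0 ≤ ρ)
    (hr : ∀ x a, |M.r x a| ≤ ρ) (ξ : M.Pair × M.states) (h : M.Pair → ℝ) :
    ‖M.increment A γ ξ h‖ ≤ Ā * (ρ + 2 * ‖h‖) := by
  refine (pi_norm_le_iff_of_nonneg (by positivity)).2 fun ζ => ?_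
  rw [increment, norm_mul]
  refine mul_le_mul (hA _ _) ?_ (norm_nonneg _) hĀ
  have h2 := M.abs_maxAction_le h ξ.2
  have h3 := norm_le_pi_norm h ξ.1
  have h4 : ‖γ * M.maxAction h ξ.2‖ ≤ ‖h‖ := by
    rw [norm_mul, Real.norm_of_nonneg hγ0]
    exact (mul_le_of_le_one_left (norm_nonneg _) hγ1).trans h2
  have h5 : ‖M.r ξ.1.1 ξ.1.2‖ ≤ ρ := hr _ _
  have h6 := norm_add_le (M.r ξ.1.1 ξ.1.2) (γ * M.maxAction h ξ.2)
  refine (_root_.norm_sub_le _ _).trans ?_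
  linarith

/-- The limiting frequency of a transition. -/
noncomputable def transitionFreq (ϖ : M.states → ℝ) (ξ : M.Pair × M.states) : ℝ :=
  ϖ ξ.1.1 / M.actions.card * M.p ξ.2 ξ.1.1 ξ.1.2

/-- The target involves the maximum at the next state, so the averaged driver is the whole
transition `((x, a), z)`; `∑ z, p = 1` brings the reward and `h` under the sum over `z`. -/
theorem drift_eq_sum_increment (σ : ℝ → ℝ) (γ α : ℝ) (μ₀ : Measure (Param (dx + da)))
    (ϖ : M.states → ℝ) (h : M.Pair → ℝ) :
    M.drift σ γ α μ₀ ϖ h =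
      ∑ ξ, M.transitionFreq ϖ ξ • M.increment (M.kernelA σ α μ₀) γ ξ h := by
  ext ζ
  rw [drift, Finset.sum_apply]
  refine Eq.trans ?_ (Fintype.sum_prod_type _).symm
  refine Finset.sum_congr rfl fun ζ' _ => ?_
  have h1 : M.bellmanResidual γ h ζ' =
      ∑ z, M.p z ζ'.1 ζ'.2 * (M.r ζ'.1 ζ'.2 + γ * M.maxAction h z - h ζ') := by
    have h2 : ∀ z, M.p z ζ'.1 ζ'.2 * (M.r ζ'.1 ζ'.2 + γ * M.maxAction h z - h ζ') =
      (M.r ζ'.1 ζ'.2 - h ζ') * M.p z ζ'.1 ζ'.2 + γ * (M.maxAction h z * M.p z ζ'.1 ζ'.2) :=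
      fun z => by ring
    simp only [h2]
    rw [Finset.sum_add_distrib, ← Finset.mul_sum, ← Finset.mul_sum, M.p_sum, bellmanResidual]
    ring
  rw [h1, Finset.mul_sum]
  refine Finset.sum_congr rfl fun z _ => ?_
  simp only [Pi.smul_apply, smul_eq_mul, transitionFreq, increment]
  ring

theorem sum_transitionFreq {ϖ : M.states → ℝ} (hϖ : ∑ s, ϖ s = 1) :
    ∑ ξ, M.transitionFreq ϖ ξ = 1 := by
  have hK : (M.actions.card : ℝ) ≠ 0 := (Nat.cast_pos.2 M.actions_nonempty.card_pos).ne'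
  simp only [Fintype.sum_prod_type, transitionFreq, ← Finset.mul_sum, M.p_sum, mul_one,
    Finset.sum_const, Finset.card_univ, Fintype.card_coe, nsmul_eq_mul]
  rw [← Finset.sum_div, mul_div_cancel₀ _ hK, hϖ]

theorem transitionFreq_nonneg {ϖ : M.states → ℝ} (hϖ : ∀ s, 0 < ϖ s) (ξ : M.Pair × M.states) :
    0 ≤ M.transitionFreq ϖ ξ :=
  mul_nonneg (div_nonneg (hϖ _).le (Nat.cast_nonneg _)) (M.p_nonneg _ _ _)

theorem norm_drift_le {σ : ℝ → ℝ} {γ α : ℝ} {μ₀ : Measure (Param (dx + da))}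
    {ϖ : M.states → ℝ} (hϖ : M.IsLimitingDistribution ϖ) {Ā : ℝ} (hĀ : 0 ≤ Ā)
    (hA : ∀ ζ ζ', |M.kernelA σ α μ₀ ζ ζ'| ≤ Ā) (hγ0 : 0 ≤ γ) (hγ1 : γ ≤ 1) {ρ : ℝ} (hρ : 0 ≤ ρ)
    (hr : ∀ x a, |M.r x a| ≤ ρ) (h : M.Pair → ℝ) :
    ‖M.drift σ γ α μ₀ ϖ h‖ ≤ Ā * (ρ + 2 * ‖h‖) := by
  rw [drift_eq_sum_increment]
  calc ‖∑ ξ, M.transitionFreq ϖ ξ • M.increment (M.kernelA σ α μ₀) γ ξ h‖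
      ≤ ∑ ξ, M.transitionFreq ϖ ξ * (Ā * (ρ + 2 * ‖h‖)) := by
        refine norm_sum_le_of_le _ fun ξ _ => ?_
        rw [norm_smul, Real.norm_of_nonneg (M.transitionFreq_nonneg hϖ.pos ξ)]
        exact mul_le_mul_of_nonneg_left (M.norm_increment_le hĀ hA hγ0 hγ1 hρ hr ξ h)
          (M.transitionFreq_nonneg hϖ.pos ξ)
    _ = Ā * (ρ + 2 * ‖h‖) := by
        rw [← Finset.sum_mul, M.sum_transitionFreq hϖ.sum_eq_one, one_mul]

theorem norm_drift_sub_le {σ : ℝ → ℝ} {γ α : ℝ} {μ₀ : Measure (Param (dx + da))}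
    {ϖ : M.states → ℝ} (hϖ : M.IsLimitingDistribution ϖ) {Ā : ℝ} (hĀ : 0 ≤ Ā)
    (hA : ∀ ζ ζ', |M.kernelA σ α μ₀ ζ ζ'| ≤ Ā) (hγ0 : 0 ≤ γ) (hγ1 : γ ≤ 1) (h h' : M.Pair → ℝ) :
    ‖M.drift σ γ α μ₀ ϖ h - M.drift σ γ α μ₀ ϖ h'‖ ≤ 2 * Ā * ‖h - h'‖ := by
  rw [drift_eq_sum_increment, drift_eq_sum_increment, ← Finset.sum_sub_distrib]
  calc ‖∑ ξ, (M.transitionFreq ϖ ξ • M.increment (M.kernelA σ α μ₀) γ ξ h -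
        M.transitionFreq ϖ ξ • M.increment (M.kernelA σ α μ₀) γ ξ h')‖
      ≤ ∑ ξ, M.transitionFreq ϖ ξ * (2 * Ā * ‖h - h'‖) := by
        refine norm_sum_le_of_le _ fun ξ _ => ?_
        rw [← smul_sub, norm_smul, Real.norm_of_nonneg (M.transitionFreq_nonneg hϖ.pos ξ)]
        exact mul_le_mul_of_nonneg_left (M.norm_increment_sub_le hĀ hA hγ0 hγ1 ξ h h')
          (M.transitionFreq_nonneg hϖ.pos ξ)
    _ = 2 * Ā * ‖h - h'‖ := by
        rw [← Finset.sum_mul, M.sum_transitionFreq hϖ.sum_eq_one, one_mul]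

/-- Two errors per step: the second-order remainder, and the replacement of the current kernel by
the fixed `A`. The factor `N⁻¹` is kept outside, in the form required by the averaging lemma. -/
theorem norm_qNet_qStep_sub_sub_le {σ : ℝ → ℝ} {K V ρ : ℝ} (hd : M.DataBound σ K V ρ) {γ : ℝ}
    (hγ0 : 0 ≤ γ) (hγ1 : γ ≤ 1) {α : ℝ} {b M₀ : ℝ} {N : ℕ} [NeZero N]
    {θ : Fin N → Param (dx + da)} (hb : ∀ i, |(θ i).1| ≤ b) (hM : ‖M.qNet σ θ‖ ≤ M₀)
    {A : M.Pair → M.Pair → ℝ} {e : ℝ} (hA : ∀ ζ ζ', |M.empiricalKernel σ α θ ζ ζ' - A ζ ζ'| ≤ e)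
    (ζ' : M.Pair) (x' : M.states) :
    ‖M.qNet σ (M.qStep σ γ (α / N) θ ζ' x') - M.qNet σ θ -
        (N : ℝ)⁻¹ • M.increment A γ (ζ', x') (M.qNet σ θ)‖ ≤
      ((√(N : ℝ))⁻¹ * ((α * (ρ + 2 * M₀)) ^ 2 * (b * K ^ 3 * V ^ 2 + b ^ 3 * K ^ 3 * V ^ 4)) +
        (ρ + 2 * M₀) * e) * (N : ℝ)⁻¹ := by
  have hK := hd.activation.nonneg
  have hV := hd.nonneg_V
  have hρ := hd.nonneg_reward
  have hb0 : 0 ≤ b := (abs_nonneg _).trans (hb 0)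
  have he0 : 0 ≤ e := (abs_nonneg _).trans (hA ζ' ζ')
  have hM0 : 0 ≤ M₀ := (norm_nonneg _).trans hM
  have hN1 : (1 : ℝ) ≤ N := by exact_mod_cast NeZero.pos N
  have hN0 : (0 : ℝ) < N := one_pos.trans_le hN1
  have hNi : 0 < (N : ℝ)⁻¹ := inv_pos.2 hN0
  have hNi1 : (N : ℝ)⁻¹ ≤ 1 := inv_le_one_of_one_le₀ hN1
  have hsi : 0 ≤ (√(N : ℝ))⁻¹ := inv_nonneg.2 (Real.sqrt_nonneg _)
  set C := b * K ^ 3 * V ^ 2 + b ^ 3 * K ^ 3 * V ^ 4 with hC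
  have hC0 : 0 ≤ C := by positivity
  refine (pi_norm_le_iff_of_nonneg (by positivity)).2 fun ζ => ?_
  set δ := M.tdError σ γ θ ζ' x' with hδ
  have hδ1 : |δ| ≤ ρ + 2 * M₀ :=
    (M.abs_tdError_le hd.abs_r_le hγ0 hγ1 _ _).trans (by linarith)
  have h1 := M.abs_qNet_qStep_sub_sub_le (η := α / N) (γ := γ) hd.activation hd.norm_vec_le hb ζ ζ' x'
  rw [← hδ, ← hC] at h1
  have h2 : (M.qNet σ (M.qStep σ γ (α / N) θ ζ' x') - M.qNet σ θ -
        (N : ℝ)⁻¹ • M.increment A γ (ζ', x') (M.qNet σ θ)) ζ =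
      (M.qNet σ (M.qStep σ γ (α / N) θ ζ' x') ζ - M.qNet σ θ ζ -
        δ * M.empiricalKernel σ (α / N) θ ζ ζ') +
      (N : ℝ)⁻¹ * (δ * (M.empiricalKernel σ α θ ζ ζ' - A ζ ζ')) := by
    simp only [Pi.sub_apply, Pi.smul_apply, smul_eq_mul, increment, empiricalKernel, hδ, tdError]
    rw [div_eq_mul_inv]
    ring
  rw [h2, add_mul]
  refine (_root_.norm_add_le _ _).trans (add_le_add (h1.trans ?_) ?_)
  · have h3 : δ ^ 2 ≤ (ρ + 2 * M₀) ^ 2 := sq_le_sq' (by linarith [neg_abs_le δ]) (by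
      linarith [le_abs_self δ])
    calc (√(N : ℝ))⁻¹ * (α / N * δ) ^ 2 * C
        = (√(N : ℝ))⁻¹ * (α ^ 2 * δ ^ 2 * C) * ((N : ℝ)⁻¹ * (N : ℝ)⁻¹) := by
          rw [div_eq_mul_inv]; ring
      _ ≤ (√(N : ℝ))⁻¹ * (α ^ 2 * (ρ + 2 * M₀) ^ 2 * C) * (1 * (N : ℝ)⁻¹) := by gcongr
      _ = _ := by ring
  · rw [norm_mul, norm_mul, Real.norm_of_nonneg hNi.le, mul_comm]
    exact mul_le_mul_of_nonneg_right
      (mul_le_mul hδ1 (hA ζ ζ') (norm_nonneg _) (by positivity)) hNi.le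

open scoped Classical in
/-- Along a fixed realization, for a large network, the output follows the limit equation and the
parameters stay close to their initial values. -/
theorem eventually_norm_qNet_sub_le {σ : ℝ → ℝ} (hσ : IsC2b σ) {γ : ℝ} (hγ0 : 0 ≤ γ)
    (hγ1 : γ ≤ 1) {α : ℝ} (hα : 0 ≤ α) {T : ℝ} (hT : 0 ≤ T) {μ₀ : Measure (Param (dx + da))}
    {ϖ : M.states → ℝ} (hϖ : M.IsLimitingDistribution ϖ) {θ : ℕ → Param (dx + da)} {B : ℝ}
    (hB : ∀ i, |(θ i).1| ≤ B) {x : ℕ → M.states} {a : ℕ → M.actions}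
    (hker : ∀ ζ ζ', Tendsto (fun N : ℕ => M.empiricalKernel σ α (fun i : Fin N => θ i) ζ ζ') atTop
      (𝓝 (M.kernelA σ α μ₀ ζ ζ')))
    (hfreq : ∀ ξ, Tendsto (fun n : ℕ => (n : ℝ)⁻¹ * ∑ k ∈ Finset.range n,
      ((if ((x k, a k), x (k + 1)) = ξ then (1 : ℝ) else 0) - M.transitionFreq ϖ ξ)) atTop (𝓝 0))
    {R : ℝ} (hR : 0 ≤ R) {ε : ℝ} (hε : 0 < ε) :
    ∀ᶠ N : ℕ in atTop, ∀ [NeZero N], ‖M.qNet σ (fun i : Fin N => θ i)‖ ≤ R →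
      ∀ φ, IsODESolution (M.drift σ γ α μ₀ ϖ) T (M.qNet σ (fun i : Fin N => θ i)) φ →
      ∀ t ∈ Set.Icc 0 T,
        ‖M.qNet σ (M.trainedParams σ γ (α / N) (fun i : Fin N => θ i) x a ⌊N * t⌋₊) - φ t‖ ≤ ε ∧
        ∀ i, |(M.trainedParams σ γ (α / N) (fun i : Fin N => θ i) x a ⌊N * t⌋₊ i).1 - (θ i).1| ≤ ε ∧
          ‖(M.trainedParams σ γ (α / N) (fun i : Fin N => θ i) x a ⌊N * t⌋₊ i).2 - (θ i).2‖ ≤ ε := by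
  obtain ⟨K, V, ρ, hd⟩ := M.exists_dataBound hσ
  have hK := hd.activation.nonneg
  have hV := hd.nonneg_V
  have hρ := hd.nonneg_reward
  have hB0 : 0 ≤ B := (abs_nonneg _).trans (hB 0)
  obtain ⟨C, M₀, hC, hM0, N₀, hN₀⟩ := M.exists_trajectory_bound hd hγ0 hγ1 hα hT hB0 hR
  set A := M.kernelA σ α μ₀ with hAdef
  obtain ⟨Ā, hĀ, hA⟩ : ∃ Ā : ℝ, 0 ≤ Ā ∧ ∀ ζ ζ', |A ζ ζ'| ≤ Ā :=
    ⟨‖A‖, norm_nonneg _, fun ζ ζ' => (norm_le_pi_norm (A ζ) ζ').trans (norm_le_pi_norm A ζ)⟩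
  set L := 2 * Ā with hL
  have hL0 : 0 ≤ L := by positivity
  -- `R'` bounds every solution started in the ball of radius `R`, and `M₀` bounds the network
  -- output; `D` is then a common bound on the speeds of both.
  set R' := gronwallBound R L (Ā * ρ) T with hR'
  set D := Ā * (ρ + 2 * max R' M₀) with hD
  have hmax0 : 0 ≤ max R' M₀ := hM0.trans (le_max_right _ _)
  have hD0 : 0 ≤ D := by positivity
  set c : ℝ := ((Fintype.card (M.Pair × M.states) : ℕ) : ℝ) with hc
  have hc0 : 0 ≤ c := Nat.cast_nonneg _
  -- One tolerance `s` serves for the frequency error, the step defect and `N⁻¹`; the total error is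
  -- continuous in `s` and vanishes at `0`.
  obtain ⟨s, hs0, hs⟩ : ∃ s : ℝ, 0 < s ∧ (T * s + c * (s * (D + T * (L * (D + s)))) +
      T * (L * D * s)) * Real.exp (L * T) + D * s ≤ ε := by
    have hcont : Continuous fun s : ℝ => (T * s + c * (s * (D + T * (L * (D + s)))) +
      T * (L * D * s)) * Real.exp (L * T) + D * s := by fun_prop
    have h0 : ∀ᶠ s in 𝓝 (0 : ℝ), (T * s + c * (s * (D + T * (L * (D + s)))) +
      T * (L * D * s)) * Real.exp (L * T) + D * s < ε :=
      hcont.continuousAt.eventually_lt_const (by simpa using hε)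
    obtain ⟨s, hs, hs'⟩ := ((h0.filter_mono nhdsWithin_le_nhds).and
      (self_mem_nhdsWithin : Set.Ioi (0 : ℝ) ∈ 𝓝[>] 0)).exists
    exact ⟨s, hs', hs.le⟩
  have hsqrt : Tendsto (fun N : ℕ => (√(N : ℝ))⁻¹) atTop (𝓝 0) :=
    tendsto_inv_atTop_zero.comp (Real.tendsto_sqrt_atTop.comp tendsto_natCast_atTop_atTop)
  set b := B + 1 with hb
  set Cκ := 2 * K ^ 2 * V + (2 * b * K ^ 2 + 2 * b ^ 2 * K ^ 2 * V) * V ^ 2 with hCκ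
  set C₂ := (α * (ρ + 2 * M₀)) ^ 2 * (b * K ^ 3 * V ^ 2 + b ^ 3 * K ^ 3 * V ^ 4) with hC₂
  set e : ℕ → ℝ := fun N => ∑ ζ, ∑ ζ',
    |M.empiricalKernel σ α (fun i : Fin N => θ i) ζ ζ' - A ζ ζ'| with he
  have he0 : Tendsto e atTop (𝓝 0) := by
    have : Tendsto e atTop (𝓝 (∑ ζ : M.Pair, ∑ ζ' : M.Pair, |A ζ ζ' - A ζ ζ'|)) :=
      tendsto_finsetSum _ fun ζ _ => tendsto_finsetSum _ fun ζ' _ =>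
        ((hker ζ ζ').sub_const _).abs
    simpa using this
  have hele : ∀ N ζ ζ', |M.empiricalKernel σ α (fun i : Fin N => θ i) ζ ζ' - A ζ ζ'| ≤ e N :=
    fun N ζ ζ' => (Finset.single_le_sum (f := fun ζ' => |M.empiricalKernel σ α
      (fun i : Fin N => θ i) ζ ζ' - A ζ ζ'|) (fun _ _ => abs_nonneg _) (Finset.mem_univ ζ')).trans
      (Finset.single_le_sum (f := fun ζ => ∑ ζ', |M.empiricalKernel σ α (fun i : Fin N => θ i) ζ ζ' -
        A ζ ζ'|) (fun _ _ => Finset.sum_nonneg fun _ _ => abs_nonneg _) (Finset.mem_univ ζ))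
  -- The step defect collects the second-order remainder, the change of the kernel since
  -- initialization and the law of large numbers error `e N`.
  have hrate : Tendsto (fun N : ℕ => (√(N : ℝ))⁻¹ * C₂ +
      (ρ + 2 * M₀) * (α * (Cκ * (C * (√(N : ℝ))⁻¹)) + e N)) atTop (𝓝 0) := by
    have := (hsqrt.mul_const C₂).add (((((hsqrt.const_mul C).const_mul Cκ).const_mul α).add
      he0).const_mul (ρ + 2 * M₀))
    simpa using this
  have hdisp : Tendsto (fun N : ℕ => C * (√(N : ℝ))⁻¹) atTop (𝓝 0) := by
    simpa using hsqrt.const_mul C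
  have hκ := eventually_all.2 fun ξ => eventually_forall_abs_le_of_tendsto
    (S := fun n => ∑ k ∈ Finset.range n,
      ((if ((x k, a k), x (k + 1)) = ξ then (1 : ℝ) else 0) - M.transitionFreq ϖ ξ))
    (by simp) (hfreq ξ) hT hs0
  filter_upwards [eventually_ge_atTop N₀, hκ, hrate.eventually_le_const hs0,
    hdisp.eventually_le_const hε,
    (tendsto_inv_atTop_nhds_zero_nat (𝕜 := ℝ)).eventually_le_const hs0]
    with N hNN hκN hrateN hdispN hNs hNz hqR φ hφ t ht
  have hN0 : (0 : ℝ) < N := Nat.cast_pos.2 (NeZero.pos N)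
  have hNi : 0 < (N : ℝ)⁻¹ := inv_pos.2 hN0
  have htraj := hN₀ N hNN (fun i : Fin N => θ i) x a (fun i => hB i) hqR
  have hfloor : ∀ r ∈ Set.Icc 0 T, ((⌊N * r⌋₊ : ℕ) : ℝ) ≤ N * r := fun r hr =>
    Nat.floor_le (mul_nonneg hN0.le hr.1)
  have hfloorT : ((⌊N * t⌋₊ : ℕ) : ℝ) ≤ N * T :=
    (hfloor t ht).trans (mul_le_mul_of_nonneg_left ht.2 hN0.le)
  refine ⟨?_, fun i => ⟨((htraj _ hfloorT).2 i).2.1.trans hdispN,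
    ((htraj _ hfloorT).2 i).2.2.trans hdispN⟩⟩
  set n := ⌊(N : ℝ) * T⌋₊ with hn
  have hnT : (n : ℝ) ≤ N * T := hfloor T ⟨hT, le_rfl⟩
  have hkn : ∀ k ≤ n, (k : ℝ) ≤ N * T := fun k hk =>
    le_trans (by exact_mod_cast hk) hnT
  set q : ℕ → M.Pair → ℝ := fun k =>
    M.qNet σ (M.trainedParams σ γ (α / N) (fun i : Fin N => θ i) x a k) with hq
  have hDφ : ∀ r ∈ Set.Icc 0 T, ‖M.drift σ γ α μ₀ ϖ (φ r)‖ ≤ D := by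
    intro r hr
    refine (M.norm_drift_le hϖ hĀ hA hγ0 hγ1 hρ hd.abs_r_le _).trans ?_
    have h1 : ‖φ r‖ ≤ R' := by
      refine (hφ.norm_le (K := L) (C := Ā * ρ) (fun u => ?_) hr).trans ?_
      · exact (M.norm_drift_le hϖ hĀ hA hγ0 hγ1 hρ hd.abs_r_le u).trans (by rw [hL]; linarith)
      · refine (gronwallBound_mono (norm_nonneg _) (by positivity) hL0 hr.2).trans ?_
        rw [hR']
        unfold gronwallBound
        split_ifs <;> gcongr
    have h2 : ‖φ r‖ ≤ max R' M₀ := h1.trans (le_max_left _ _)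
    rw [hD]
    gcongr
  have hφ' : IsODESolution (M.drift σ γ α μ₀ ϖ) T (q 0) φ := hφ
  have hmain := norm_sub_le_of_averaging (b := M.increment A γ) (q := M.transitionFreq ϖ)
    (f := M.drift σ γ α μ₀ ϖ) (M.drift_eq_sum_increment σ γ α μ₀ ϖ) (L := L) (D := D) (M := M₀)
    (κ := s) (ρ := s) hL0 hT (fun ξ u v => M.norm_increment_sub_le hĀ hA hγ0 hγ1 ξ u v)
    (fun u v => M.norm_drift_sub_le hϖ hĀ hA hγ0 hγ1 u v)
    (fun ξ u hu => (M.norm_increment_le hĀ hA hγ0 hγ1 hρ hd.abs_r_le ξ u).trans (by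
      have := hu.trans (le_max_right R' M₀)
      rw [hD]
      gcongr))
    hN0 hnT (ξ := fun k => ((x k, a k), x (k + 1))) (h := q)
    (fun k hk => (htraj k (hkn k hk)).1)
    (fun k hk => by
      have hk' := htraj k (hkn k hk.le)
      refine (M.norm_qNet_qStep_sub_sub_le hd hγ0 hγ1 (fun i => (hk'.2 i).1) hk'.1
        (e := α * (Cκ * (C * (√(N : ℝ))⁻¹)) + e N) (fun ζ ζ' => ?_) (x k, a k) (x (k + 1))).trans
        (mul_le_mul_of_nonneg_right hrateN hNi.le)
      refine (abs_sub_le _ (M.empiricalKernel σ α (fun i : Fin N => θ i) ζ ζ') _).trans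
        (add_le_add ?_ (hele N ζ ζ'))
      exact M.abs_empiricalKernel_sub_le hd.activation hd.norm_vec_le hα (fun i => (hk'.2 i).1)
        (fun i => (hB i).trans (by rw [hb]; linarith)) (fun i => (hk'.2 i).2.1)
        (fun i => (hk'.2 i).2.2) ζ ζ')
    hs0.le (fun k hk ξ => by convert hκN ξ k (hkn k hk)) hφ' hDφ
    (Nat.floor_mono (mul_le_mul_of_nonneg_left ht.2 hN0.le) : ⌊N * t⌋₊ ≤ n)
  have hmem : (⌊N * t⌋₊ : ℝ) * (N : ℝ)⁻¹ ∈ Set.Icc 0 T := by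
    refine ⟨by positivity, ?_⟩
    rw [← div_eq_mul_inv, div_le_iff₀ hN0]
    linarith
  -- The averaging lemma compares at grid times; this passes from `⌊N t⌋ / N` to `t`.
  have hshift : ‖φ (⌊N * t⌋₊ * (N : ℝ)⁻¹) - φ t‖ ≤ D * (N : ℝ)⁻¹ := by
    refine (hφ.norm_sub_le hDφ ht hmem).trans (mul_le_mul_of_nonneg_left ?_ hD0)
    have h1 := hfloor t ht
    have h2 := Nat.lt_floor_add_one ((N : ℝ) * t)
    have h3 : (⌊N * t⌋₊ : ℝ) * (N : ℝ)⁻¹ - t = (⌊N * t⌋₊ - N * t) * (N : ℝ)⁻¹ := by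
      field_simp
    rw [h3, abs_mul, abs_of_pos hNi]
    refine mul_le_of_le_one_left hNi.le ?_
    rw [abs_le]
    constructor <;> linarith
  refine (norm_sub_le_norm_sub_add_norm_sub _ (φ (⌊N * t⌋₊ * (N : ℝ)⁻¹)) _).trans
    ((add_le_add hmain hshift).trans (le_trans ?_ hs))
  rw [← hc]
  gcongr

end MDP

/-! ### Uniform estimates in the Skorokhod space -/

namespace SkorokhodSpace

variable {T : ℝ} {E : Type*}

/-- A continuous path as an element of the Skorokhod space. -/
def ofContinuous [TopologicalSpace E] (u : Set.Icc (0 : ℝ) T → E) (hu : Continuous u) :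
    SkorokhodSpace T E where
  toFun := u
  right_continuous _ := hu.continuousWithinAt
  left_limits t := ⟨u t, hu.continuousAt.tendsto.mono_left nhdsWithin_le_nhds⟩

/-- The identity is an admissible time change. -/
theorem edist_le [PseudoEMetricSpace E] {u v : SkorokhodSpace T E} {ε : ℝ≥0∞}
    (h : ∀ t, edist (u t) (v t) ≤ ε) : edist u v ≤ ε := by
  refine (iInf_le _ (OrderIso.refl _)).trans (max_le (iSup_le fun t => ?_) (iSup_le h))
  simp

theorem floor_mul_le (N : ℕ) (t : Set.Icc (0 : ℝ) T) : ⌊(N : ℝ) * t⌋₊ ≤ ⌊(N : ℝ) * T⌋₊ :=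
  Nat.floor_mono (mul_le_mul_of_nonneg_left t.2.2 (Nat.cast_nonneg _))

theorem ofSeq_congr [TopologicalSpace E] {N : ℕ} {u v : ℕ → E}
    (h : ∀ k ≤ ⌊(N : ℝ) * T⌋₊, u k = v k) : ofSeq T N u = ofSeq T N v := by
  unfold ofSeq
  congr 1
  funext t
  exact h _ (floor_mul_le N t)

/-- Only the finitely many indices up to `⌊N T⌋` are visited, so continuity of each term gives
closeness uniform in time. -/
theorem continuous_ofSeq [PseudoEMetricSpace E] {X : Type*} [TopologicalSpace X] (N : ℕ)
    {u : X → ℕ → E} (hu : ∀ k, Continuous fun y => u y k) :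
    Continuous fun y => ofSeq T N (u y) := by
  refine continuous_iff_continuousAt.2 fun y => EMetric.tendsto_nhds.2 fun ε hε => ?_
  obtain ⟨δ, hδ, hδε⟩ := exists_between hε
  have h : ∀ k, ∀ᶠ z in 𝓝 y, edist (u z k) (u y k) < δ := fun k =>
    EMetric.tendsto_nhds.1 (hu k).continuousAt δ hδ
  have h' : ∀ᶠ z in 𝓝 y, ∀ k ∈ Set.Iic ⌊(N : ℝ) * T⌋₊, edist (u z k) (u y k) < δ :=
    (eventually_all_finite (Set.finite_Iic _)).2 fun k _ => h k
  filter_upwards [h'] with z hz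
  exact (edist_le fun t => (hz _ (floor_mul_le N t)).le).trans_lt hδε

end SkorokhodSpace

/-! ### The limit path and the distance to it -/

namespace MDP

variable {dx da : ℕ} (M : MDP dx da)

theorem exists_lipschitzWith_drift (σ : ℝ → ℝ) {γ : ℝ} (hγ0 : 0 ≤ γ) (hγ1 : γ ≤ 1) (α : ℝ)
    (μ₀ : Measure (Param (dx + da))) {ϖ : M.states → ℝ} (hϖ : M.IsLimitingDistribution ϖ) :
    ∃ K, LipschitzWith K (M.drift σ γ α μ₀ ϖ) := by
  refine ⟨2 * ‖M.kernelA σ α μ₀‖₊, LipschitzWith.of_dist_le_mul fun u v => ?_⟩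
  rw [dist_eq_norm, dist_eq_norm]
  exact M.norm_drift_sub_le hϖ (norm_nonneg (M.kernelA σ α μ₀)) (fun ζ ζ' =>
    (norm_le_pi_norm (M.kernelA σ α μ₀ ζ) ζ').trans (norm_le_pi_norm (M.kernelA σ α μ₀) ζ))
    hγ0 hγ1 u v

/-- The path `t ↦ (μ, φ t)`. -/
noncomputable def limitPath {T : ℝ} (μ : ProbabilityMeasure (Param (dx + da)))
    (φ : ℝ → M.Pair → ℝ) (hφ : ContinuousOn φ (Set.Icc 0 T)) : SkorokhodSpace T M.E :=
  SkorokhodSpace.ofContinuous (fun t => (LevyProkhorov.ofMeasure μ, φ t))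
    (continuous_const.prodMk (continuousOn_iff_continuous_domRestrict.1 hφ))

theorem solvesLimitEquation_limitPath {σ : ℝ → ℝ} {γ α : ℝ} {μ₀ : Measure (Param (dx + da))}
    [IsProbabilityMeasure μ₀] {ϖ : M.states → ℝ} {T : ℝ} (hT : 0 ≤ T) {K : NNReal}
    (hK : LipschitzWith K (M.drift σ γ α μ₀ ϖ)) {g : M.Pair → ℝ} {φ : ℝ → M.Pair → ℝ}
    (hφ : IsODESolution (M.drift σ γ α μ₀ ϖ) T g φ) :
    M.SolvesLimitEquation σ γ α μ₀ ϖ hT g (M.limitPath ⟨μ₀, inferInstance⟩ φ hφ.continuousOn) where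
  initial := hφ.initial
  output t ζ := by
    have hsub : Set.Icc (0 : ℝ) t ⊆ Set.Icc 0 T := Set.Icc_subset_Icc_right t.2.2
    have hcont : ContinuousOn (fun s => M.drift σ γ α μ₀ ϖ (φ s) ζ) (Set.Icc 0 T) :=
      (continuous_apply ζ).comp_continuousOn (hK.continuous.comp_continuousOn hφ.continuousOn)
    have h1 : ∫ s in (0 : ℝ)..t, M.drift σ γ α μ₀ ϖ (φ s) ζ = φ t ζ - φ 0 ζ := by
      refine intervalIntegral.integral_eq_sub_of_hasDeriv_right_of_le t.2.1
        ((continuous_apply ζ).comp_continuousOn (hφ.continuousOn.mono hsub)) (fun s hs => ?_) ?_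
      · exact (hasDerivWithinAt_pi.1 (hφ.hasDeriv_Ici ⟨hs.1.le, hs.2.trans_le t.2.2⟩) ζ).mono
          Set.Ioi_subset_Ici_self
      · exact (hcont.mono hsub).intervalIntegrable_of_Icc t.2.1
    have h2 : ∫ s in (0 : ℝ)..t, M.drift σ γ α μ₀ ϖ
        (M.limitPath ⟨μ₀, inferInstance⟩ φ hφ.continuousOn (Set.projIcc 0 T hT s)).2 ζ =
        ∫ s in (0 : ℝ)..t, M.drift σ γ α μ₀ ϖ (φ s) ζ := by
      refine intervalIntegral.integral_congr fun s hs => ?_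
      rw [Set.uIcc_of_le t.2.1] at hs
      have h3 : (Set.projIcc 0 T hT s : ℝ) = s := by
        rw [Set.projIcc_of_mem hT (hsub hs)]
      change M.drift σ γ α μ₀ ϖ (φ (Set.projIcc 0 T hT s)) ζ = _
      rw [h3]
    rw [h2, h1]
    change φ t ζ = φ 0 ζ + _
    ring
  measure _ _ _ := rfl
  measure_eq _ := rfl

/-- Gronwall dependence on the initial value; it makes the solution map continuous into the
Skorokhod space, as continuous mapping requires. -/
theorem edist_limitPath_le {σ : ℝ → ℝ} {γ α : ℝ} {μ₀ : Measure (Param (dx + da))}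
    {ϖ : M.states → ℝ} {T : ℝ} {K : NNReal} (hK : LipschitzWith K (M.drift σ γ α μ₀ ϖ))
    (μ : ProbabilityMeasure (Param (dx + da))) {g g' : M.Pair → ℝ} {φ φ' : ℝ → M.Pair → ℝ}
    (hφ : IsODESolution (M.drift σ γ α μ₀ ϖ) T g φ)
    (hφ' : IsODESolution (M.drift σ γ α μ₀ ϖ) T g' φ') :
    edist (M.limitPath μ φ hφ.continuousOn) (M.limitPath μ φ' hφ'.continuousOn) ≤
      (Real.exp (K * T)).toNNReal * edist g g' := by
  refine SkorokhodSpace.edist_le fun t => ?_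
  change edist (_, φ t) (_, φ' t) ≤ _
  rw [Prod.edist_eq, edist_self, zero_max, edist_dist, edist_dist, ← ENNReal.ofReal,
    ← ENNReal.ofReal_mul (Real.exp_nonneg _)]
  refine ENNReal.ofReal_le_ofReal ((hφ.dist_le hφ' hK t.2).trans ?_)
  rw [mul_comm]
  gcongr
  exact t.2.2

open scoped Classical in
/-- Along a fixed realization, the distance between the rescaled process and the solution of the
limit equation with the same initial output tends to zero, locally uniformly in that output. -/
theorem eventually_edist_scaledPath_le {σ : ℝ → ℝ} (hσ : IsC2b σ) {γ : ℝ} (hγ0 : 0 ≤ γ)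
    (hγ1 : γ ≤ 1) {α : ℝ} (hα : 0 ≤ α) {T : ℝ} (hT : 0 ≤ T) {μ₀ : Measure (Param (dx + da))}
    {ϖ : M.states → ℝ} (hϖ : M.IsLimitingDistribution ϖ) {θ : ℕ → Param (dx + da)} {B : ℝ}
    (hB : ∀ i, |(θ i).1| ≤ B) {x : ℕ → M.states} {a : ℕ → M.actions}
    (hker : ∀ ζ ζ', Tendsto (fun N : ℕ => M.empiricalKernel σ α (fun i : Fin N => θ i) ζ ζ') atTop
      (𝓝 (M.kernelA σ α μ₀ ζ ζ')))
    (hfreq : ∀ ξ, Tendsto (fun n : ℕ => (n : ℝ)⁻¹ * ∑ k ∈ Finset.range n,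
      ((if ((x k, a k), x (k + 1)) = ξ then (1 : ℝ) else 0) - M.transitionFreq ϖ ξ)) atTop (𝓝 0))
    {μ : ProbabilityMeasure (Param (dx + da))}
    (hemp : Tendsto (fun N : ℕ+ => empiricalMeasure fun i : Fin N => θ i) atTop (𝓝 μ))
    {R : ℝ} (hR : 0 ≤ R) {ε : ℝ} (hε : 0 < ε) :
    ∀ᶠ N : ℕ+ in atTop, ‖M.qNet σ (fun i : Fin N => θ i)‖ ≤ R →
      ∀ φ (hφ : IsODESolution (M.drift σ γ α μ₀ ϖ) T (M.qNet σ (fun i : Fin N => θ i)) φ),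
        edist (M.scaledPath σ γ α T N (fun i : Fin N => θ i) x a)
          (M.limitPath μ φ hφ.continuousOn) ≤ ENNReal.ofReal ε := by
  have h1 := tendsto_PNat_val_atTop_atTop.eventually (M.eventually_norm_qNet_sub_le hσ hγ0 hγ1 hα hT
    hϖ hB hker hfreq hR (half_pos hε))
  have h2 : Tendsto (fun N : ℕ+ => LevyProkhorov.ofMeasure
      (empiricalMeasure fun i : Fin N => θ i)) atTop (𝓝 (LevyProkhorov.ofMeasure μ)) :=
    (LevyProkhorov.continuous_ofMeasure_probabilityMeasure.tendsto μ).comp hemp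
  have h3 := EMetric.tendsto_nhds.1 h2 (ENNReal.ofReal (ε / 2))
    (ENNReal.ofReal_pos.2 (half_pos hε))
  filter_upwards [h1, h3] with N hN1 hN3 hqR φ hφ
  refine SkorokhodSpace.edist_le fun t => ?_
  obtain ⟨h4, h5⟩ := hN1 hqR φ hφ t t.2
  change edist (LevyProkhorov.ofMeasure (empiricalMeasure (M.trainedParams σ γ (α / (N : ℕ))
    (fun i : Fin N => θ i) x a ⌊((N : ℕ) : ℝ) * t⌋₊)), M.qNet σ (M.trainedParams σ γ (α / (N : ℕ))
    (fun i : Fin N => θ i) x a ⌊((N : ℕ) : ℝ) * t⌋₊)) (LevyProkhorov.ofMeasure μ, φ t) ≤ _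
  rw [Prod.edist_eq]
  refine max_le ?_ ?_
  -- Half of `ε` pays for the motion of the atoms since initialization, half for the convergence of
  -- the initial empirical measure.
  · refine (edist_triangle _ (LevyProkhorov.ofMeasure
      (empiricalMeasure fun i : Fin N => θ i)) _).trans ?_
    have h6 : ENNReal.ofReal ε = ENNReal.ofReal (ε / 2) + ENNReal.ofReal (ε / 2) := by
      rw [← ENNReal.ofReal_add (half_pos hε).le (half_pos hε).le, add_halves]
    rw [h6]
    refine add_le_add (levyProkhorovEDist_empiricalMeasure_le _ _ fun i => ?_) hN3.le
    rw [edist_dist]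
    refine ENNReal.ofReal_le_ofReal ?_
    rw [Prod.dist_eq, Real.dist_eq, dist_eq_norm]
    exact max_le (h5 i).1 (h5 i).2
  · rw [edist_dist, dist_eq_norm]
    exact ENNReal.ofReal_le_ofReal (h4.trans (half_le_self hε.le))

/-! ### Measurability of the trained network -/

theorem continuous_qNet {σ : ℝ → ℝ} (hσ : Continuous σ) (N : ℕ) :
    Continuous fun θ : Fin N → Param (dx + da) => M.qNet σ θ := by
  refine continuous_pi fun ζ => ?_
  unfold qNet
  fun_prop

theorem maxAction_continuous (z : M.states) : Continuous fun h => M.maxAction h z := by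
  refine LipschitzWith.continuous (K := 1) (LipschitzWith.of_dist_le_mul fun h h' => ?_)
  rw [NNReal.coe_one, one_mul, Real.dist_eq, dist_eq_norm]
  exact M.abs_maxAction_sub_le h h' z

theorem continuous_trainedParams {σ : ℝ → ℝ} {K : ℝ} (hσ : ActivationBound σ K) (γ η : ℝ) (N : ℕ)
    (x : ℕ → M.states) (a : ℕ → M.actions) (k : ℕ) :
    Continuous fun θ : Fin N → Param (dx + da) => M.trainedParams σ γ η θ x a k := by
  have h1 := hσ.continuous
  have h2 := hσ.continuous_deriv
  induction k with
  | zero => exact continuous_id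
  | succ k ih =>
    have hq := (M.continuous_qNet h1 N).comp ih
    have hδ : Continuous fun θ : Fin N → Param (dx + da) =>
        M.tdError σ γ (M.trainedParams σ γ η θ x a k) (x k, a k) (x (k + 1)) :=
      (continuous_const.add (((M.maxAction_continuous _).comp hq).const_mul γ)).sub
        ((continuous_apply _).comp hq)
    refine continuous_pi fun i => ?_
    have hi := (continuous_apply i).comp ih
    have hi1 : Continuous fun θ : Fin N → Param (dx + da) =>
      (M.trainedParams σ γ η θ x a k i).1 := continuous_fst.comp hi
    have hi2 : Continuous fun θ : Fin N → Param (dx + da) =>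
      (M.trainedParams σ γ η θ x a k i).2 := continuous_snd.comp hi
    simp only [trainedParams, qStep]
    fun_prop

theorem continuous_scaledPath {σ : ℝ → ℝ} {K : ℝ} (hσ : ActivationBound σ K) (γ α T : ℝ) (N : ℕ)
    [NeZero N] (x : ℕ → M.states) (a : ℕ → M.actions) :
    Continuous fun θ : Fin N → Param (dx + da) => M.scaledPath σ γ α T N θ x a :=
  SkorokhodSpace.continuous_ofSeq N fun k =>
    (continuous_empiricalMeasure.comp (M.continuous_trainedParams hσ _ _ N x a k)).prodMk
      ((M.continuous_qNet hσ.continuous N).comp (M.continuous_trainedParams hσ _ _ N x a k))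

theorem trainedParams_congr (σ : ℝ → ℝ) (γ η : ℝ) {N : ℕ} (θ : Fin N → Param (dx + da))
    {x x' : ℕ → M.states} {a a' : ℕ → M.actions} {k : ℕ} (hx : ∀ j ≤ k, x j = x' j)
    (ha : ∀ j ≤ k, a j = a' j) :
    M.trainedParams σ γ η θ x a k = M.trainedParams σ γ η θ x' a' k := by
  induction k with
  | zero => rfl
  | succ k ih =>
    simp only [trainedParams]
    rw [ih (fun j hj => hx j (hj.trans k.le_succ)) (fun j hj => ha j (hj.trans k.le_succ)),
      hx k k.le_succ, hx (k + 1) le_rfl, ha k k.le_succ]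

theorem scaledPath_congr (σ : ℝ → ℝ) (γ α T : ℝ) {N : ℕ} [NeZero N]
    (θ : Fin N → Param (dx + da)) {x x' : ℕ → M.states} {a a' : ℕ → M.actions}
    (hx : ∀ j ≤ ⌊(N : ℝ) * T⌋₊, x j = x' j) (ha : ∀ j ≤ ⌊(N : ℝ) * T⌋₊, a j = a' j) :
    M.scaledPath σ γ α T N θ x a = M.scaledPath σ γ α T N θ x' a' := by
  refine SkorokhodSpace.ofSeq_congr fun k hk => ?_
  rw [M.trainedParams_congr σ γ _ θ (fun j hj => hx j (hj.trans hk))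
    fun j hj => ha j (hj.trans hk)]

/-- A function of the trajectory that depends on finitely many of its terms is measurable as soon
as it is so for each fixed trajectory. -/
theorem IsExplorationChain.measurable_of_congr {M : MDP dx da} {Ω β : Type*} [MeasurableSpace Ω]
    [MeasurableSpace β] {P : Measure Ω} {x : ℕ → Ω → M.states} {a : ℕ → Ω → M.actions}
    (h : M.IsExplorationChain P x a) {F : (ℕ → M.states) → (ℕ → M.actions) → Ω → β}
    (hF : ∀ u b, Measurable (F u b)) (m : ℕ)
    (hcongr : ∀ u u' b b', (∀ k ≤ m, u k = u' k) → (∀ k ≤ m, b k = b' k) → F u b = F u' b') :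
    Measurable fun ω => F (fun k => x k ω) (fun k => a k ω) ω := by
  let p : Ω → (Fin (m + 1) → M.states) × (Fin (m + 1) → M.actions) :=
    fun ω => (fun k => x k ω, fun k => a k ω)
  have hp : Measurable p :=
    (measurable_pi_lambda (fun ω (k : Fin (m + 1)) => x k ω) fun k => h.measurable_state k).prodMk
    (measurable_pi_lambda (fun ω (k : Fin (m + 1)) => a k ω) fun k => h.measurable_action k)
  -- The finite prefix is extended to a sequence by reducing the index modulo `m + 1`; the values
  -- after `m` are irrelevant by `hcongr`. There are finitely many prefixes, so measurability can be
  -- checked one at a time.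
  have hG : Measurable fun y : Ω × (Fin (m + 1) → M.states) × (Fin (m + 1) → M.actions) => F (fun k => y.2.1 (Fin.ofNat (m + 1) k))
      (fun k => y.2.2 (Fin.ofNat (m + 1) k)) y.1 :=
    measurable_from_prod_countable_left fun y => hF (fun k => y.1 (Fin.ofNat (m + 1) k)) fun k => y.2 (Fin.ofNat (m + 1) k)
  have key := hG.comp (measurable_id.prodMk hp)
  convert key using 1
  funext ω
  refine congrFun (hcongr _ _ _ _ (fun k hk => ?_) (fun k hk => ?_)) ω
  · simp [p, Fin.ofNat, Nat.mod_eq_of_lt (Nat.lt_succ_of_le hk)]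
  · simp [p, Fin.ofNat, Nat.mod_eq_of_lt (Nat.lt_succ_of_le hk)]

end MDP

/-- If `X` converges in distribution, it is enough to estimate the events `s n` on the sets where
`X n` is bounded. -/
theorem tendsto_measure_zero_of_tendstoInDistribution {ι F Ω Ω' : Type*} {mΩ : MeasurableSpace Ω}
    {P : Measure Ω} [IsProbabilityMeasure P] {mΩ' : MeasurableSpace Ω'} {P' : Measure Ω'}
    [IsProbabilityMeasure P'] [NormedAddCommGroup F] [MeasurableSpace F] [BorelSpace F]
    {l : Filter ι} {X : ι → Ω → F} {Z : Ω' → F}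
    (hX : TendstoInDistribution X l Z (fun _ => P) P') {s : ι → Set Ω}
    (h : ∀ R : ℝ, 0 ≤ R → Tendsto (fun n => P {ω | ‖X n ω‖ ≤ R ∧ ω ∈ s n}) l (𝓝 0)) :
    Tendsto (fun n => P (s n)) l (𝓝 0) := by
  have hF : ∀ R : ℝ, IsClosed {y : F | R ≤ ‖y‖} := fun R =>
    isClosed_le continuous_const continuous_norm
  refine ENNReal.tendsto_nhds_zero.2 fun η hη => ?_
  have hη2 : 0 < η / 2 := ENNReal.half_pos hη.ne'
  -- The limit law has vanishing tails; portmanteau on the closed tail sets passes the bound to `X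
  -- n` eventually.
  have h1 : Tendsto (fun R : ℕ => (P'.map Z) {y : F | (R : ℝ) ≤ ‖y‖}) atTop (𝓝 0) := by
    have := Measure.isProbabilityMeasure_map (μ := P') hX.aemeasurable_limit
    have h2 := tendsto_measure_iInter_atTop (μ := P'.map Z) (s := fun R : ℕ => {y : F | (R : ℝ) ≤ ‖y‖})
      (fun R => (hF R).measurableSet.nullMeasurableSet)
      (fun R R' hR y hy => (Nat.cast_le.2 hR : (R : ℝ) ≤ R').trans hy) ⟨0, measure_ne_top _ _⟩
    have h3 : ⋂ R : ℕ, {y : F | (R : ℝ) ≤ ‖y‖} = ∅ := by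
      refine Set.eq_empty_iff_forall_notMem.2 fun y hy => ?_
      obtain ⟨n, hn⟩ := exists_nat_gt ‖y‖
      exact absurd (Set.mem_iInter.1 hy n) (not_le.2 hn)
    rwa [h3, measure_empty] at h2
  obtain ⟨R, hR⟩ := (h1.eventually_lt_const hη2).exists
  have h4 := (ProbabilityMeasure.limsup_measure_closed_le_of_tendsto hX.tendsto (hF R)).trans_lt hR
  filter_upwards [eventually_lt_of_limsup_lt h4,
    (ENNReal.tendsto_nhds_zero.1 (h R (Nat.cast_nonneg R))) _ hη2] with n hn hn'
  have hn : (P.map (X n)) {y : F | (R : ℝ) ≤ ‖y‖} < η / 2 := hn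
  rw [Measure.map_apply_of_aemeasurable (hX.forall_aemeasurable n) (hF R).measurableSet] at hn
  calc P (s n) ≤ P ((X n ⁻¹' {y : F | (R : ℝ) ≤ ‖y‖}) ∪ {ω | ‖X n ω‖ ≤ R ∧ ω ∈ s n}) := by
        refine measure_mono fun ω hω => ?_
        rcases le_total (R : ℝ) ‖X n ω‖ with hle | hle
        · exact Or.inl hle
        · exact Or.inr ⟨hle, hω⟩
    _ ≤ η / 2 + η / 2 := (measure_union_le _ _).trans (add_le_add hn.le hn')
    _ = η := ENNReal.add_halves η

/-! ### The network at initialization and convergence in distribution -/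

namespace MDP

variable {dx da : ℕ} (M : MDP dx da)

/-- The covariance matrix of the initial output. -/
noncomputable def initialCovariance (σ : ℝ → ℝ) (μ₀ : Measure (Param (dx + da))) :
    Matrix M.Pair M.Pair ℝ := fun ζ ζ' =>
  ∫ θ, θ.1 ^ 2 * σ (inner ℝ θ.2 (M.vec ζ)) * σ (inner ℝ θ.2 (M.vec ζ')) ∂μ₀

/-- A Gram matrix again, of the functions `c σ(w·ζ)` in `L²(μ₀)`. -/
theorem posSemidef_initialCovariance {σ : ℝ → ℝ} {K : ℝ} (hσ : ActivationBound σ K)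
    {μ₀ : Measure (Param (dx + da))} (hμ₀ : IsInitialLaw μ₀) :
    (M.initialCovariance σ μ₀).PosSemidef := by
  have hint := M.integrable_sq_mul_mul hσ.continuous hσ.continuous hσ.abs_le hσ.abs_le hμ₀
  refine .of_dotProduct_mulVec_nonneg (Matrix.IsHermitian.ext fun ζ ζ' => ?_) fun y => ?_
  · simp only [initialCovariance, star_trivial]
    exact integral_congr_ae (ae_of_all _ fun θ => mul_right_comm _ _ _)
  · have h1 : star y ⬝ᵥ (M.initialCovariance σ μ₀).mulVec y =
        ∫ θ, θ.1 ^ 2 * (∑ ζ, y ζ * σ (inner ℝ θ.2 (M.vec ζ))) ^ 2 ∂μ₀ := by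
      have h2 : ∀ θ : Param (dx + da), θ.1 ^ 2 * (∑ ζ, y ζ * σ (inner ℝ θ.2 (M.vec ζ))) ^ 2 =
          ∑ ζ, ∑ ζ', y ζ * y ζ' *
            (θ.1 ^ 2 * σ (inner ℝ θ.2 (M.vec ζ)) * σ (inner ℝ θ.2 (M.vec ζ'))) := fun θ => by
        rw [sq (∑ ζ, _), Finset.sum_mul_sum, Finset.mul_sum]
        refine Finset.sum_congr rfl fun ζ _ => ?_
        rw [Finset.mul_sum]
        exact Finset.sum_congr rfl fun ζ' _ => by ring
      simp only [h2]
      rw [integral_finsetSum _ fun ζ _ => integrable_finsetSum _ fun ζ' _ =>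
        (hint ζ ζ').const_mul _]
      simp only [dotProduct, Matrix.mulVec, Pi.star_apply, star_trivial]
      refine Finset.sum_congr rfl fun ζ _ => ?_
      rw [integral_finsetSum _ fun ζ' _ => (hint ζ ζ').const_mul _, Finset.mul_sum]
      refine Finset.sum_congr rfl fun ζ' _ => ?_
      rw [integral_const_mul, initialCovariance]
      ring
    rw [h1]
    exact integral_nonneg fun θ => by positivity

open scoped Classical in
theorem isInitialGaussian_ofLp {σ : ℝ → ℝ} {K : ℝ} (hσ : ActivationBound σ K)
    {μ₀ : Measure (Param (dx + da))} (hμ₀ : IsInitialLaw μ₀) :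
    M.IsInitialGaussian σ μ₀ (multivariateGaussian 0 (M.initialCovariance σ μ₀))
      (fun y => y.ofLp) := by
  set ν := multivariateGaussian (0 : EuclideanSpace ℝ M.Pair) (M.initialCovariance σ μ₀) with hν
  have hid : HasGaussianLaw (fun y : EuclideanSpace ℝ M.Pair => y) ν :=
    IsGaussian.hasGaussianLaw_id
  have hG : HasGaussianLaw (fun y : EuclideanSpace ℝ M.Pair => y.ofLp) ν :=
    hid.map_equiv_fun (PiLp.continuousLinearEquiv 2 ℝ fun _ : M.Pair => ℝ)
  have hmean : ∀ ζ, ∫ y : EuclideanSpace ℝ M.Pair, y ζ ∂ν = 0 := fun ζ => by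
    have h := (PiLp.proj 2 (fun _ : M.Pair => ℝ) ζ : EuclideanSpace ℝ M.Pair →L[ℝ] ℝ).integral_comp_comm
      hid.integrable
    rw [integral_id_multivariateGaussian] at h
    simpa using h
  have hmem : ∀ ζ, MemLp (fun y : EuclideanSpace ℝ M.Pair => y ζ) 2 ν := fun ζ =>
    (hG.eval (X := fun ζ (y : EuclideanSpace ℝ M.Pair) => y ζ) ζ).memLp_two
  refine ⟨hG, hmean, fun ζ ζ' => ?_⟩
  have h := covariance_eq_sub (hmem ζ) (hmem ζ')
  rw [covariance_eval_multivariateGaussian (M.posSemidef_initialCovariance hσ hμ₀), hmean,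
    zero_mul, sub_zero] at h
  exact h.symm

section InitialParameters

variable {σ : ℝ → ℝ} {K : ℝ} {μ₀ : Measure (Param (dx + da))} {Ω : Type*} [MeasurableSpace Ω]
  {P : Measure Ω} {θ₀ : ℕ → Ω → Param (dx + da)}

/-- Independence of `c` and `w` with `c` centred: the initial output needs no recentring in the
central limit theorem, although `σ(w·ζ)` may have non-zero mean. -/
theorem integral_mul_activation_eq_zero (hσ : ActivationBound σ K) (hμ₀ : IsInitialLaw μ₀)
    (ζ : M.Pair) : ∫ θ, θ.1 * σ (inner ℝ θ.2 (M.vec ζ)) ∂μ₀ = 0 := by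
  have hc := hσ.continuous
  have hg : Measurable fun w : EuclideanSpace ℝ (Fin (dx + da)) => σ (inner ℝ w (M.vec ζ)) :=
    Continuous.measurable (by fun_prop)
  have h := (hμ₀.indep.comp measurable_id hg).integral_mul_eq_mul_integral
    (measurable_fst.aestronglyMeasurable) ((hg.comp measurable_snd).aestronglyMeasurable)
  have h' : ∫ θ : Param (dx + da), (id ∘ Prod.fst) θ ∂μ₀ = 0 := hμ₀.mean_c
  rw [h', zero_mul] at h
  exact h

open scoped Classical in
/-- The output of the network at initialization converges to a Gaussian vector. -/
theorem tendstoInDistribution_qNet [IsProbabilityMeasure P] (hσ : ActivationBound σ K)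
    (hμ₀ : IsInitialLaw μ₀)
    (hθ_meas : ∀ i, Measurable (θ₀ i)) (hθ_law : ∀ i, P.map (θ₀ i) = μ₀)
    (hθ_indep : iIndepFun θ₀ P) :
    TendstoInDistribution (fun (N : ℕ+) ω => M.qNet σ fun i : Fin N => θ₀ i ω) atTop
      (fun y => y.ofLp) (fun _ => P) (multivariateGaussian 0 (M.initialCovariance σ μ₀)) := by
  have hc := hσ.continuous
  let F : Param (dx + da) → EuclideanSpace ℝ M.Pair := fun θ =>
    WithLp.toLp 2 fun ζ => θ.1 * σ (inner ℝ θ.2 (M.vec ζ))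
  have hF : Measurable F := by
    refine Continuous.measurable ?_
    exact (PiLp.continuous_toLp 2 _).comp (continuous_pi fun ζ => by fun_prop)
  have hFi : ∀ ζ, Measurable fun θ => F θ ζ := fun ζ =>
    (Continuous.measurable (by fun_prop) : Measurable fun θ : Param (dx + da) =>
      θ.1 * σ (inner ℝ θ.2 (M.vec ζ)))
  have hint : ∀ g : Param (dx + da) → ℝ, Measurable g →
      ∫ ω, g (θ₀ 0 ω) ∂P = ∫ θ, g θ ∂μ₀ := fun g hg => by
    rw [← hθ_law 0, integral_map (hθ_meas 0).aemeasurable hg.aestronglyMeasurable]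
  obtain ⟨B, hB⟩ := hμ₀.bounded_c
  have hB' : ∀ᵐ ω ∂P, |(θ₀ 0 ω).1| ≤ B := by
    rw [← hθ_law 0] at hB
    exact ae_of_ae_map (hθ_meas 0).aemeasurable hB
  have hclt := tendstoInDistribution_multivariateGaussian (P := P) (Y := fun i ω => F (θ₀ i ω))
    (C := B * K) (S := M.initialCovariance σ μ₀) (fun i => hF.comp (hθ_meas i))
    (hθ_indep.comp (fun _ => F) fun _ => hF)
    (fun i => (IdentDistrib.mk (hθ_meas i).aemeasurable (hθ_meas 0).aemeasurable
      ((hθ_law i).trans (hθ_law 0).symm)).comp hF)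
    (by
      filter_upwards [hB'] with ω hω ζ
      change |(θ₀ 0 ω).1 * σ (inner ℝ (θ₀ 0 ω).2 (M.vec ζ))| ≤ B * K
      rw [abs_mul]
      exact mul_le_mul hω (hσ.abs_le _) (abs_nonneg _) ((abs_nonneg _).trans hω))
    (fun ζ => by
      rw [hint (fun θ => F θ ζ) (hFi ζ)]
      exact M.integral_mul_activation_eq_zero hσ hμ₀ ζ)
    (M.posSemidef_initialCovariance hσ hμ₀)
    (fun ζ ζ' => by
      rw [hint (fun θ => F θ ζ * F θ ζ') ((hFi ζ).mul (hFi ζ'))]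
      exact integral_congr_ae (ae_of_all _ fun θ => by
        simp only [F]
        ring))
  have hofLp := hclt.continuous_comp (g := fun y : EuclideanSpace ℝ M.Pair => y.ofLp)
    (PiLp.continuous_ofLp 2 _)
  have heq : ∀ (N : ℕ) (ω : Ω), ((√(N : ℝ))⁻¹ • ∑ k ∈ Finset.range N, F (θ₀ k ω)).ofLp =
      M.qNet σ fun i : Fin N => θ₀ i ω := fun N ω => by
    ext ζ
    rw [qNet, Fin.sum_univ_eq_sum_range
      (fun k => (θ₀ k ω).1 * σ (inner ℝ (θ₀ k ω).2 (M.vec ζ))) N]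
    simp [F]
  have hm : ∀ N : ℕ+, AEMeasurable (fun ω => M.qNet σ fun i : Fin N => θ₀ i ω) P := fun N =>
    ((M.continuous_qNet hc N).measurable.comp
      (measurable_pi_lambda _ fun i => hθ_meas i)).aemeasurable
  refine ⟨hm, hofLp.aemeasurable_limit, ?_⟩
  have h := hofLp.tendsto.comp tendsto_PNat_val_atTop_atTop
  refine h.congr fun N => Subtype.ext ?_
  change Measure.map _ P = Measure.map _ P
  congr 1
  funext ω
  exact heq N ω

/-- The strong law for `unitKernel`, whose `μ₀`-mean times `α` is `A`. -/
theorem ae_tendsto_empiricalKernel (hσ : ActivationBound σ K) (α : ℝ) (hμ₀ : IsInitialLaw μ₀)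
    (hθ_meas : ∀ i, Measurable (θ₀ i)) (hθ_law : ∀ i, P.map (θ₀ i) = μ₀)
    (hθ_indep : iIndepFun θ₀ P) :
    ∀ᵐ ω ∂P, ∀ ζ ζ', Tendsto (fun N : ℕ => M.empiricalKernel σ α (fun i : Fin N => θ₀ i ω) ζ ζ')
      atTop (𝓝 (M.kernelA σ α μ₀ ζ ζ')) := by
  have h1 := hσ.continuous
  have h2 := hσ.continuous_deriv
  rw [ae_all_iff]
  intro ζ
  rw [ae_all_iff]
  intro ζ'
  have hi1 := M.integrable_activation_mul hσ hμ₀ ζ' ζ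
  have hi2 := M.integrable_sq_mul_deriv hσ hμ₀ ζ' ζ
  have hmeas : Measurable fun θ : Param (dx + da) => unitKernel σ θ (M.vec ζ) (M.vec ζ') := by
    unfold unitKernel
    exact Continuous.measurable (by fun_prop)
  filter_upwards [strong_law_comp hθ_meas hθ_law hθ_indep hmeas (hi1.add hi2)] with ω hω
  have h3 : M.kernelA σ α μ₀ ζ ζ' = α * ∫ θ, unitKernel σ θ (M.vec ζ) (M.vec ζ') ∂μ₀ := by
    simp only [kernelA, unitKernel]
    rw [integral_add hi1 hi2, mul_add]
  rw [h3]
  refine (hω.const_mul α).congr fun N => ?_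
  rw [empiricalKernel, Fin.sum_univ_eq_sum_range
    (fun k => unitKernel σ (θ₀ k ω) (M.vec ζ) (M.vec ζ')) N]

theorem exists_ae_forall_abs_fst_le (hμ₀ : IsInitialLaw μ₀)
    (hθ_meas : ∀ i, Measurable (θ₀ i)) (hθ_law : ∀ i, P.map (θ₀ i) = μ₀) :
    ∃ B, ∀ᵐ ω ∂P, ∀ i, |(θ₀ i ω).1| ≤ B := by
  obtain ⟨B, hB⟩ := hμ₀.bounded_c
  refine ⟨B, ae_all_iff.2 fun i => ?_⟩
  rw [← hθ_law i] at hB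
  exact ae_of_ae_map (hθ_meas i).aemeasurable hB

end InitialParameters

/-- Convergence in distribution of the rescaled process. -/
theorem exists_limit_scaledPath {γ : ℝ} (hγ0 : 0 ≤ γ) (hγ1 : γ ≤ 1) {α : ℝ} (hα : 0 ≤ α) {T : ℝ}
    (hT : 0 ≤ T) {σ : ℝ → ℝ} (hσ : IsC2b σ) {μ₀ : Measure (Param (dx + da))}
    (hμ₀ : IsInitialLaw μ₀) {ϖ : M.states → ℝ} (hϖ : M.IsLimitingDistribution ϖ)
    {Ω : Type*} [MeasurableSpace Ω] (P : Measure Ω) [IsProbabilityMeasure P]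
    {θ₀ : ℕ → Ω → Param (dx + da)} (hθ_meas : ∀ i, Measurable (θ₀ i))
    (hθ_law : ∀ i, P.map (θ₀ i) = μ₀) (hθ_indep : iIndepFun θ₀ P)
    {x : ℕ → Ω → M.states} {a : ℕ → Ω → M.actions} (hxa : M.IsExplorationChain P x a) :
    ∃ (Ω' : Type) (_ : MeasurableSpace Ω') (P' : Measure Ω') (_ : IsProbabilityMeasure P')
      (G : Ω' → M.Pair → ℝ) (Z : Ω' → SkorokhodSpace T M.E),
      M.IsInitialGaussian σ μ₀ P' G ∧
      (∀ᵐ ω ∂P', M.SolvesLimitEquation σ γ α μ₀ ϖ hT (G ω) (Z ω)) ∧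
      TendstoInDistribution
        (fun (N : ℕ+) ω => M.scaledPath σ γ α T N (fun i : Fin N => θ₀ i ω)
          (fun k => x k ω) (fun k => a k ω))
        atTop Z (fun _ => P) P' := by
  classical
  have := hμ₀.isProbabilityMeasure
  obtain ⟨K, hK⟩ := hσ.exists_activationBound
  obtain ⟨L, hL⟩ := M.exists_lipschitzWith_drift σ hγ0 hγ1 α μ₀ hϖ
  choose Φ hΦ using fun g : M.Pair → ℝ => exists_isODESolution hL hT g
  let μ : ProbabilityMeasure (Param (dx + da)) := ⟨μ₀, inferInstance⟩
  let flow : (M.Pair → ℝ) → SkorokhodSpace T M.E := fun g => M.limitPath μ (Φ g) (hΦ g).continuousOn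
  have hflow : Continuous flow :=
    LipschitzWith.continuous fun g g' => M.edist_limitPath_le hL μ (hΦ g) (hΦ g')
  have hclt := M.tendstoInDistribution_qNet hK hμ₀ hθ_meas hθ_law hθ_indep
  have hθN : ∀ N : ℕ+, Measurable fun ω => (fun i : Fin N => θ₀ i ω) := fun N =>
    measurable_pi_lambda _ fun i => hθ_meas i
  -- The limit is realized on the Gaussian space itself: `G` is the coordinate vector and `Z` the
  -- solution issued from it.
  refine ⟨EuclideanSpace ℝ M.Pair, inferInstance,
    multivariateGaussian 0 (M.initialCovariance σ μ₀), inferInstance, fun y => y.ofLp,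
    flow ∘ fun y => y.ofLp, M.isInitialGaussian_ofLp hK hμ₀,
    ae_of_all _ fun y => M.solvesLimitEquation_limitPath hT hL (hΦ y.ofLp), ?_⟩
  refine tendstoInDistribution_of_tendsto_measure_edist (hclt.continuous_comp hflow)
    (fun N => (hxa.measurable_of_congr
      (F := fun u b ω => M.scaledPath σ γ α T N (fun i : Fin N => θ₀ i ω) u b)
      (fun u b => (M.continuous_scaledPath hK γ α T N u b).measurable.comp (hθN N))
      ⌊((N : ℕ) : ℝ) * T⌋₊ fun u u' b b' hu hb => funext fun ω =>
        M.scaledPath_congr σ γ α T _ hu hb).aemeasurable) fun ε hε => ?_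
  -- The pathwise estimate is uniform only over bounded initial outputs, and `Q^N(·; θ_0)` need not
  -- stay bounded in `N` along a realization.
  refine tendsto_measure_zero_of_tendstoInDistribution hclt fun R hR => ?_
  have hdist : ∀ N : ℕ+, Measurable fun ω => edist (M.scaledPath σ γ α T N
      (fun i : Fin N => θ₀ i ω) (fun k => x k ω) (fun k => a k ω))
      (flow (M.qNet σ fun i : Fin N => θ₀ i ω)) := fun N =>
    hxa.measurable_of_congr (F := fun u b ω => edist (M.scaledPath σ γ α T N
      (fun i : Fin N => θ₀ i ω) u b) (flow (M.qNet σ fun i : Fin N => θ₀ i ω)))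
      (fun u b => (((M.continuous_scaledPath hK γ α T N u b).edist
        (hflow.comp (M.continuous_qNet hK.continuous N))).measurable).comp (hθN N))
      ⌊((N : ℕ) : ℝ) * T⌋₊ fun u u' b b' hu hb => funext fun ω => by
        rw [M.scaledPath_congr σ γ α T _ hu hb]
  have hnorm : ∀ N : ℕ+, Measurable fun ω => ‖M.qNet σ fun i : Fin N => θ₀ i ω‖ := fun N =>
    (M.continuous_qNet hK.continuous N).norm.measurable.comp (hθN N)
  rw [← measure_empty (μ := P)]
  refine tendsto_measure_of_ae_tendsto_indicator_of_isFiniteMeasure _ MeasurableSet.empty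
    (fun N => (measurableSet_le (hnorm N) measurable_const).inter
      (measurableSet_le measurable_const (hdist N))) ?_
  obtain ⟨B, hB⟩ := exists_ae_forall_abs_fst_le hμ₀ hθ_meas hθ_law
  filter_upwards [hB, M.ae_tendsto_empiricalKernel hK α hμ₀ hθ_meas hθ_law hθ_indep,
    hxa.ae_tendsto_transition hϖ, ae_tendsto_empiricalMeasure hθ_meas hθ_law hθ_indep]
    with ω h1 h2 h3 h4
  -- The pathwise estimate is used with `ε / 2` because the bad event has a non-strict inequality.
  filter_upwards [M.eventually_edist_scaledPath_le hσ hγ0 hγ1 hα hT hϖ h1 h2 h3 h4 hR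
    (half_pos hε)] with N hN
  refine iff_of_false (fun h => ?_) (Set.notMem_empty ω)
  exact absurd (h.2.trans (hN h.1 _ (hΦ _)))
    (not_le.2 ((ENNReal.ofReal_lt_ofReal_iff hε).2 (half_lt_self hε)))

end MDP

end QLearning

theorem mainTheorem1 {dx da : ℕ} (M : QLearning.MDP dx da)
    (γ : ℝ) (hγ0 : 0 < γ) (hγ1 : γ ≤ 1) (α : ℝ) (hα : 0 < α) (T : ℝ) (hT : 0 < T)
    (σ : ℝ → ℝ) (hσ : QLearning.IsC2b σ)
    (μ₀ : Measure (QLearning.Param (dx + da))) (hμ₀ : QLearning.IsInitialLaw μ₀)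
    (ϖ : M.states → ℝ) (hϖ : M.IsLimitingDistribution ϖ)
    {Ω : Type*} [MeasurableSpace Ω] (P : Measure Ω) [IsProbabilityMeasure P]
    (θ₀ : ℕ → Ω → QLearning.Param (dx + da)) (hθ_meas : ∀ i, Measurable (θ₀ i))
    (hθ_law : ∀ i, P.map (θ₀ i) = μ₀) (hθ_indep : iIndepFun θ₀ P)
    (x : ℕ → Ω → M.states) (a : ℕ → Ω → M.actions) (hxa : M.IsExplorationChain P x a) :
    (∃ (Ω' : Type) (_ : MeasurableSpace Ω') (P' : Measure Ω') (_ : IsProbabilityMeasure P')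
      (G : Ω' → M.Pair → ℝ) (Z : Ω' → QLearning.SkorokhodSpace T M.E),
      M.IsInitialGaussian σ μ₀ P' G ∧
      (∀ᵐ ω ∂P', M.SolvesLimitEquation σ γ α μ₀ ϖ hT.le (G ω) (Z ω)) ∧
      TendstoInDistribution
        (fun (N : ℕ+) ω => M.scaledPath σ γ α T N (fun i : Fin N => θ₀ i ω)
          (fun k => x k ω) (fun k => a k ω))
        atTop Z (fun _ => P) P') ∧
    (γ < 1 → QLearning.NonPolynomial σ → QLearning.SlowlyIncreasing σ →
      QLearning.HasFullSupport μ₀ → M.DistinctDirections →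
      ∃ V : M.Pair → ℝ, M.SolvesBellman γ V ∧
        (∀ V' : M.Pair → ℝ, M.SolvesBellman γ V' → V' = V) ∧
        ∀ h : M.Pair → ℝ, M.IsStationaryPoint σ γ α μ₀ ϖ h ↔ h = V) := by
  refine ⟨M.exists_limit_scaledPath hγ0.le hγ1 hα.le hT.le hσ hμ₀ hϖ P hθ_meas hθ_law hθ_indep
    hxa, fun hγ1' hpoly _ hfull hdir => ?_⟩
  obtain ⟨V, hV, hV'⟩ := M.existsUnique_solvesBellman hγ0 hγ1'
  obtain ⟨K, hK⟩ := hσ.exists_activationBound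
  refine ⟨V, hV, hV', fun h => ?_⟩
  rw [M.isStationaryPoint_iff hK hα hμ₀ hpoly hfull hdir hϖ.pos]
  exact ⟨hV' h, fun h' => h' ▸ hV⟩
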